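/- **Setting.** Let $d\ge 2$, let $\Omega\subset\mathbb R^d$ be bounded and open, and let $A\in L^\infty(\Omega;\mathbb R^{d\times d}_{\rm sym})$ be uniformly positive definite, $\mathbf b\in L^\infty(\Omega)^d$, $c\in L^\infty(\Omega)$, such that $a(u,v)=\int_\Omega A\nabla u\cdot\nabla v+\int_\Omega(\mathbf b\cdot\nabla u)\,v+\int_\Omega cuv$ is elliptic on $H^1_0(\Omega)$, i.e. $a(v,v)\ge C_{\rm ell}\|v\|_{H^1}^2$ for some $C_{\rm ell}>0$. Put $|\!|\!|v|\!|\!|^2=\int_\Omega A\nabla v\cdot\nabla v$. Let $\mathcal K:H^1_0(\Omega)\to H^{-1}(\Omega)=H^1_0(\Omega)'$ be linear and compact. For $f\in L^2(\Omega)$, $\mathbf f\in L^2(\Omega)^d$ let $u\in H^1_0(\Omega)$ solve $a(u,v)=\int_\Omega fv-\int_\Omega\mathbf f\cdot\nabla v$ for all $v\in H^1_0(\Omega)$, and for $w\in H^1_0(\Omega)$ let $z[w]\in H^1_0(\Omega)$ solve $a(v,z[w])=\langle\mathcal Kv,w\rangle+\langle\mathcal Kw,v\rangle$ for all $v\in H^1_0(\Omega)$.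 For a conforming triangulation $\mathcal T_H$ of $\Omega$ into compact simplices let $\mathcal X_H\subset H^1_0(\Omega)$ be the functions that are on each element a polynomial of degree at most $p$ ($p\ge1$ fixed), and let $u_H,z_H[w]\in\mathcal X_H$ be the Galerkin solutions of the two problems in $\mathcal X_H$. **Refinement.** Let $\mathcal T_0$ be a conforming triangulation of $\Omega$ and ${\tt refine}$ a deterministic rule that turns a triangulation $\mathcal T_H$ and a set $\mathcal M\subseteq\mathcal T_H$ into a conforming triangulation of $\Omega$ whose elements are contained in elements of $\mathcal T_H$ and which contains no $T\in\mathcal M$. Let $\mathbb T(\mathcal T_H)$ be the set of all triangulations obtained from $\mathcal T_H$ by finitely many such steps, $\mathbb T=\mathbb T(\mathcal T_0)$, $\mathbb T_N=\{\mathcal T\in\mathbb T:\#\mathcal T-\#\mathcal T_0\le N\}$. Assume: $\#(\mathcal T_H\setminus\mathcal T_h)+\#\mathcal T_H\le\#\mathcal T_h$ for $\mathcal T_H\in\mathbb T$, $\mathcal T_h\in\mathbb T(\mathcal T_H)$; $\#\mathcal T_\ell-\#\mathcal T_0\le C_{\rm mesh}\sum_{j<\ell}\#\mathcal M_j$ whenever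 $\mathcal T_{j+1}={\tt refine}(\mathcal T_j,\mathcal M_j)$ with $\mathcal M_j\subseteq\mathcal T_j$ for all $j$; any $\mathcal T_H,\mathcal T_h\in\mathbb T$ have a common refinement in $\mathbb T(\mathcal T_H)\cap\mathbb T(\mathcal T_h)$ with at most $\#\mathcal T_H+\#\mathcal T_h-\#\mathcal T_0$ elements. **Estimators.** For $\mathcal T_H\in\mathbb T$, $T\in\mathcal T_H$, $v_H\in\mathcal X_H$, $w\in H^1_0(\Omega)$ let indicators $\eta_H(T,v_H)\ge0$ and $\zeta_H(w;T,v_H)\ge0$ be given, the latter for the dual problem linearized at $w$; put $\eta_H(\mathcal U,v_H)=(\sum_{T\in\mathcal U}\eta_H(T,v_H)^2)^{1/2}$, $\eta_H(v_H)=\eta_H(\mathcal T_H,v_H)$, likewise $\zeta_H(w;\mathcal U,v_H)$ and $\zeta_H(w;v_H)$. For a discrete function of the form $z_H[w]$ write $\zeta_H(\mathcal U,z_H[w])=\zeta_H(w;\mathcal U,z_H[w])$ and $\zeta_H(z_H[w])=\zeta_H(w;z_H[w])$. With $C_{\rm stab},C_{\rm rel},C_{\rm drel}>0$ and $0<q_{\rm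 red}<1$, suppose for all $\mathcal T_H\in\mathbb T$ and $\mathcal T_h\in\mathbb T(\mathcal T_H)$: (A1) for all $v_h\in\mathcal X_h$, $v_H\in\mathcal X_H$, $w_h,w_H\in H^1_0(\Omega)$, $\mathcal U\subseteq\mathcal T_h\cap\mathcal T_H$: $|\eta_h(\mathcal U,v_h)-\eta_H(\mathcal U,v_H)|+|\zeta_h(w_h;\mathcal U,v_h)-\zeta_H(w_H;\mathcal U,v_H)|\le C_{\rm stab}\big(|\!|\!|v_h-v_H|\!|\!|+|\!|\!|w_h-w_H|\!|\!|\big)$; (A2) for all $v_H\in\mathcal X_H$, $w\in H^1_0(\Omega)$: $\eta_h(\mathcal T_h\setminus\mathcal T_H,v_H)\le q_{\rm red}\,\eta_H(\mathcal T_H\setminus\mathcal T_h,v_H)$ and $\zeta_h(w;\mathcal T_h\setminus\mathcal T_H,v_H)\le q_{\rm red}\,\zeta_H(w;\mathcal T_H\setminus\mathcal T_h,v_H)$; (A3) for all $w\in H^1_0(\Omega)$: $|\!|\!|u-u_H|\!|\!|\le C_{\rm rel}\,\eta_H(u_H)$ and $|\!|\!|z[w]-z_H[w]|\!|\!|\le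 C_{\rm rel}\,\zeta_H(z_H[w])$; (A4) for all $w\in H^1_0(\Omega)$: $|\!|\!|u_h-u_H|\!|\!|\le C_{\rm drel}\,\eta_H(\mathcal T_H\setminus\mathcal T_h,u_H)$ and $|\!|\!|z_h[w]-z_H[w]|\!|\!|\le C_{\rm drel}\,\zeta_H(\mathcal T_H\setminus\mathcal T_h,z_H[w])$. (If $\zeta_H$ does not depend on $w$, (A1) is implied by the usual stability with right-hand side $C_{\rm stab}|\!|\!|v_h-v_H|\!|\!|$.) **Algorithm A** with parameters $0<\theta\le1$, $C_{\rm mark}\ge1$: starting from $\mathcal T_0$, for $\ell=0,1,2,\dots$ choose sets $\overline{\mathcal M}{}_\ell^{u},\overline{\mathcal M}{}_\ell^{uz}\subseteq\mathcal T_\ell$ of, up to the factor $C_{\rm mark}$, minimal cardinality with $\theta\,\eta_\ell(u_\ell)^2\le\eta_\ell(\overline{\mathcal M}{}_\ell^{u},u_\ell)^2$ and $\theta[\eta_\ell(u_\ell)^2+\zeta_\ell(z_\ell[u_\ell])^2]\le\eta_\ell(\overline{\mathcal M}{}_\ell^{uz},u_\ell)^2+\zeta_\ell(\overline{\mathcal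 M}{}_\ell^{uz},z_\ell[u_\ell])^2$, respectively; choose $\mathcal M_\ell^u\subseteq\overline{\mathcal M}{}_\ell^u$ and $\mathcal M_\ell^{uz}\subseteq\overline{\mathcal M}{}_\ell^{uz}$ with $\#\mathcal M_\ell^u=\#\mathcal M_\ell^{uz}=\min\{\#\overline{\mathcal M}{}_\ell^u,\#\overline{\mathcal M}{}_\ell^{uz}\}$; put $\mathcal T_{\ell+1}={\tt refine}(\mathcal T_\ell,\mathcal M_\ell^u\cup\mathcal M_\ell^{uz})$. Write $P_\ell=\eta_\ell(u_\ell)\,[\eta_\ell(u_\ell)^2+\zeta_\ell(z_\ell[u_\ell])^2]^{1/2}$ and, for $s,t>0$, $\|u\|_{\mathbb A_s}=\sup_{N\in\mathbb N_0}(N+1)^s\min_{\mathcal T_H\in\mathbb T_N}\eta_H(u_H)$, $\|z[u]\|_{\mathbb A_t}=\sup_{N\in\mathbb N_0}(N+1)^t\min_{\mathcal T_H\in\mathbb T_N}\zeta_H(z_H[u])$ in $[0,\infty]$. **Theorem.** (i) For all $0<\theta\le1$ and $C_{\rm mark}\ge1$ there are $\ell_0\in\mathbb N_0$, $C_{\rm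 lin}>0$ and $0<q_{\rm lin}<1$ such that every run of Algorithm A satisfies $P_n\le C_{\rm lin}\,q_{\rm lin}^{\,n-\ell}\,P_\ell$ for all $n\ge\ell\ge\ell_0$. (ii) If moreover $\theta<\theta_{\rm opt}:=(1+C_{\rm stab}^2C_{\rm drel}^2)^{-1}$, then for every $\alpha>0$ there is $C_{\rm opt}>0$ such that, with the same $\ell_0$, every run of Algorithm A satisfies $$P_\ell\le C_{\rm opt}\,\|u\|_{\mathbb A_s}\big(\|u\|_{\mathbb A_s}+\|z[u]\|_{\mathbb A_t}\big)\,(\#\mathcal T_\ell-\#\mathcal T_0)^{-\alpha}$$ for all $s,t>0$ with $\alpha=\min\{2s,s+t\}$ and $\|u\|_{\mathbb A_s}+\|z[u]\|_{\mathbb A_t}<\infty$ and all $\ell\ge\ell_0$ with $\#\mathcal T_\ell>\#\mathcal T_0$. The constants $\ell_0,C_{\rm lin},q_{\rm lin}$ depend only on $\theta$, $q_{\rm red}$, $C_{\rm stab}$, $C_{\rm rel}$, $a(\cdot,\cdot)$ (hence on $\Omega$) and $\mathcal K$; $C_{\rm opt}$ depends in addition only on $C_{\rm drel}$, $C_{\rm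 mesh}$, $C_{\rm mark}$ and $\alpha$. -/

import Mathlib

open MeasureTheory Matrix
open scoped ENNReal

namespace GOAFEM

/-- Euclidean space `ℝ^d`. -/
abbrev E (d : ℕ) : Type := EuclideanSpace ℝ (Fin d)

/-! ### The Sobolev space `H^1_0(Ω)` and its dual -/

/-- Pairs `(v, g)` in `L²(Ω) × L²(Ω)^d` with the norm `(‖v‖² + ‖g‖²)^{1/2}`. -/
abbrev L2Pair {d : ℕ} (Ω : Set (E d)) : Type :=
  WithLp 2 (Lp ℝ 2 (volume.restrict Ω) × Lp (E d) 2 (volume.restrict Ω))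

/-- The pairs `(φ, ∇φ)` with `φ` smooth and compactly supported in `Ω`. -/
def testPairs {d : ℕ} (Ω : Set (E d)) : Set (L2Pair Ω) :=
  {w | ∃ φ : E d → ℝ, ContDiff ℝ ((⊤ : ℕ∞) : WithTop ℕ∞) φ ∧ HasCompactSupport φ ∧ tsupport φ ⊆ Ω ∧
    w.fst =ᵐ[volume.restrict Ω] φ ∧ w.snd =ᵐ[volume.restrict Ω] gradient φ}

/-- `H^1_0(Ω)`: the closure of `C_c^∞(Ω)` in the `H^1`-norm. A function is stored together with its
weak gradient, so the norm inherited from `L2Pair Ω` is the `H^1(Ω)`-norm. -/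
noncomputable def H10 {d : ℕ} (Ω : Set (E d)) : Submodule ℝ (L2Pair Ω) :=
  (Submodule.span ℝ (testPairs Ω)).topologicalClosure

/-- The values of `v ∈ H^1_0(Ω)`. -/
noncomputable def fn {d : ℕ} {Ω : Set (E d)} (v : H10 Ω) : E d → ℝ := (v : L2Pair Ω).fst

/-- The weak gradient of `v ∈ H^1_0(Ω)`. -/
noncomputable def wgrad {d : ℕ} {Ω : Set (E d)} (v : H10 Ω) : E d → E d := (v : L2Pair Ω).snd

/-- `H^{-1}(Ω)`, the dual space of `H^1_0(Ω)`. -/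
abbrev Hneg1 {d : ℕ} (Ω : Set (E d)) : Type := H10 Ω →L[ℝ] ℝ

/-! ### The bilinear form, the energy norm, Galerkin solutions -/

/-- `∫ A ∇u · ∇v`. -/
noncomputable def principalForm {d : ℕ} {Ω : Set (E d)} (A : E d → Matrix (Fin d) (Fin d) ℝ)
    (u v : H10 Ω) : ℝ :=
  ∫ x in Ω, (A x *ᵥ (wgrad u x).ofLp) ⬝ᵥ (wgrad v x).ofLp

/-- `a(u,v) = ∫ A ∇u · ∇v + ∫ (b · ∇u) v + ∫ c u v`. -/
noncomputable def bilin {d : ℕ} {Ω : Set (E d)} (A : E d → Matrix (Fin d) (Fin d) ℝ)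
    (b : E d → E d) (c : E d → ℝ) (u v : H10 Ω) : ℝ :=
  principalForm A u v + (∫ x in Ω, ((b x).ofLp ⬝ᵥ (wgrad u x).ofLp) * fn v x)
    + ∫ x in Ω, c x * fn u x * fn v x

/-- The energy norm `(∫ A ∇v · ∇v)^{1/2}`. -/
noncomputable def energyNorm {d : ℕ} {Ω : Set (E d)} (A : E d → Matrix (Fin d) (Fin d) ℝ)
    (v : H10 Ω) : ℝ :=
  √(principalForm A v v)

/-- The assumptions on the coefficients: essentially bounded and measurable, `A` symmetric and
uniformly positive definite, and `a` elliptic on `H^1_0(Ω)`. -/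
structure AdmissibleCoefficients {d : ℕ} (Ω : Set (E d)) (A : E d → Matrix (Fin d) (Fin d) ℝ)
    (b : E d → E d) (c : E d → ℝ) : Prop where
  memLp_A : ∀ i j, MemLp (fun x => A x i j) ⊤ (volume.restrict Ω)
  memLp_b : MemLp b ⊤ (volume.restrict Ω)
  memLp_c : MemLp c ⊤ (volume.restrict Ω)
  symm : ∀ᵐ x ∂(volume.restrict Ω), (A x).IsSymm
  posDef : ∃ α : ℝ, 0 < α ∧ ∀ᵐ x ∂(volume.restrict Ω), ∀ y : E d,
    α * ‖y‖ ^ 2 ≤ (A x *ᵥ y.ofLp) ⬝ᵥ y.ofLp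
  elliptic : ∃ Cell : ℝ, 0 < Cell ∧ ∀ v : H10 Ω, Cell * ‖v‖ ^ 2 ≤ bilin A b c v v

/-- `F(v) = ∫ f v - ∫ 𝐟 · ∇v`. -/
noncomputable def load {d : ℕ} {Ω : Set (E d)} (f : E d → ℝ) (ff : E d → E d) (v : H10 Ω) : ℝ :=
  (∫ x in Ω, f x * fn v x) - ∫ x in Ω, (ff x).ofLp ⬝ᵥ (wgrad v x).ofLp

/-- The element `u ∈ X` with `a(u, v) = F(v)` for all `v ∈ X` (it exists and is unique by the
Lax--Milgram lemma in all the situations in which it is used). -/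
noncomputable def galerkin {V : Type} [AddCommGroup V] [Module ℝ V] (a : V → V → ℝ) (F : V → ℝ)
    (X : Submodule ℝ V) : V :=
  Classical.epsilon fun u => u ∈ X ∧ ∀ v ∈ X, a u v = F v

/-- Solution of the primal problem in `X`. For `X = ⊤` this is the exact solution `u`. -/
noncomputable def primal {d : ℕ} {Ω : Set (E d)} (A : E d → Matrix (Fin d) (Fin d) ℝ)
    (b : E d → E d) (c : E d → ℝ) (f : E d → ℝ) (ff : E d → E d)
    (X : Submodule ℝ (H10 Ω)) : H10 Ω :=
  galerkin (bilin A b c) (load f ff) X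

/-- Solution in `X` of the dual problem linearized at `w`, i.e.
`a(v, z) = ⟨K v, w⟩ + ⟨K w, v⟩` for all `v ∈ X`. For `X = ⊤` this is the exact solution `z[w]`. -/
noncomputable def dual {d : ℕ} {Ω : Set (E d)} (A : E d → Matrix (Fin d) (Fin d) ℝ)
    (b : E d → E d) (c : E d → ℝ) (K : H10 Ω →L[ℝ] Hneg1 Ω) (w : H10 Ω)
    (X : Submodule ℝ (H10 Ω)) : H10 Ω :=
  galerkin (fun z v => bilin A b c v z) (fun v => K v w + K w v) X

/-! ### Triangulations and finite element spaces -/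

/-- A simplex, given by its finite set of vertices. -/
abbrev Elem (d : ℕ) : Type := Finset (E d)

/-- The compact set spanned by the vertices. -/
def Elem.hull {d : ℕ} (T : Elem d) : Set (E d) := convexHull ℝ (T : Set (E d))

/-- A finite set of simplices. -/
abbrev Mesh (d : ℕ) : Type := Finset (Elem d)

/-- Conforming triangulations of `Ω` into nondegenerate compact simplices: two elements meet in the
simplex spanned by their common vertices. -/
structure IsTriangulation {d : ℕ} (Ω : Set (E d)) (TH : Mesh d) : Prop where
  simplex : ∀ T ∈ TH, T.card = d + 1 ∧ AffineIndependent ℝ (fun x : T => (x : E d))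
  cover : ⋃ T ∈ TH, Elem.hull T = closure Ω
  conforming : ∀ T ∈ TH, ∀ T' ∈ TH,
    Elem.hull T ∩ Elem.hull T' = convexHull ℝ ((T : Set (E d)) ∩ (T' : Set (E d)))

/-- `v` coincides a.e. on the element `T` with a polynomial of total degree at most `p`. -/
def IsPolyOn {d : ℕ} {Ω : Set (E d)} (p : ℕ) (T : Elem d) (v : H10 Ω) : Prop :=
  ∃ q : MvPolynomial (Fin d) ℝ, q.totalDegree ≤ p ∧
    ∀ᵐ x ∂(volume.restrict Ω), x ∈ Elem.hull T → fn v x = MvPolynomial.eval x.ofLp q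

/-- The conforming finite element space of degree `p` on the mesh `TH`. -/
noncomputable def feSpace {d : ℕ} (Ω : Set (E d)) (p : ℕ) (TH : Mesh d) :
    Submodule ℝ (H10 Ω) where
  carrier := {v | ∀ T ∈ TH, IsPolyOn p T v}
  zero_mem' := by
    intro T _
    refine ⟨0, by simp, ?_⟩
    filter_upwards [Lp.coeFn_zero ℝ 2 (volume.restrict Ω)] with x hx _
    simpa [fn] using hx
  add_mem' := by
    intro v w hv hw T hT
    obtain ⟨q, hq, hvq⟩ := hv T hT
    obtain ⟨r, hr, hwr⟩ := hw T hT
    refine ⟨q + r, (MvPolynomial.totalDegree_add q r).trans (max_le hq hr), ?_⟩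
    filter_upwards [hvq, hwr,
      Lp.coeFn_add (v : L2Pair Ω).fst (w : L2Pair Ω).fst] with x h1 h2 h3 hx
    have h4 : fn (v + w) x = fn v x + fn w x := h3
    rw [h4, h1 hx, h2 hx, map_add]
  smul_mem' := by
    intro t v hv T hT
    obtain ⟨q, hq, hvq⟩ := hv T hT
    refine ⟨t • q, (MvPolynomial.totalDegree_smul_le t q).trans hq, ?_⟩
    filter_upwards [hvq, Lp.coeFn_smul t (v : L2Pair Ω).fst] with x h1 h3 hx
    have h4 : fn (t • v) x = t * fn v x := h3
    rw [h4, h1 hx, MvPolynomial.smul_eval]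

/-! ### Mesh refinement -/

/-- A deterministic refinement rule: `refine TH M` is the mesh obtained from `TH` by refining
(at least) the marked elements `M`. -/
abbrev RefineRule (d : ℕ) : Type := Mesh d → Finset (Elem d) → Mesh d

/-- `Refines refine TH Th`: the mesh `Th` results from `TH` by finitely many steps of refinement,
i.e. `Th ∈ 𝕋(TH)`. -/
def Refines {d : ℕ} (refine : RefineRule d) (TH Th : Mesh d) : Prop :=
  Relation.ReflTransGen (fun T T' => ∃ M ⊆ T, T' = refine T M) TH Th

open Classical in
/-- The assumptions on the initial mesh and on the refinement rule, with mesh-closure constant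
`Cmesh`. -/
structure AdmissibleRefinement {d : ℕ} (Ω : Set (E d)) (T0 : Mesh d) (refine : RefineRule d)
    (Cmesh : ℝ) : Prop where
  initial : IsTriangulation Ω T0
  triangulation : ∀ TH, Refines refine T0 TH → ∀ M ⊆ TH, IsTriangulation Ω (refine TH M)
  /-- Every new element is contained in an old one. -/
  subdivision : ∀ TH, Refines refine T0 TH → ∀ M ⊆ TH,
    ∀ T ∈ refine TH M, ∃ T' ∈ TH, Elem.hull T ⊆ Elem.hull T'
  /-- Marked elements are refined. -/
  marked : ∀ TH, Refines refine T0 TH → ∀ M ⊆ TH, M ⊆ TH \ refine TH M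
  /-- Each refined element has at least two sons. -/
  sons : ∀ TH Th, Refines refine T0 TH → Refines refine TH Th →
    (TH \ Th).card + TH.card ≤ Th.card
  /-- Mesh-closure estimate. -/
  meshClosure : ∀ (𝒯 : ℕ → Mesh d) (M : ℕ → Finset (Elem d)), 𝒯 0 = T0 →
    (∀ l, M l ⊆ 𝒯 l ∧ 𝒯 (l + 1) = refine (𝒯 l) (M l)) →
    ∀ l, ((𝒯 l).card : ℝ) - T0.card ≤ Cmesh * ∑ j ∈ Finset.range l, ((M j).card : ℝ)
  /-- Overlay estimate. -/
  overlay : ∀ TH Th, Refines refine T0 TH → Refines refine T0 Th →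
    ∃ To, Refines refine TH To ∧ Refines refine Th To ∧
      To.card + T0.card ≤ TH.card + Th.card

/-! ### Discretization data: everything but `Ω`, the form `a`, and the operator `K` -/

/-- The data of the adaptive finite element discretization: the right-hand side `(f, ff)` of the
primal problem, the polynomial degree `p`, the initial mesh, the refinement rule, and the refinement
indicators `eta TH T v` and `zeta w TH T v`. The latter is the indicator for the dual problem
linearized at `w` (for an indicator that does not use the right-hand side of the dual problem, the
argument `w` is idle). Only values at `T ∈ TH ∈ 𝕋` and `v` in the finite element space on `TH`
matter. -/
structure Discretization {d : ℕ} (Ω : Set (E d)) where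
  f : E d → ℝ
  ff : E d → E d
  p : ℕ
  T0 : Mesh d
  refine : RefineRule d
  eta : Mesh d → Elem d → H10 Ω → ℝ
  zeta : H10 Ω → Mesh d → Elem d → H10 Ω → ℝ

namespace Discretization

variable {d : ℕ} {Ω : Set (E d)} (D : Discretization Ω)

/-- The finite element space on `TH`. -/
noncomputable def X (TH : Mesh d) : Submodule ℝ (H10 Ω) := feSpace Ω D.p TH

/-- `𝕋`, the set of all meshes obtained from the initial mesh. -/
def meshes : Set (Mesh d) := {TH | Refines D.refine D.T0 TH}

/-- `𝕋_N`, the meshes with at most `N` elements more than the initial mesh. -/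
def meshesUpTo (N : ℕ) : Set (Mesh d) := {TH | TH ∈ D.meshes ∧ TH.card ≤ D.T0.card + N}

/-- `η_H(U, v) = (∑_{T ∈ U} η_H(T, v)²)^{1/2}`. -/
noncomputable def etaOn (TH : Mesh d) (U : Finset (Elem d)) (v : H10 Ω) : ℝ :=
  √(∑ T ∈ U, D.eta TH T v ^ 2)

/-- `ζ_H[w](U, v) = (∑_{T ∈ U} ζ_H[w](T, v)²)^{1/2}`. -/
noncomputable def zetaOn (w : H10 Ω) (TH : Mesh d) (U : Finset (Elem d)) (v : H10 Ω) : ℝ :=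
  √(∑ T ∈ U, D.zeta w TH T v ^ 2)

variable (A : E d → Matrix (Fin d) (Fin d) ℝ) (b : E d → E d) (c : E d → ℝ)
  (K : H10 Ω →L[ℝ] Hneg1 Ω)

/-- The exact primal solution `u`. -/
noncomputable def u : H10 Ω := primal A b c D.f D.ff ⊤

/-- The discrete primal solution `u_H`. -/
noncomputable def uH (TH : Mesh d) : H10 Ω := primal A b c D.f D.ff (D.X TH)

/-- The discrete dual solution `z_H[w]`. -/
noncomputable def zH (w : H10 Ω) (TH : Mesh d) : H10 Ω := dual A b c K w (D.X TH)

open Classical in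
/-- The axioms of adaptivity: stability, reduction, reliability, discrete reliability. -/
structure AdaptivityAxioms (Cstab qred Crel Cdrel : ℝ) : Prop where
  eta_nonneg : ∀ TH ∈ D.meshes, ∀ T ∈ TH, ∀ v ∈ D.X TH, 0 ≤ D.eta TH T v
  zeta_nonneg : ∀ w, ∀ TH ∈ D.meshes, ∀ T ∈ TH, ∀ v ∈ D.X TH, 0 ≤ D.zeta w TH T v
  stability : ∀ TH ∈ D.meshes, ∀ Th, Refines D.refine TH Th →
    ∀ vh ∈ D.X Th, ∀ vH ∈ D.X TH, ∀ wh wH : H10 Ω, ∀ U ⊆ Th ∩ TH,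
      |D.etaOn Th U vh - D.etaOn TH U vH| + |D.zetaOn wh Th U vh - D.zetaOn wH TH U vH|
        ≤ Cstab * (energyNorm A (vh - vH) + energyNorm A (wh - wH))
  reduction_eta : ∀ TH ∈ D.meshes, ∀ Th, Refines D.refine TH Th → ∀ vH ∈ D.X TH,
    D.etaOn Th (Th \ TH) vH ≤ qred * D.etaOn TH (TH \ Th) vH
  reduction_zeta : ∀ TH ∈ D.meshes, ∀ Th, Refines D.refine TH Th → ∀ vH ∈ D.X TH,
    ∀ w : H10 Ω, D.zetaOn w Th (Th \ TH) vH ≤ qred * D.zetaOn w TH (TH \ Th) vH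
  reliability_eta : ∀ TH ∈ D.meshes,
    energyNorm A (D.u A b c - D.uH A b c TH) ≤ Crel * D.etaOn TH TH (D.uH A b c TH)
  reliability_zeta : ∀ TH ∈ D.meshes, ∀ w : H10 Ω,
    energyNorm A (dual A b c K w ⊤ - D.zH A b c K w TH)
      ≤ Crel * D.zetaOn w TH TH (D.zH A b c K w TH)
  discreteReliability_eta : ∀ TH ∈ D.meshes, ∀ Th, Refines D.refine TH Th →
    energyNorm A (D.uH A b c Th - D.uH A b c TH)
      ≤ Cdrel * D.etaOn TH (TH \ Th) (D.uH A b c TH)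
  discreteReliability_zeta : ∀ TH ∈ D.meshes, ∀ Th, Refines D.refine TH Th → ∀ w : H10 Ω,
    energyNorm A (D.zH A b c K w Th - D.zH A b c K w TH)
      ≤ Cdrel * D.zetaOn w TH (TH \ Th) (D.zH A b c K w TH)

/-- All standing assumptions on the discretization, with the constants that occur in them. -/
structure Admissible (Cmesh Cstab qred Crel Cdrel : ℝ) : Prop where
  memLp_f : MemLp D.f 2 (volume.restrict Ω)
  memLp_ff : MemLp D.ff 2 (volume.restrict Ω)
  one_le_p : 1 ≤ D.p
  refinement : AdmissibleRefinement Ω D.T0 D.refine Cmesh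
  adaptivity : D.AdaptivityAxioms A b c K Cstab qred Crel Cdrel

/-! ### The adaptive algorithm -/

/-- `η_H(U, u_H)` -/
noncomputable def etaU (TH : Mesh d) (U : Finset (Elem d)) : ℝ := D.etaOn TH U (D.uH A b c TH)

/-- `ζ_H(U, z_H[u_H])`: the dual problem is linearized at `u_H`. -/
noncomputable def zetaZ (TH : Mesh d) (U : Finset (Elem d)) : ℝ :=
  D.zetaOn (D.uH A b c TH) TH U (D.zH A b c K (D.uH A b c TH) TH)

/-- The Dörfler criterion for the primal estimator. -/
def DoerflerU (θ : ℝ) (TH : Mesh d) (M : Finset (Elem d)) : Prop :=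
  θ * D.etaU A b c TH TH ^ 2 ≤ D.etaU A b c TH M ^ 2

/-- The Dörfler criterion for the combined estimator. -/
def DoerflerUZ (θ : ℝ) (TH : Mesh d) (M : Finset (Elem d)) : Prop :=
  θ * (D.etaU A b c TH TH ^ 2 + D.zetaZ A b c K TH TH ^ 2)
    ≤ D.etaU A b c TH M ^ 2 + D.zetaZ A b c K TH M ^ 2

/-- `M ⊆ TH` satisfies `P` and has minimal cardinality up to the factor `Cmark`. -/
def AlmostMinimal (Cmark : ℝ) (TH : Mesh d) (P : Finset (Elem d) → Prop)
    (M : Finset (Elem d)) : Prop :=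
  M ⊆ TH ∧ P M ∧ ∀ M' ⊆ TH, P M' → (M.card : ℝ) ≤ Cmark * M'.card

open Classical in
/-- One step of the adaptive algorithm may lead from the mesh `TH` to the mesh `Th`. -/
def Step (θ Cmark : ℝ) (TH Th : Mesh d) : Prop :=
  ∃ Mu' Muz' Mu Muz : Finset (Elem d),
    AlmostMinimal Cmark TH (D.DoerflerU A b c θ TH) Mu' ∧
    AlmostMinimal Cmark TH (D.DoerflerUZ A b c K θ TH) Muz' ∧
    Mu ⊆ Mu' ∧ Muz ⊆ Muz' ∧
    Mu.card = min Mu'.card Muz'.card ∧ Muz.card = min Mu'.card Muz'.card ∧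
    Th = D.refine TH (Mu ∪ Muz)

/-- `𝒯` is a sequence of meshes that the adaptive algorithm with parameters `θ`, `Cmark` may
produce. -/
def IsRun (θ Cmark : ℝ) (𝒯 : ℕ → Mesh d) : Prop :=
  𝒯 0 = D.T0 ∧ ∀ l, D.Step A b c K θ Cmark (𝒯 l) (𝒯 (l + 1))

/-- The estimator product `η_H(u_H) [η_H(u_H)² + ζ_H(z_H[u_H])²]^{1/2}`. -/
noncomputable def estProduct (TH : Mesh d) : ℝ :=
  D.etaU A b c TH TH * √(D.etaU A b c TH TH ^ 2 + D.zetaZ A b c K TH TH ^ 2)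

/-! ### Approximation classes -/

/-- `‖u‖_{𝔸_s} = sup_N (N+1)^s min_{𝕋_N} η_H(u_H)`. -/
noncomputable def approxU (s : ℝ) : ℝ≥0∞ :=
  ⨆ N : ℕ, ENNReal.ofReal (((N : ℝ) + 1) ^ s) *
    ⨅ TH ∈ D.meshesUpTo N, ENNReal.ofReal (D.etaOn TH TH (D.uH A b c TH))

/-- `‖z[u]‖_{𝔸_t} = sup_N (N+1)^t min_{𝕋_N} ζ_H(z_H[u])`, linearized at the exact solution `u`. -/
noncomputable def approxZ (t : ℝ) : ℝ≥0∞ :=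
  ⨆ N : ℕ, ENNReal.ofReal (((N : ℝ) + 1) ^ t) *
    ⨅ TH ∈ D.meshesUpTo N,
      ENNReal.ofReal (D.zetaOn (D.u A b c) TH TH (D.zH A b c K (D.u A b c) TH))

end Discretization

end GOAFEM

/-!
Let `P_k` be the orthogonal projections onto the nested spaces `X_k` of a run. By Pythagoras
`‖P_k g‖² ≤ ‖g‖²` increases by the square of each increment of `P_k g`, so the steps split into
boundedly many intervals on each of which `P_k g` varies by at most `ε ‖g‖`, with a bound depending
on `ε` only. This property is inherited by sums, products and uniform limits of such operator
sequences, and the Galerkin solution operators of a coercive form are the uniform limit of the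
Richardson iterations built from `P_k`. It therefore holds for the discrete primal and dual
solutions, with the same bound for every run started at any step.

On an interval of steps on which the discrete solutions are nearly constant, each marking for an
estimator reduces it up to a small perturbation. Every step marks for the primal or for the combined
estimator, so after a fixed number of steps one of the two has been marked often enough within one
such interval to make the product of both fall below half of its initial value. This is linear
convergence.

For the rates, a refinement that reduces the product by a fixed factor reduces one of the estimators
so much that the refined elements satisfy its Dörfler criterion. The overlay with quasi-optimal
meshes provides such a refinement, so minimality of the marked sets bounds their cardinality, and by
linear convergence these bounds sum up like a geometric series.
-/

namespace GOAFEM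

/-! ### Oscillation of sequences -/

/-- The natural numbers split into `M` consecutive, possibly empty, intervals (the level sets of a
monotone labelling) on each of which `δ` is at most `ε`. Typically `δ k l` is a distance between
the `k`-th and the `l`-th member of a sequence. -/
def OscillationLE (δ : ℕ → ℕ → ℝ) (ε : ℝ) (M : ℕ) : Prop :=
  ∃ φ : ℕ → ℕ, Monotone φ ∧ (∀ k, φ k < M) ∧ ∀ k l, φ k = φ l → δ k l ≤ ε

theorem exists_monotone_label_refinement {M M' : ℕ} {φ : ℕ → ℕ} {ψ : ℕ → ℕ → ℕ}
    (hφ : Monotone φ) (hφM : ∀ k, φ k < M) (hψ : ∀ c, Monotone (ψ c))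
    (hψM : ∀ c k, ψ c k < M') :
    ∃ χ : ℕ → ℕ, Monotone χ ∧ (∀ k, χ k < M * M') ∧
      ∀ k l, χ k = χ l → φ k = φ l ∧ ψ (φ k) k = ψ (φ k) l := by
  have lt_succ_mul : ∀ c k, c * M' + ψ c k < (c + 1) * M' := fun c k => by
    rw [Nat.succ_mul]
    exact Nat.add_lt_add_left (hψM c k) _
  have label_div : ∀ c k, (c * M' + ψ c k) / M' = c := fun c k =>
    Nat.div_eq_of_lt_le (Nat.le_add_right _ _) (lt_succ_mul c k)
  refine ⟨fun k => φ k * M' + ψ (φ k) k, fun k l hkl => ?_, fun k => ?_, fun k l hkl => ?_⟩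
  · dsimp only
    rcases (hφ hkl).eq_or_lt with heq | hlt
    · rw [← heq]
      exact Nat.add_le_add_left (hψ _ hkl) _
    · exact (lt_succ_mul _ k).le.trans
        ((Nat.mul_le_mul_right _ hlt).trans (Nat.le_add_right _ _))
  · exact (lt_succ_mul _ k).trans_le (Nat.mul_le_mul_right _ (hφM k))
  · have hφkl : φ k = φ l := by
      rw [← label_div (φ k) k, ← label_div (φ l) l]
      exact congrArg (· / M') hkl
    refine ⟨hφkl, Nat.add_left_cancel (n := φ k * M') (hkl.trans ?_)⟩
    dsimp only
    rw [← hφkl]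

namespace OscillationLE

variable {δ δ' : ℕ → ℕ → ℝ} {ε ε' : ℝ} {M M' : ℕ}

theorem mono (h : OscillationLE δ ε M)
    (hδ : ∀ k l, δ k l ≤ ε → δ' k l ≤ ε') : OscillationLE δ' ε' M := by
  obtain ⟨φ, hφ, hφM, hle⟩ := h
  exact ⟨φ, hφ, hφM, fun k l hkl => hδ k l (hle k l hkl)⟩

theorem of_forall_le (h : ∀ k l, δ k l ≤ ε) : OscillationLE δ ε 1 :=
  ⟨fun _ => 0, monotone_const, fun _ => one_pos, fun k l _ => h k l⟩

theorem mono_count (h : OscillationLE δ ε M) (hM : M ≤ M') : OscillationLE δ ε M' := by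
  obtain ⟨φ, hφ, hφM, hle⟩ := h
  exact ⟨φ, hφ, fun k => (hφM k).trans_le hM, hle⟩

theorem add (h : OscillationLE δ ε M) (h' : OscillationLE δ' ε' M') :
    OscillationLE (fun k l => δ k l + δ' k l) (ε + ε') (M * M') := by
  obtain ⟨φ, hφ, hφM, hle⟩ := h
  obtain ⟨ψ, hψ, hψM, hle'⟩ := h'
  obtain ⟨χ, hχ, hχM, hχφ⟩ :=
    exists_monotone_label_refinement (ψ := fun _ => ψ) hφ hφM (fun _ => hψ) (fun _ => hψM)
  exact ⟨χ, hχ, hχM, fun k l hkl =>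
    add_le_add (hle k l (hχφ k l hkl).1) (hle' k l (hχφ k l hkl).2)⟩

end OscillationLE

/-! ### Tame families of operator sequences -/

section Tame

variable {ι V W Z : Type*} [NormedAddCommGroup V] [NormedSpace ℝ V] [NormedAddCommGroup W]
  [NormedSpace ℝ W] [NormedAddCommGroup Z] [NormedSpace ℝ Z]

/-- A family of sequences of operators is tame if it is bounded and if, on each vector `v`, the
number of intervals on which its sequences oscillate by at most `ε * ‖v‖` is bounded uniformly in
the index `i` and in `v`. It replaces pointwise convergence by a property with constants. -/
def IsTame (T : ι → ℕ → V →L[ℝ] W) : Prop :=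
  (∃ B, 0 ≤ B ∧ ∀ i k, ‖T i k‖ ≤ B) ∧
    ∀ ε > 0, ∃ M, ∀ i v, OscillationLE (fun k l => ‖T i k v - T i l v‖) (ε * ‖v‖) M

namespace IsTame

theorem const (T : V →L[ℝ] W) : IsTame fun (_ : ι) (_ : ℕ) => T :=
  ⟨⟨‖T‖, norm_nonneg _, fun _ _ => le_rfl⟩, fun ε hε => ⟨1, fun _ v =>
    .of_forall_le fun _ _ => by rw [sub_self, norm_zero]; positivity⟩⟩

theorem add {S T : ι → ℕ → V →L[ℝ] W} (hS : IsTame S) (hT : IsTame T) :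
    IsTame fun i k => S i k + T i k := by
  obtain ⟨⟨B, hB0, hB⟩, hS⟩ := hS
  obtain ⟨⟨B', hB'0, hB'⟩, hT⟩ := hT
  refine ⟨⟨B + B', by positivity, fun i k =>
    (norm_add_le _ _).trans (add_le_add (hB i k) (hB' i k))⟩, fun ε hε => ?_⟩
  obtain ⟨M, hM⟩ := hS (ε / 2) (half_pos hε)
  obtain ⟨M', hM'⟩ := hT (ε / 2) (half_pos hε)
  refine ⟨M * M', fun i v => ((hM i v).add (hM' i v)).mono fun k l h => ?_⟩
  calc ‖(S i k + T i k) v - (S i l + T i l) v‖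
      = ‖(S i k v - S i l v) + (T i k v - T i l v)‖ := by
        simp only [_root_.add_apply]; congr 1; abel
    _ ≤ ε / 2 * ‖v‖ + ε / 2 * ‖v‖ := (norm_add_le _ _).trans h
    _ = ε * ‖v‖ := by ring

/-- On each interval on which `T i k v` is nearly constant, replace it by one of its values. -/
theorem comp {S : ι → ℕ → W →L[ℝ] Z} {T : ι → ℕ → V →L[ℝ] W} (hS : IsTame S) (hT : IsTame T) :
    IsTame fun i k => (S i k).comp (T i k) := by
  obtain ⟨⟨B, hB0, hB⟩, hS⟩ := hS
  obtain ⟨⟨B', hB'0, hB'⟩, hT⟩ := hT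
  refine ⟨⟨B * B', by positivity, fun i k =>
    (ContinuousLinearMap.opNorm_comp_le _ _).trans (by gcongr; exacts [hB i k, hB' i k])⟩,
    fun ε hε => ?_⟩
  obtain ⟨M, hM⟩ := hT (ε / (4 * (B + 1))) (by positivity)
  obtain ⟨M', hM'⟩ := hS (ε / (2 * (B' + 1))) (by positivity)
  refine ⟨M * M', fun i v => ?_⟩
  obtain ⟨φ, hφ, hφM, hle⟩ := hM i v
  let r : ℕ → ℕ := fun c => Classical.epsilon fun j => φ j = c
  have hr : ∀ k, φ (r (φ k)) = φ k := fun k => Classical.epsilon_spec (p := (φ · = φ k)) ⟨k, rfl⟩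
  choose ψ hψ hψM hle' using fun c => hM' i (T i (r c) v)
  obtain ⟨χ, hχ, hχM, hχφ⟩ := exists_monotone_label_refinement hφ hφM hψ hψM
  refine ⟨χ, hχ, hχM, fun k l hkl => ?_⟩
  obtain ⟨hφkl, hψkl⟩ := hχφ k l hkl
  set w := T i (r (φ k)) v
  have replace_right : ∀ j, φ j = φ k → ‖S i j (T i j v - w)‖ ≤ ε / 4 * ‖v‖ := fun j hj =>
    calc ‖S i j (T i j v - w)‖ ≤ (B + 1) * (ε / (4 * (B + 1)) * ‖v‖) :=
          (S i j).le_of_opNorm_le_of_le ((hB i j).trans (by linarith))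
            (hle j _ (by rw [hr, hj]))
      _ = ε / 4 * ‖v‖ := by field_simp
  have hw : ‖w‖ ≤ (B' + 1) * ‖v‖ :=
    (T i _).le_of_opNorm_le_of_le ((hB' i _).trans (by linarith)) le_rfl
  have change_left : ‖S i k w - S i l w‖ ≤ ε / 2 * ‖v‖ :=
    calc ‖S i k w - S i l w‖ ≤ ε / (2 * (B' + 1)) * ((B' + 1) * ‖v‖) :=
          (hle' (φ k) k l hψkl).trans (by gcongr)
      _ = ε / 2 * ‖v‖ := by field_simp
  calc ‖S i k (T i k v) - S i l (T i l v)‖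
      = ‖S i k (T i k v - w) + (S i k w - S i l w) - S i l (T i l v - w)‖ := by
        simp only [map_sub]; congr 1; abel
    _ ≤ ‖S i k (T i k v - w)‖ + ‖S i k w - S i l w‖ + ‖S i l (T i l v - w)‖ :=
        (norm_sub_le _ _).trans (add_le_add_left (norm_add_le _ _) _)
    _ ≤ ε * ‖v‖ := by linarith [replace_right k rfl, replace_right l hφkl.symm]

theorem const_smul {T : ι → ℕ → V →L[ℝ] W} (hT : IsTame T) (t : ℝ) :
    IsTame fun i k => t • T i k :=
  (const (t • ContinuousLinearMap.id ℝ W)).comp hT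

theorem sub {S T : ι → ℕ → V →L[ℝ] W} (hS : IsTame S) (hT : IsTame T) :
    IsTame fun i k => S i k - T i k := by
  simpa [sub_eq_add_neg] using hS.add (hT.const_smul (-1))

theorem of_uniform_limit {T : ι → ℕ → V →L[ℝ] W}
    (hT : ∀ ε > 0, ∃ S : ι → ℕ → V →L[ℝ] W, IsTame S ∧ ∀ i k, ‖T i k - S i k‖ ≤ ε) :
    IsTame T := by
  refine ⟨?_, fun ε hε => ?_⟩
  · obtain ⟨S, ⟨⟨B, hB0, hB⟩, -⟩, hTS⟩ := hT 1 one_pos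
    refine ⟨1 + B, by positivity, fun i k => ?_⟩
    calc ‖T i k‖ = ‖(T i k - S i k) + S i k‖ := by rw [sub_add_cancel]
      _ ≤ 1 + B := (norm_add_le _ _).trans (add_le_add (hTS i k) (hB i k))
  · obtain ⟨S, ⟨-, hS⟩, hTS⟩ := hT (ε / 4) (by positivity)
    obtain ⟨M, hM⟩ := hS (ε / 2) (half_pos hε)
    refine ⟨M, fun i v => (hM i v).mono fun k l h => ?_⟩
    have close : ∀ j, ‖(T i j - S i j) v‖ ≤ ε / 4 * ‖v‖ := fun j =>
      (T i j - S i j).le_of_opNorm_le (hTS i j) v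
    calc ‖T i k v - T i l v‖
        = ‖(T i k - S i k) v + (S i k v - S i l v) - (T i l - S i l) v‖ := by
          simp only [_root_.sub_apply]; congr 1; abel
      _ ≤ ‖(T i k - S i k) v‖ + ‖S i k v - S i l v‖ + ‖(T i l - S i l) v‖ :=
          (norm_sub_le _ _).trans (add_le_add_left (norm_add_le _ _) _)
      _ ≤ ε * ‖v‖ := by linarith [close k, close l]

end IsTame

end Tame

section Projection

variable {V : Type*} [NormedAddCommGroup V] [InnerProductSpace ℝ V]

theorem norm_starProjection_sq_add {X Y : Submodule ℝ V} [X.HasOrthogonalProjection]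
    [Y.HasOrthogonalProjection] (hXY : X ≤ Y) (g : V) :
    ‖X.starProjection g‖ ^ 2 + ‖Y.starProjection g - X.starProjection g‖ ^ 2
      = ‖Y.starProjection g‖ ^ 2 := by
  have hmem : X.starProjection g ∈ X := X.starProjection_apply_mem g
  have horth : inner ℝ (X.starProjection g) (Y.starProjection g - X.starProjection g) = 0 := by
    have hX := X.starProjection_inner_eq_zero g _ hmem
    have hY := Y.starProjection_inner_eq_zero g _ (hXY hmem)
    rw [inner_sub_left] at hX hY
    rw [real_inner_comm, inner_sub_left]
    linarith
  have h := norm_add_sq_real (X.starProjection g) (Y.starProjection g - X.starProjection g)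
  rw [add_sub_cancel, horth] at h
  linarith

/-- By Pythagoras, `‖P_k g‖² ≤ ‖g‖²` increases by the square of each oscillation. -/
theorem oscillationLE_starProjection {X : ℕ → Submodule ℝ V}
    [∀ k, (X k).HasOrthogonalProjection] (hX : Monotone X) {ε : ℝ} (hε : 0 < ε) (g : V) :
    OscillationLE (fun k l => ‖(X k).starProjection g - (X l).starProjection g‖) (ε * ‖g‖)
      (⌊1 / ε ^ 2⌋₊ + 1) := by
  rcases eq_or_ne g 0 with rfl | hg
  · exact (OscillationLE.of_forall_le fun k l => by simp).mono_count (Nat.le_add_left _ _)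
  have hr : 0 < (ε * ‖g‖) ^ 2 := by have := norm_pos_iff.2 hg; positivity
  set level : ℕ → ℝ := fun k => ‖(X k).starProjection g‖ ^ 2 / (ε * ‖g‖) ^ 2
  have step_le : ∀ k l, k ≤ l → ⌊level k⌋₊ = ⌊level l⌋₊ →
      ‖(X l).starProjection g - (X k).starProjection g‖ ≤ ε * ‖g‖ := by
    intro k l hkl h
    have hk := Nat.floor_le (a := level k) (by positivity)
    have hl := Nat.lt_floor_add_one (level l)
    rw [← h] at hl
    rw [le_div_iff₀ hr] at hk
    rw [div_lt_iff₀ hr] at hl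
    exact le_of_sq_le_sq (by nlinarith [norm_starProjection_sq_add (hX hkl) g]) (by positivity)
  refine ⟨fun k => ⌊level k⌋₊, fun k l hkl => Nat.floor_le_floor ?_,
    fun k => Nat.lt_succ_of_le (Nat.floor_le_floor ?_), fun k l h => ?_⟩
  · exact div_le_div_of_nonneg_right
      (by nlinarith [norm_starProjection_sq_add (hX hkl) g]) hr.le
  · rw [div_le_div_iff₀ hr (by positivity), one_mul, mul_pow, mul_comm]
    gcongr
    exact (X k).norm_starProjection_apply_le g
  · rcases le_total k l with hkl | hkl
    · exact (norm_sub_rev _ _).trans_le (step_le k l hkl h)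
    · exact step_le l k hkl h.symm

theorem isTame_starProjection [CompleteSpace V] :
    IsTame fun (X : ℕ →o ClosedSubmodule ℝ V) k => (X k).toSubmodule.starProjection :=
  ⟨⟨1, zero_le_one, fun X k => (X k).toSubmodule.starProjection_norm_le⟩, fun _ hε =>
    ⟨_, fun X => oscillationLE_starProjection
      (X := fun k => (X k).toSubmodule) (fun _ _ h => X.monotone h) hε⟩⟩

end Projection

/-! ### Galerkin solutions of coercive problems -/

section Galerkin

variable {V : Type*} [NormedAddCommGroup V] [InnerProductSpace ℝ V]

/-- `u` is the Galerkin solution in `X` of the problem `a(u, v) = F(v)`. -/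
def IsGalerkin (a : V →L[ℝ] V →L[ℝ] ℝ) (F : V →L[ℝ] ℝ) (X : Submodule ℝ V) (u : V) : Prop :=
  u ∈ X ∧ ∀ v ∈ X, a u v = F v

variable {a a' : V →L[ℝ] V →L[ℝ] ℝ} {X : Submodule ℝ V}

theorem exists_norm_isGalerkin_le (ha : IsCoercive a) :
    ∃ B, 0 ≤ B ∧ ∀ F X u, IsGalerkin a F X u → ‖u‖ ≤ B * ‖F‖ := by
  obtain ⟨c, hc, hac⟩ := ha
  refine ⟨c⁻¹, by positivity, fun F X u hu => ?_⟩
  have hF : c * ‖u‖ * ‖u‖ ≤ ‖F‖ * ‖u‖ :=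
    (hac u).trans ((hu.2 u hu.1).trans_le ((le_abs_self _).trans (F.le_opNorm u)))
  rcases (norm_nonneg u).eq_or_lt with hu0 | hu0
  · rw [← hu0]
    positivity
  · rw [inv_mul_eq_div, le_div_iff₀' hc]
    exact le_of_mul_le_mul_right hF hu0

namespace IsGalerkin

variable {F G : V →L[ℝ] ℝ} {u v w : V}

theorem sub (hu : IsGalerkin a F X u) (hv : IsGalerkin a G X v) :
    IsGalerkin a (F - G) X (u - v) :=
  ⟨X.sub_mem hu.1 hv.1, fun w hw => by simp [hu.2 w hw, hv.2 w hw]⟩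

theorem sub_mem (hu : IsGalerkin a F X u) (hw : IsGalerkin a F ⊤ w) (hv : v ∈ X) :
    IsGalerkin a (a (w - v)) X (u - v) := by
  have hF : F = a w := by
    ext x
    exact (hw.2 x trivial).symm
  rw [map_sub, ← hF]
  exact hu.sub ⟨hv, fun _ _ => rfl⟩

theorem unique (ha : IsCoercive a) (hu : IsGalerkin a F X u) (hv : IsGalerkin a F X v) :
    u = v := by
  obtain ⟨B, -, hB⟩ := exists_norm_isGalerkin_le ha
  have h := hB _ _ _ (hu.sub hv)
  rw [sub_self, norm_zero, mul_zero] at h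
  exact sub_eq_zero.1 (norm_le_zero_iff.1 h)

end IsGalerkin

theorem exists_norm_isGalerkin_sub_le (ha : IsCoercive a) :
    ∃ B, 0 ≤ B ∧ ∀ F X u w v, IsGalerkin a F ⊤ w → IsGalerkin a F X u → v ∈ X →
      ‖u - v‖ ≤ B * ‖w - v‖ := by
  obtain ⟨B, hB0, hB⟩ := exists_norm_isGalerkin_le ha
  refine ⟨B * ‖a‖, by positivity, fun F X u w v hw hu hv => ?_⟩
  calc ‖u - v‖ ≤ B * ‖a (w - v)‖ := hB _ _ _ (hu.sub_mem hw hv)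
    _ ≤ B * (‖a‖ * ‖w - v‖) := by gcongr; exact a.le_opNorm _
    _ = B * ‖a‖ * ‖w - v‖ := by ring

theorem isCoercive_restrict (ha : IsCoercive a) (X : Submodule ℝ V) :
    IsCoercive (a.bilinearComp X.subtypeL X.subtypeL) := by
  obtain ⟨c, hc, hac⟩ := ha
  exact ⟨c, hc, fun v => hac v⟩

variable [CompleteSpace V]

open InnerProductSpace (continuousLinearMapOfBilin continuousLinearMapOfBilin_apply)

/-- The operator that maps `g` to the Galerkin solution in `X` of `a(u, v) = ⟨g, v⟩`, by the
Lax-Milgram lemma. -/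
noncomputable def galerkinOperator (ha : IsCoercive a) (X : ClosedSubmodule ℝ V) : V →L[ℝ] V :=
  have : CompleteSpace X.toSubmodule := X.isClosed.completeSpace_coe
  X.toSubmodule.subtypeL ∘L
    ((isCoercive_restrict ha X.toSubmodule).continuousLinearEquivOfBilin.symm :
      X.toSubmodule →L[ℝ] X.toSubmodule) ∘L X.toSubmodule.orthogonalProjectionOnto

theorem isGalerkin_galerkinOperator (ha : IsCoercive a) (X : ClosedSubmodule ℝ V) (g : V) :
    IsGalerkin a (innerSL ℝ g) X.toSubmodule (galerkinOperator ha X g) := by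
  have : CompleteSpace X.toSubmodule := X.isClosed.completeSpace_coe
  refine ⟨Subtype.property _, fun v hv => ?_⟩
  have h := (isCoercive_restrict ha X.toSubmodule).continuousLinearEquivOfBilin_apply
    ((isCoercive_restrict ha X.toSubmodule).continuousLinearEquivOfBilin.symm
      (X.toSubmodule.orthogonalProjectionOnto g)) ⟨v, hv⟩
  rw [ContinuousLinearEquiv.apply_symm_apply] at h
  rw [innerSL_apply_apply]
  exact h.symm.trans (Submodule.inner_orthogonalProjectionOnto_eq_of_mem_right _ _)

theorem exists_isGalerkin (ha : IsCoercive a) (F : V →L[ℝ] ℝ) (hX : IsClosed (X : Set V)) :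
    ∃ u, IsGalerkin a F X u := by
  have hF : innerSL ℝ ((InnerProductSpace.toDual ℝ V).symm F) = F := by
    ext v
    exact InnerProductSpace.toDual_symm_apply
  rw [← hF]
  exact ⟨_, isGalerkin_galerkinOperator ha ⟨X, hX⟩ _⟩

theorem IsGalerkin.eq_galerkinOperator (ha : IsCoercive a) {X : ClosedSubmodule ℝ V} {u w : V}
    (hu : IsGalerkin a (a' w) X.toSubmodule u) :
    u = galerkinOperator ha X (continuousLinearMapOfBilin a' w) := by
  refine hu.unique ha ?_
  have hF : innerSL ℝ (continuousLinearMapOfBilin a' w) = a' w := by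
    ext v
    exact continuousLinearMapOfBilin_apply a' w v
  rw [← hF]
  exact isGalerkin_galerkinOperator ha X _

theorem exists_norm_galerkinOperator_le (ha : IsCoercive a) :
    ∃ B, 0 ≤ B ∧ ∀ X, ‖galerkinOperator ha X‖ ≤ B := by
  obtain ⟨B, hB0, hB⟩ := exists_norm_isGalerkin_le ha
  refine ⟨B, hB0, fun X => ContinuousLinearMap.opNorm_le_bound _ hB0 fun g => ?_⟩
  simpa only [innerSL_apply_norm] using hB _ _ _ (isGalerkin_galerkinOperator ha X g)

/-- `ρ² = 1 - c²/C²`, where `c` is the coercivity constant and `C ≥ max c ‖A‖`. -/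
theorem exists_richardson_contraction (ha : IsCoercive a) :
    ∃ τ ρ : ℝ, 0 ≤ ρ ∧ ρ < 1 ∧ ∀ (X : Submodule ℝ V) [X.HasOrthogonalProjection],
      ∀ e ∈ X, ‖e - τ • X.starProjection (continuousLinearMapOfBilin a e)‖ ≤ ρ * ‖e‖ := by
  obtain ⟨c, hc, hac⟩ := ha
  set A := continuousLinearMapOfBilin a
  set C := max c ‖A‖
  have hC : 0 < C := lt_max_of_lt_left hc
  have hcC : c ^ 2 / C ^ 2 ≤ 1 :=
    (div_le_one (by positivity)).2 (pow_le_pow_left₀ hc.le (le_max_left _ _) 2)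
  refine ⟨c / C ^ 2, √(1 - c ^ 2 / C ^ 2), Real.sqrt_nonneg _, ?_, fun X _ e he => ?_⟩
  · rw [Real.sqrt_lt' one_pos]
    linarith [show 0 < c ^ 2 / C ^ 2 by positivity]
  set y := X.starProjection (A e)
  have hinner : inner ℝ e y = a e e := by
    have h := X.starProjection_inner_eq_zero (A e) e he
    rw [inner_sub_left] at h
    rw [real_inner_comm, ← continuousLinearMapOfBilin_apply a e e]
    linarith
  have hy : ‖y‖ ≤ C * ‖e‖ :=
    (X.norm_starProjection_apply_le _).trans (A.le_of_opNorm_le (le_max_right _ _) e)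
  refine le_of_sq_le_sq ?_ (by positivity)
  calc ‖e - (c / C ^ 2) • y‖ ^ 2
      = ‖e‖ ^ 2 - 2 * (c / C ^ 2) * a e e + (c / C ^ 2) ^ 2 * ‖y‖ ^ 2 := by
        rw [norm_sub_sq_real, inner_smul_right, hinner, norm_smul, mul_pow, Real.norm_eq_abs,
          sq_abs]
        ring
    _ ≤ ‖e‖ ^ 2 - 2 * (c / C ^ 2) * (c * ‖e‖ * ‖e‖) + (c / C ^ 2) ^ 2 * (C * ‖e‖) ^ 2 := by
        gcongr
        exact hac e
    _ = (√(1 - c ^ 2 / C ^ 2) * ‖e‖) ^ 2 := by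
        rw [mul_pow (√_), Real.sq_sqrt (sub_nonneg.2 hcC)]
        field_simp
        ring

/-- The operator that maps `g` to the `n`-th iterate of the Richardson iteration, started at `0`,
for the equation `P (A x) = P g` with `P` the orthogonal projection onto `X`. -/
noncomputable def richardson (A : V →L[ℝ] V) (τ : ℝ) (X : ClosedSubmodule ℝ V) : ℕ → V →L[ℝ] V
  | 0 => 0
  | n + 1 => richardson A τ X n +
      τ • (X.toSubmodule.starProjection ∘L
        (ContinuousLinearMap.id ℝ V - A ∘L richardson A τ X n))

theorem richardson_mem (A : V →L[ℝ] V) (τ : ℝ) (X : ClosedSubmodule ℝ V) (n : ℕ) (g : V) :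
    richardson A τ X n g ∈ X.toSubmodule := by
  induction n with
  | zero => exact zero_mem _
  | succ n ih =>
    exact add_mem ih (Submodule.smul_mem _ _ (Submodule.starProjection_apply_mem _ _))

theorem isTame_richardson (A : V →L[ℝ] V) (τ : ℝ) (n : ℕ) :
    IsTame fun (X : ℕ →o ClosedSubmodule ℝ V) k => richardson A τ (X k) n := by
  induction n with
  | zero => exact .const 0
  | succ n ih =>
    exact ih.add
      ((isTame_starProjection.comp ((IsTame.const _).sub ((IsTame.const A).comp ih))).const_smul τ)

theorem starProjection_galerkinOperator (ha : IsCoercive a) (X : ClosedSubmodule ℝ V) (g : V) :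
    X.toSubmodule.starProjection (continuousLinearMapOfBilin a (galerkinOperator ha X g))
      = X.toSubmodule.starProjection g := by
  rw [← sub_eq_zero, ← map_sub, Submodule.starProjection_apply_eq_zero_iff]
  intro v hv
  rw [real_inner_comm, inner_sub_left, continuousLinearMapOfBilin_apply,
    (isGalerkin_galerkinOperator ha X g).2 v hv, innerSL_apply_apply, sub_self]

theorem exists_norm_galerkinOperator_sub_richardson_le (ha : IsCoercive a) :
    ∃ τ ρ B : ℝ, 0 ≤ ρ ∧ ρ < 1 ∧ 0 ≤ B ∧ ∀ X n,
      ‖galerkinOperator ha X - richardson (continuousLinearMapOfBilin a) τ X n‖ ≤ ρ ^ n * B := by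
  obtain ⟨τ, ρ, hρ0, hρ1, hcontr⟩ := exists_richardson_contraction ha
  obtain ⟨B, hB0, hB⟩ := exists_norm_galerkinOperator_le ha
  refine ⟨τ, ρ, B, hρ0, hρ1, hB0, fun X n => ?_⟩
  set A := continuousLinearMapOfBilin a
  induction n with
  | zero => simpa [richardson] using hB X
  | succ n ih =>
    refine ContinuousLinearMap.opNorm_le_bound _ (by positivity) fun g => ?_
    set e := (galerkinOperator ha X - richardson A τ X n) g with he
    have he_mem : e ∈ X.toSubmodule :=
      sub_mem (isGalerkin_galerkinOperator ha X g).1 (richardson_mem _ _ _ _ _)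
    have error_step : (galerkinOperator ha X - richardson A τ X (n + 1)) g
        = e - τ • X.toSubmodule.starProjection (A e) := by
      simp only [he, richardson, _root_.sub_apply, _root_.add_apply, _root_.smul_apply,
        ContinuousLinearMap.comp_apply, ContinuousLinearMap.id_apply, map_sub, smul_sub,
        A, starProjection_galerkinOperator]
      abel
    calc ‖(galerkinOperator ha X - richardson A τ X (n + 1)) g‖ ≤ ρ * ‖e‖ :=
          error_step ▸ hcontr X.toSubmodule e he_mem
      _ ≤ ρ * (ρ ^ n * B * ‖g‖) := by
          gcongr
          exact ContinuousLinearMap.le_of_opNorm_le _ ih g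
      _ = ρ ^ (n + 1) * B * ‖g‖ := by ring

theorem isTame_galerkinOperator (ha : IsCoercive a) :
    IsTame fun (X : ℕ →o ClosedSubmodule ℝ V) k => galerkinOperator ha (X k) := by
  obtain ⟨τ, ρ, B, hρ0, hρ1, hB0, hlim⟩ := exists_norm_galerkinOperator_sub_richardson_le ha
  refine .of_uniform_limit fun ε hε => ?_
  obtain ⟨n, hn⟩ := exists_pow_lt_of_lt_one (show 0 < ε / (B + 1) by positivity) hρ1
  refine ⟨_, isTame_richardson (continuousLinearMapOfBilin a) τ n, fun X k => ?_⟩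
  calc _ ≤ ρ ^ n * B := hlim (X k) n
    _ ≤ ε / (B + 1) * (B + 1) := by gcongr; linarith
    _ = ε := by field_simp

theorem exists_oscillationLE_isGalerkin (ha : IsCoercive a) {ε : ℝ} (hε : 0 < ε) :
    ∃ M, ∀ (X : ℕ →o ClosedSubmodule ℝ V) (F : V →L[ℝ] ℝ) (w : V) (u : ℕ → V),
      IsGalerkin a F ⊤ w → (∀ k, IsGalerkin a F (X k).toSubmodule (u k)) →
      OscillationLE (fun k l => ‖u l - u k‖) (ε * ‖w - u 0‖) M := by
  obtain ⟨M, hM⟩ := (isTame_galerkinOperator ha).2 (ε / (‖continuousLinearMapOfBilin a‖ + 1))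
    (by positivity)
  refine ⟨M, fun X F w u hw hu =>
    (hM X (continuousLinearMapOfBilin a (w - u 0))).mono fun k l hkl => ?_⟩
  have hsol : ∀ k, u k - u 0
      = galerkinOperator ha (X k) (continuousLinearMapOfBilin a (w - u 0)) := fun k =>
    ((hu k).sub_mem hw (X.monotone k.zero_le (hu 0).1)).eq_galerkinOperator ha
  calc ‖u l - u k‖ = ‖(u k - u 0) - (u l - u 0)‖ := by rw [sub_sub_sub_cancel_right, norm_sub_rev]
    _ ≤ ε / (‖continuousLinearMapOfBilin a‖ + 1) * ‖continuousLinearMapOfBilin a (w - u 0)‖ := by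
        rw [hsol, hsol]
        exact hkl
    _ ≤ ε / (‖continuousLinearMapOfBilin a‖ + 1) *
          ((‖continuousLinearMapOfBilin a‖ + 1) * ‖w - u 0‖) := by
        gcongr
        exact ContinuousLinearMap.le_of_opNorm_le _ (by linarith) _
    _ = ε * ‖w - u 0‖ := by field_simp

/-- The Galerkin solutions `z k l` solve problems with right-hand side `H (u k)` which varies with
`k`. Their change from `X k` to `X l` is split into the change of `z 0 l`, the change of
`G'_l H G_l (A (w - u 0))`, and a contribution of `u l - u k`. -/
theorem exists_oscillationLE_nested_isGalerkin (ha : IsCoercive a) (ha' : IsCoercive a')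
    (H : V →L[ℝ] V →L[ℝ] ℝ) {ε : ℝ} (hε : 0 < ε) :
    ∃ M, ∀ (X : ℕ →o ClosedSubmodule ℝ V) (F : V →L[ℝ] ℝ) (w : V) (u : ℕ → V) (y : V)
      (z : ℕ → ℕ → V), IsGalerkin a F ⊤ w → (∀ k, IsGalerkin a F (X k).toSubmodule (u k)) →
      IsGalerkin a' (H (u 0)) ⊤ y →
      (∀ k l, IsGalerkin a' (H (u k)) (X l).toSubmodule (z k l)) →
      OscillationLE (fun k l => ‖z k l - z k k‖) (ε * (‖w - u 0‖ + ‖y - z 0 0‖)) M := by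
  set A := continuousLinearMapOfBilin a
  set H' := continuousLinearMapOfBilin H
  have hGHG := (isTame_galerkinOperator ha').comp
    ((IsTame.const H').comp (isTame_galerkinOperator ha))
  have hGH := (isTame_galerkinOperator ha').comp (IsTame.const H')
  obtain ⟨B, hB0, hB⟩ := hGH.1
  obtain ⟨M₁, hM₁⟩ := exists_oscillationLE_isGalerkin ha' hε
  obtain ⟨M₂, hM₂⟩ := hGHG.2 (ε / 2 / (‖A‖ + 1)) (by positivity)
  obtain ⟨M₃, hM₃⟩ := exists_oscillationLE_isGalerkin ha (show 0 < ε / 2 / (B + 1) by positivity)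
  refine ⟨M₁ * M₂ * M₃, fun X F w u y z hw hu hy hz => ?_⟩
  set f := A (w - u 0)
  have hf : ε / 2 / (‖A‖ + 1) * ‖f‖ ≤ ε / 2 * ‖w - u 0‖ :=
    calc ε / 2 / (‖A‖ + 1) * ‖f‖ ≤ ε / 2 / (‖A‖ + 1) * ((‖A‖ + 1) * ‖w - u 0‖) := by
          gcongr
          exact A.le_of_opNorm_le (by linarith) _
      _ = ε / 2 * ‖w - u 0‖ := by field_simp
  have primal_part : OscillationLE (fun k l => B * ‖u l - u k‖) (ε / 2 * ‖w - u 0‖) M₃ :=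
    (hM₃ X F w u hw hu).mono fun k l h =>
      calc B * ‖u l - u k‖ ≤ (B + 1) * (ε / 2 / (B + 1) * ‖w - u 0‖) := by gcongr; linarith
        _ = ε / 2 * ‖w - u 0‖ := by field_simp
  refine (((hM₁ X _ y (z 0) hy (hz 0)).add (hM₂ X f)).add primal_part).mono fun k l h => ?_
  have hGu : ∀ k, galerkinOperator ha (X k) f = u k - u 0 := fun k =>
    (((hu k).sub_mem hw (X.monotone k.zero_le (hu 0).1)).eq_galerkinOperator ha).symm
  have hGz : ∀ k l, z k l = galerkinOperator ha' (X l) (H' (u k)) := fun k l =>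
    (hz k l).eq_galerkinOperator ha'
  simp only [ContinuousLinearMap.comp_apply, hGu] at h
  have split : z k l - z k k = (z 0 l - z 0 k)
      - (galerkinOperator ha' (X k) (H' (u k - u 0)) - galerkinOperator ha' (X l) (H' (u l - u 0)))
      - galerkinOperator ha' (X l) (H' (u l - u k)) := by
    simp only [hGz, map_sub]
    abel
  have hGH_le : ‖galerkinOperator ha' (X l) (H' (u l - u k))‖ ≤ B * ‖u l - u k‖ :=
    ContinuousLinearMap.le_of_opNorm_le _ (hB X l) _
  rw [split]
  refine ((norm_sub_le _ _).trans (add_le_add (norm_sub_le _ _) hGH_le)).trans (h.trans ?_)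
  linarith

end Galerkin

/-! ### Linear convergence of products of adaptive sequences -/

theorem exists_mem_card_filter_lt {α : Type*} [LinearOrder α] {L : Finset α} {n : ℕ}
    (hn : n < L.card) : ∃ k ∈ L, n ≤ (L.filter (· < k)).card := by
  obtain ⟨k, hkL, hkmax⟩ := L.exists_max_image id (Finset.card_pos.1 (Nat.zero_lt_of_lt hn))
  have hsub : L.erase k ⊆ L.filter (· < k) := fun i hi =>
    Finset.mem_filter.2 ⟨Finset.mem_of_mem_erase hi,
      (hkmax i (Finset.mem_of_mem_erase hi)).lt_of_ne (Finset.ne_of_mem_erase hi)⟩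
  have hcard := Finset.card_le_card hsub
  rw [Finset.card_erase_of_mem hkL] at hcard
  exact ⟨k, hkL, (Nat.le_sub_one_of_lt hn).trans hcard⟩

/-- Nonnegative sequences `e` with the properties of an error estimator along an adaptive
algorithm: `e` changes by at most the distance `δ` of the discrete solutions, it is reduced by the
factor `q` up to this distance in the `marked` steps, it controls all later distances up to the
factor `B`, and after step `j` at most `M ε` intervals are needed to make the distances smaller
than `ε * e j`. -/
structure AdaptiveSequence (e : ℕ → ℝ) (δ : ℕ → ℕ → ℝ) (marked : Set ℕ) (B q : ℝ)
    (M : ℝ → ℕ) : Prop where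
  nonneg : ∀ k, 0 ≤ e k
  stability : ∀ k l, k ≤ l → e l ≤ e k + δ k l
  reduction : ∀ k ∈ marked, e (k + 1) ≤ q * e k + δ k (k + 1)
  reliability : ∀ k l, k ≤ l → δ k l ≤ B * e k
  oscillation : ∀ j, ∀ ε > 0, OscillationLE (fun k l => δ (j + k) (j + l)) (ε * e j) (M ε)

namespace AdaptiveSequence

variable {e e' : ℕ → ℝ} {δ δ' : ℕ → ℕ → ℝ} {marked marked' : Set ℕ} {B q : ℝ} {M : ℝ → ℕ}

theorem shift (h : AdaptiveSequence e δ marked B q M) (j : ℕ) :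
    AdaptiveSequence (fun k => e (j + k)) (fun k l => δ (j + k) (j + l)) {k | j + k ∈ marked}
      B q M where
  nonneg k := h.nonneg _
  stability k l hkl := h.stability _ _ (Nat.add_le_add_left hkl j)
  reduction k hk := h.reduction _ hk
  reliability k l hkl := h.reliability _ _ (Nat.add_le_add_left hkl j)
  oscillation i ε hε := by simpa only [← Nat.add_assoc] using h.oscillation (j + i) ε hε

theorem le_mul_of_le (h : AdaptiveSequence e δ marked B q M) {k l : ℕ} (hkl : k ≤ l) :
    e l ≤ (1 + B) * e k := by
  linarith [h.stability k l hkl, h.reliability k l hkl]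

/-- Induction over the marked steps, each of which reduces `e` up to the error `2 * r`. -/
theorem le_of_le_card_marked (h : AdaptiveSequence e δ marked B q M) {S : Finset ℕ}
    (hS : ↑S ⊆ marked) (hq0 : 0 ≤ q) (hq1 : q < 1) {φ : ℕ → ℕ} (hφ : Monotone φ) {r : ℝ}
    (hr : 0 ≤ r) (hδ : ∀ k l, φ k = φ l → δ k l ≤ r) (n k : ℕ)
    (hn : n ≤ (S.filter fun j => j < k ∧ φ j = φ k).card) :
    e k ≤ q ^ n * ((1 + B) * e 0) + 2 * r / (1 - q) := by
  have h1q : 0 < 1 - q := sub_pos.2 hq1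
  induction n generalizing k with
  | zero =>
    have : 0 ≤ 2 * r / (1 - q) := by positivity
    linarith [h.le_mul_of_le k.zero_le]
  | succ n ih =>
    obtain ⟨j, hj, hcard⟩ := exists_mem_card_filter_lt (Nat.lt_of_succ_le hn)
    obtain ⟨hjS, hjk, hjφ⟩ := Finset.mem_filter.1 hj
    have hsub : (S.filter fun i => i < k ∧ φ i = φ k).filter (· < j) ⊆
        S.filter fun i => i < j ∧ φ i = φ j := fun i hi => by
      simp only [Finset.mem_filter] at hi ⊢
      exact ⟨hi.1.1, hi.2, hi.1.2.2.trans hjφ.symm⟩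
    have hφ_succ : φ (j + 1) = φ k := le_antisymm (hφ hjk) (hjφ ▸ hφ j.le_succ)
    calc e k ≤ e (j + 1) + r := (h.stability _ _ hjk).trans (by linarith [hδ _ _ hφ_succ])
      _ ≤ q * e j + 2 * r := by
          linarith [h.reduction j (hS hjS), hδ j (j + 1) (hjφ.trans hφ_succ.symm)]
      _ ≤ q * (q ^ n * ((1 + B) * e 0) + 2 * r / (1 - q)) + 2 * r := by
          gcongr
          exact ih j (hcard.trans (Finset.card_le_card hsub))
      _ = q ^ (n + 1) * ((1 + B) * e 0) + 2 * r / (1 - q) := by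
          field_simp
          ring

end AdaptiveSequence

theorem exists_card_marked_suffices {B q κ : ℝ} (hB : 0 ≤ B) (hq0 : 0 ≤ q) (hq1 : q < 1)
    (hκ : 0 < κ) (M : ℝ → ℕ) :
    ∃ m : ℕ, 0 < m ∧ ∀ {e δ marked}, AdaptiveSequence e δ marked B q M → ∀ {S : Finset ℕ} {N : ℕ},
      ↑S ⊆ marked → S ⊆ Finset.range N → m ≤ S.card → e N ≤ κ * e 0 := by
  have h1q : 0 < 1 - q := sub_pos.2 hq1
  set ε := κ * (1 - q) / (4 * (1 + B))
  have hε : 0 < ε := by positivity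
  obtain ⟨n, hn⟩ := exists_pow_lt_of_lt_one (show 0 < κ / (2 * (1 + B) ^ 2) by positivity) hq1
  refine ⟨M ε * n + 1, Nat.succ_pos _, fun {e δ marked} h S N hS hSN hm => ?_⟩
  have he0 := h.nonneg 0
  obtain ⟨φ, hφ, hφM, hδ⟩ := h.oscillation 0 ε hε
  simp only [zero_add] at hδ
  obtain ⟨c, -, hc⟩ := Finset.exists_lt_card_fiber_of_mul_lt_card_of_maps_to (s := S)
    (t := Finset.range (M ε)) (f := φ) (n := n) (fun k _ => Finset.mem_range.2 (hφM k))
    (by rw [Finset.card_range]; omega)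
  obtain ⟨k, hk, hcard⟩ := exists_mem_card_filter_lt hc
  obtain ⟨hkS, hkc⟩ := Finset.mem_filter.1 hk
  have hsub : (S.filter fun i => φ i = c).filter (· < k) ⊆
      S.filter fun i => i < k ∧ φ i = φ k := fun i hi => by
    simp only [Finset.mem_filter] at hi ⊢
    exact ⟨hi.1.1, hi.2, hi.1.2.trans hkc.symm⟩
  calc e N ≤ (1 + B) * e k := h.le_mul_of_le (Finset.mem_range.1 (hSN hkS)).le
    _ ≤ (1 + B) * (q ^ n * ((1 + B) * e 0) + 2 * (ε * e 0) / (1 - q)) := by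
        gcongr
        exact h.le_of_le_card_marked hS hq0 hq1 hφ (by positivity) hδ n k
          (hcard.trans (Finset.card_le_card hsub))
    _ ≤ (1 + B) * (κ / (2 * (1 + B) ^ 2) * ((1 + B) * e 0) + 2 * (ε * e 0) / (1 - q)) := by
        gcongr
    _ = κ * e 0 := by
        simp only [ε]
        field_simp
        ring

theorem exists_mul_le_half_mul {B q : ℝ} (hB : 0 ≤ B) (hq0 : 0 ≤ q) (hq1 : q < 1)
    (M : ℝ → ℕ) :
    ∃ N : ℕ, 0 < N ∧ ∀ {e δ marked e' δ' marked'}, AdaptiveSequence e δ marked B q M →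
      AdaptiveSequence e' δ' marked' B q M → marked ∪ marked' = Set.univ →
      e N * e' N ≤ 1 / 2 * (e 0 * e' 0) := by
  classical
  obtain ⟨m, hm0, hm⟩ := exists_card_marked_suffices hB hq0 hq1
    (show 0 < 1 / (2 * (1 + B)) by positivity) M
  refine ⟨m + m, Nat.add_pos_left hm0 m, fun {e δ marked e' δ' marked'} h h' hcover => ?_⟩
  set S := (Finset.range (m + m)).filter (· ∈ marked)
  set S' := (Finset.range (m + m)).filter (· ∈ marked')
  have hcard : m + m ≤ S.card + S'.card := by
    have hsub : Finset.range (m + m) ⊆ S ∪ S' := fun k hk => by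
      simp only [S, S', Finset.mem_union, Finset.mem_filter, hk, true_and]
      exact hcover.ge (Set.mem_univ k)
    simpa only [Finset.card_range] using (Finset.card_le_card hsub).trans (Finset.card_union_le _ _)
  have hSm : ↑S ⊆ marked := fun k hk => (Finset.mem_filter.1 hk).2
  have hSm' : ↑S' ⊆ marked' := fun k hk => (Finset.mem_filter.1 hk).2
  have he := h.nonneg; have he' := h'.nonneg
  have hle := h.le_mul_of_le (m + m).zero_le; have hle' := h'.le_mul_of_le (m + m).zero_le
  rcases (show m ≤ S.card ∨ m ≤ S'.card by omega) with hS | hS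
  · calc e (m + m) * e' (m + m) ≤ (1 / (2 * (1 + B)) * e 0) * ((1 + B) * e' 0) :=
          mul_le_mul (hm h hSm (Finset.filter_subset _ _) hS) hle' (he' _)
            (by have := he 0; positivity)
      _ = 1 / 2 * (e 0 * e' 0) := by field_simp
  · calc e (m + m) * e' (m + m) ≤ ((1 + B) * e 0) * (1 / (2 * (1 + B)) * e' 0) :=
          mul_le_mul hle (hm h' hSm' (Finset.filter_subset _ _) hS) (he' _)
            (by have := he 0; positivity)
      _ = 1 / 2 * (e 0 * e' 0) := by field_simp

theorem le_mul_pow_mul_of_halving {P : ℕ → ℝ} {Q : ℝ} {N : ℕ} (hN : 0 < N) (hQ : 0 ≤ Q)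
    (hP : ∀ k, 0 ≤ P k) (hmono : ∀ l n, l ≤ n → P n ≤ Q * P l)
    (hhalf : ∀ k, P (k + N) ≤ 1 / 2 * P k) {l n : ℕ} (hln : l ≤ n) :
    P n ≤ 2 * Q * ((1 / 2 : ℝ) ^ (1 / N : ℝ)) ^ (n - l) * P l := by
  set q := (1 / 2 : ℝ) ^ (1 / N : ℝ)
  have hq0 : 0 < q := by positivity
  have hq1 : q ≤ 1 := Real.rpow_le_one (by norm_num) (by norm_num) (by positivity)
  have hqN : q ^ N = 1 / 2 := by
    simp only [q, one_div, Real.rpow_inv_natCast_pow (show (0 : ℝ) ≤ 2⁻¹ by norm_num) hN.ne']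
  have hiter : ∀ i k, P (k + N * i) ≤ (1 / 2) ^ i * P k := fun i k => by
    induction i with
    | zero => simp
    | succ i ih =>
      rw [Nat.mul_succ, ← Nat.add_assoc, pow_succ']
      linarith [hhalf (k + N * i)]
  obtain ⟨m, rfl⟩ := Nat.exists_eq_add_of_le hln
  rw [Nat.add_sub_cancel_left]
  have hpow : (1 / 2 : ℝ) ^ (m / N) ≤ 2 * q ^ m := by
    have hmod : q ^ N ≤ q ^ (m % N) := pow_le_pow_of_le_one hq0.le hq1 (Nat.mod_lt m hN).le
    calc (1 / 2 : ℝ) ^ (m / N) = 2 * (q ^ N * (q ^ N) ^ (m / N)) := by rw [hqN]; ring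
      _ ≤ 2 * (q ^ (m % N) * (q ^ N) ^ (m / N)) := by gcongr
      _ = 2 * q ^ m := by rw [← pow_mul, ← pow_add, Nat.mod_add_div]
  have hPl := hP l
  calc P (l + m) ≤ Q * P (l + N * (m / N)) :=
        hmono _ _ (Nat.add_le_add_left (Nat.mul_div_le m N) l)
    _ ≤ Q * ((1 / 2) ^ (m / N) * P l) := by gcongr; exact hiter _ _
    _ ≤ Q * (2 * q ^ m * P l) := by gcongr
    _ = 2 * Q * q ^ m * P l := by ring

theorem exists_linear_convergence_mul {B q : ℝ} (hB : 0 ≤ B) (hq0 : 0 ≤ q) (hq1 : q < 1)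
    (M : ℝ → ℕ) :
    ∃ C ρ : ℝ, 0 < C ∧ 0 < ρ ∧ ρ < 1 ∧ ∀ {e δ marked e' δ' marked'},
      AdaptiveSequence e δ marked B q M → AdaptiveSequence e' δ' marked' B q M →
      marked ∪ marked' = Set.univ → ∀ {l n : ℕ}, l ≤ n →
      e n * e' n ≤ C * ρ ^ (n - l) * (e l * e' l) := by
  obtain ⟨N, hN, hhalf⟩ := exists_mul_le_half_mul hB hq0 hq1 M
  refine ⟨2 * (1 + B) ^ 2, (1 / 2 : ℝ) ^ (1 / N : ℝ), by positivity, by positivity,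
    Real.rpow_lt_one (by norm_num) (by norm_num) (by positivity), ?_⟩
  intro e δ marked e' δ' marked' h h' hcover l n hln
  refine le_mul_pow_mul_of_halving (P := fun k => e k * e' k) hN (by positivity)
    (fun k => mul_nonneg (h.nonneg k) (h'.nonneg k)) (fun l n hln => ?_) (fun k => ?_) hln
  · calc e n * e' n ≤ ((1 + B) * e l) * ((1 + B) * e' l) :=
          mul_le_mul (h.le_mul_of_le hln) (h'.le_mul_of_le hln) (h'.nonneg n)
            (by have := h.nonneg l; positivity)
      _ = (1 + B) ^ 2 * (e l * e' l) := by ring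
  · exact hhalf (h.shift k) (h'.shift k) (Set.eq_univ_of_forall fun i => hcover.ge (Set.mem_univ _))

/-! ### The forms on `H^1_0(Ω)` -/

section L2

variable {α : Type*} [MeasurableSpace α] {μ : Measure α} {c : α → ℝ}

/-- The bilinear form `(f, g) ↦ ∫ c f g` on `L²` with an essentially bounded weight `c`. -/
noncomputable def weightedForm (hc : MemLp c ⊤ μ) : Lp ℝ 2 μ →L[ℝ] Lp ℝ 2 μ →L[ℝ] ℝ :=
  ((ContinuousLinearMap.mul ℝ ℝ).lpPairing μ 2 2).comp
    ((ContinuousLinearMap.mul ℝ ℝ).holderL μ ⊤ 2 2 (hc.toLp c))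

theorem weightedForm_apply (hc : MemLp c ⊤ μ) (f g : Lp ℝ 2 μ) :
    weightedForm hc f g = ∫ x, c x * f x * g x ∂μ := by
  let cf : Lp ℝ 2 μ := (ContinuousLinearMap.mul ℝ ℝ).holder 2 (hc.toLp c) f
  have hcf : weightedForm hc f g = ∫ x, cf x * g x ∂μ :=
    (ContinuousLinearMap.mul ℝ ℝ).lpPairing_eq_integral cf g
  refine hcf.trans (integral_congr_ae ?_)
  filter_upwards [(ContinuousLinearMap.mul ℝ ℝ).coeFn_holder (r := 2) (hc.toLp c) f,
    hc.coeFn_toLp] with x hx hcx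
  rw [← hcx]
  exact congrArg (· * g x) hx

theorem integrable_mul_mul {f g : α → ℝ} (hc : MemLp c ⊤ μ) (hf : MemLp f 2 μ) (hg : MemLp g 2 μ) :
    Integrable (fun x => c x * f x * g x) μ :=
  MemLp.integrable_mul (p := 2) (q := 2) (hf.mul hc) hg

variable {F G : Type*} [NormedAddCommGroup F] [NormedAddCommGroup G]
  [InnerProductSpace ℝ F] [InnerProductSpace ℝ G]

theorem integral_norm_sq (f : Lp F 2 μ) : ∫ x, ‖f x‖ ^ 2 ∂μ = ‖f‖ ^ 2 := by
  rw [← real_inner_self_eq_norm_sq, L2.inner_def]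
  simp only [real_inner_self_eq_norm_sq]

theorem integral_norm_mul_norm_le (f : Lp F 2 μ) (g : Lp G 2 μ) :
    ∫ x, ‖f x‖ * ‖g x‖ ∂μ ≤ ‖f‖ * ‖g‖ := by
  have h := integral_mul_le_Lp_mul_Lq_of_nonneg (μ := μ) Real.HolderConjugate.two_two
    (.of_forall fun x => norm_nonneg (f x)) (.of_forall fun x => norm_nonneg (g x))
    (by simpa using (Lp.memLp f).norm) (by simpa using (Lp.memLp g).norm)
  simpa only [Real.rpow_two, integral_norm_sq, ← Real.sqrt_eq_rpow,
    Real.sqrt_sq (norm_nonneg _)] using h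

theorem abs_integral_le_mul_norm_mul_norm {k : α → ℝ} {C : ℝ} (hC : 0 ≤ C) (f : Lp F 2 μ)
    (g : Lp G 2 μ) (hk : ∀ᵐ x ∂μ, |k x| ≤ C * (‖f x‖ * ‖g x‖)) :
    |∫ x, k x ∂μ| ≤ C * (‖f‖ * ‖g‖) := by
  have hint : Integrable (fun x => ‖f x‖ * ‖g x‖) μ :=
    (Lp.memLp f).norm.integrable_mul (Lp.memLp g).norm
  calc |∫ x, k x ∂μ| ≤ ∫ x, C * (‖f x‖ * ‖g x‖) ∂μ :=
        norm_integral_le_of_norm_le (f := k) (hint.const_mul C) hk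
    _ ≤ C * (‖f‖ * ‖g‖) := by
        rw [integral_const_mul]
        gcongr
        exact integral_norm_mul_norm_le f g

end L2

section Forms

variable {d : ℕ} {Ω : Set (E d)}

instance : CompleteSpace (H10 Ω) :=
  (Submodule.isClosed_topologicalClosure (Submodule.span ℝ (testPairs Ω))).completeSpace_coe

/-- The embedding of `H^1_0(Ω)` into `L²(Ω)`. -/
noncomputable def fnL : H10 Ω →L[ℝ] Lp ℝ 2 (volume.restrict Ω) :=
  (WithLp.fstL 2 ℝ _ _).comp (H10 Ω).subtypeL

/-- The weak gradient as a bounded operator from `H^1_0(Ω)` to `L²(Ω)^d`. -/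
noncomputable def wgradL : H10 Ω →L[ℝ] Lp (E d) 2 (volume.restrict Ω) :=
  (WithLp.sndL 2 ℝ _ _).comp (H10 Ω).subtypeL

/-- The weak partial derivative `∂ᵢ` as a bounded operator from `H^1_0(Ω)` to `L²(Ω)`. -/
noncomputable def pderivL (i : Fin d) : H10 Ω →L[ℝ] Lp ℝ 2 (volume.restrict Ω) :=
  ((EuclideanSpace.proj i : E d →L[ℝ] ℝ).compLpL 2 (volume.restrict Ω)).comp wgradL

theorem norm_sq_eq_add_norm_wgradL_sq (v : H10 Ω) : ‖v‖ ^ 2 = ‖fnL v‖ ^ 2 + ‖wgradL v‖ ^ 2 :=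
  WithLp.prod_norm_sq_eq_of_L2 (v : L2Pair Ω)

theorem pderivL_ae_eq (i : Fin d) (v : H10 Ω) :
    pderivL i v =ᵐ[volume.restrict Ω] fun x => wgrad v x i :=
  ContinuousLinearMap.coeFn_compLpL (EuclideanSpace.proj i : E d →L[ℝ] ℝ) (wgradL v)

theorem memLp_wgrad_apply (i : Fin d) (v : H10 Ω) :
    MemLp (fun x => wgrad v x i) 2 (volume.restrict Ω) :=
  (Lp.memLp (wgradL v)).eval_piLp i

section Coefficients

variable {A : E d → Matrix (Fin d) (Fin d) ℝ} {b : E d → E d} {c : E d → ℝ}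

theorem mulVec_dotProduct_eq_sum {ι R : Type*} [Fintype ι] [NonUnitalSemiring R]
    (B : Matrix ι ι R) (y z : ι → R) : (B *ᵥ y) ⬝ᵥ z = ∑ i, ∑ j, B i j * y j * z i := by
  simp only [dotProduct, mulVec, Finset.sum_mul]

theorem integrable_principal (hA : ∀ i j, MemLp (fun x => A x i j) ⊤ (volume.restrict Ω))
    (u v : H10 Ω) :
    Integrable (fun x => (A x *ᵥ (wgrad u x).ofLp) ⬝ᵥ (wgrad v x).ofLp) (volume.restrict Ω) := by
  simp only [mulVec_dotProduct_eq_sum]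
  exact integrable_finsetSum _ fun i _ => integrable_finsetSum _ fun j _ =>
    integrable_mul_mul (hA i j) (memLp_wgrad_apply j u) (memLp_wgrad_apply i v)

theorem weightedForm_pderivL_pderivL (hc : MemLp c ⊤ (volume.restrict Ω)) (i j : Fin d)
    (u v : H10 Ω) :
    weightedForm hc (pderivL j u) (pderivL i v) = ∫ x in Ω, c x * wgrad u x j * wgrad v x i := by
  refine (weightedForm_apply _ _ _).trans (integral_congr_ae ?_)
  filter_upwards [pderivL_ae_eq j u, pderivL_ae_eq i v] with x hu hv
  rw [hu, hv]

/-- `principalForm A` as a bounded bilinear form. -/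
noncomputable def principalFormL (hA : ∀ i j, MemLp (fun x => A x i j) ⊤ (volume.restrict Ω)) :
    H10 Ω →L[ℝ] H10 Ω →L[ℝ] ℝ :=
  ∑ i, ∑ j, (weightedForm (hA i j)).bilinearComp (pderivL j) (pderivL i)

theorem principalFormL_apply (hA : ∀ i j, MemLp (fun x => A x i j) ⊤ (volume.restrict Ω))
    (u v : H10 Ω) : principalFormL hA u v = principalForm A u v := by
  have hint : ∀ i j, Integrable (fun x => A x i j * wgrad u x j * wgrad v x i)
      (volume.restrict Ω) := fun i j =>
    integrable_mul_mul (hA i j) (memLp_wgrad_apply j u) (memLp_wgrad_apply i v)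
  simp only [principalFormL, _root_.sum_apply, ContinuousLinearMap.bilinearComp_apply,
    weightedForm_pderivL_pderivL, principalForm, mulVec_dotProduct_eq_sum]
  rw [integral_finsetSum _ fun i _ => integrable_finsetSum _ fun j _ => hint i j]
  exact Finset.sum_congr rfl fun i _ => (integral_finsetSum _ fun j _ => hint i j).symm

/-- The convection form `(u, v) ↦ ∫ (b · ∇u) v` as a bounded bilinear form. -/
noncomputable def convectionFormL (hb : MemLp b ⊤ (volume.restrict Ω)) :
    H10 Ω →L[ℝ] H10 Ω →L[ℝ] ℝ :=
  ∑ i, (weightedForm (hb.eval_piLp i)).bilinearComp (pderivL i) fnL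

theorem convectionFormL_apply (hb : MemLp b ⊤ (volume.restrict Ω)) (u v : H10 Ω) :
    convectionFormL hb u v = ∫ x in Ω, ((b x).ofLp ⬝ᵥ (wgrad u x).ofLp) * fn v x := by
  have hterm : ∀ i, weightedForm (hb.eval_piLp i) (pderivL i u) (fnL v) =
      ∫ x in Ω, b x i * wgrad u x i * fn v x := fun i => by
    refine (weightedForm_apply _ _ _).trans (integral_congr_ae ?_)
    filter_upwards [pderivL_ae_eq i u] with x hu
    rw [hu]
    rfl
  simp only [convectionFormL, _root_.sum_apply, ContinuousLinearMap.bilinearComp_apply, hterm,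
    dotProduct, Finset.sum_mul]
  exact (integral_finsetSum _ fun i _ => integrable_mul_mul (hb.eval_piLp i)
    (memLp_wgrad_apply i u) (Lp.memLp (fnL v))).symm

/-- `bilin A b c` as a bounded bilinear form. -/
noncomputable def bilinL (h : AdmissibleCoefficients Ω A b c) : H10 Ω →L[ℝ] H10 Ω →L[ℝ] ℝ :=
  principalFormL h.memLp_A + convectionFormL h.memLp_b +
    (weightedForm h.memLp_c).bilinearComp fnL fnL

theorem bilinL_apply (h : AdmissibleCoefficients Ω A b c) (u v : H10 Ω) :
    bilinL h u v = bilin A b c u v := by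
  have hreaction : weightedForm h.memLp_c (fnL u) (fnL v) = ∫ x in Ω, c x * fn u x * fn v x :=
    weightedForm_apply _ _ _
  simp only [bilinL, _root_.add_apply, ContinuousLinearMap.bilinearComp_apply,
    principalFormL_apply, convectionFormL_apply, hreaction, bilin]

theorem isCoercive_bilinL (h : AdmissibleCoefficients Ω A b c) : IsCoercive (bilinL h) := by
  obtain ⟨C, hC, hell⟩ := h.elliptic
  refine ⟨C, hC, fun v => ?_⟩
  rw [bilinL_apply, mul_assoc, ← sq]
  exact hell v

end Coefficients

section Load

variable {f : E d → ℝ} {ff : E d → E d}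

/-- `load f ff` as a bounded linear functional. -/
noncomputable def loadL (hf : MemLp f 2 (volume.restrict Ω))
    (hff : MemLp ff 2 (volume.restrict Ω)) : Hneg1 Ω :=
  (innerSL ℝ (hf.toLp f)).comp fnL - (innerSL ℝ (hff.toLp ff)).comp wgradL

theorem loadL_apply (hf : MemLp f 2 (volume.restrict Ω))
    (hff : MemLp ff 2 (volume.restrict Ω)) (v : H10 Ω) : loadL hf hff v = load f ff v := by
  have hfn : inner ℝ (hf.toLp f) (fnL v) = ∫ x in Ω, f x * fn v x := by
    rw [L2.inner_def]
    refine integral_congr_ae ?_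
    filter_upwards [hf.coeFn_toLp] with x hx
    rw [hx, real_inner_eq_re_inner, RCLike.inner_apply, mul_comm]
    rfl
  have hwgrad : inner ℝ (hff.toLp ff) (wgradL v) =
      ∫ x in Ω, (ff x).ofLp ⬝ᵥ (wgrad v x).ofLp := by
    rw [L2.inner_def]
    refine integral_congr_ae ?_
    filter_upwards [hff.coeFn_toLp] with x hx
    rw [hx, EuclideanSpace.inner_eq_star_dotProduct, dotProduct_comm]
    rfl
  rw [load, ← hfn, ← hwgrad]
  rfl

end Load

end Forms

/-! ### The Poincaré inequality and finite element spaces -/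

section Poincare

variable {d : ℕ} {Ω : Set (E d)}

theorem zero_mem_testPairs : (0 : L2Pair Ω) ∈ testPairs Ω := by
  have hgrad : gradient (0 : E d → ℝ) = 0 := by
    funext x
    simp [gradient]
  refine ⟨0, contDiff_const, HasCompactSupport.zero, by simp, Lp.coeFn_zero ℝ 2 _, ?_⟩
  rw [hgrad]
  exact Lp.coeFn_zero (E d) 2 _

theorem add_mem_testPairs {v w : L2Pair Ω} (hv : v ∈ testPairs Ω) (hw : w ∈ testPairs Ω) :
    v + w ∈ testPairs Ω := by
  obtain ⟨φ, hφ, hφc, hφΩ, hvφ, hvφ'⟩ := hv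
  obtain ⟨ψ, hψ, hψc, hψΩ, hwψ, hwψ'⟩ := hw
  refine ⟨φ + ψ, hφ.add hψ, hφc.add hψc, (tsupport_add φ ψ).trans (Set.union_subset hφΩ hψΩ),
    ?_, ?_⟩
  · filter_upwards [hvφ, hwψ, Lp.coeFn_add v.fst w.fst] with x hv hw hadd
    rw [WithLp.add_fst, hadd, Pi.add_apply, Pi.add_apply, hv, hw]
  · filter_upwards [hvφ', hwψ', Lp.coeFn_add v.snd w.snd] with x hv hw hadd
    rw [WithLp.add_snd, hadd, Pi.add_apply, hv, hw, gradient, gradient, gradient,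
      fderiv_add (hφ.differentiable (by simp) x) (hψ.differentiable (by simp) x), map_add]

theorem smul_mem_testPairs {v : L2Pair Ω} (t : ℝ) (hv : v ∈ testPairs Ω) :
    t • v ∈ testPairs Ω := by
  obtain ⟨φ, hφ, hφc, hφΩ, hvφ, hvφ'⟩ := hv
  refine ⟨t • φ, hφ.const_smul t, hφc.smul_left (f := fun _ => t),
    (tsupport_smul_subset_right (fun _ => t) φ).trans hφΩ, ?_, ?_⟩
  · filter_upwards [hvφ, Lp.coeFn_smul t v.fst] with x hv hsmul
    rw [WithLp.smul_fst, hsmul, Pi.smul_apply, Pi.smul_apply, hv]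
  · filter_upwards [hvφ', Lp.coeFn_smul t v.snd] with x hv hsmul
    rw [WithLp.smul_snd, hsmul, Pi.smul_apply, hv, gradient, gradient,
      fderiv_const_smul (hφ.differentiable (by simp) x)]
    simp

theorem mem_testPairs_of_mem_span {v : L2Pair Ω} (hv : v ∈ Submodule.span ℝ (testPairs Ω)) :
    v ∈ testPairs Ω := by
  induction hv using Submodule.span_induction with
  | mem _ hx => exact hx
  | zero => exact zero_mem_testPairs
  | add x y _ _ hx hy => exact add_mem_testPairs hx hy
  | smul t x _ hx => exact smul_mem_testPairs t hx

theorem integral_sq_eq_neg_integral_mul_fderiv (i : Fin d) {φ : E d → ℝ} (hφ : ContDiff ℝ 1 φ)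
    (hφc : HasCompactSupport φ) :
    ∫ x, φ x ^ 2 = -∫ x, x i * (φ x * (2 * fderiv ℝ φ x (EuclideanSpace.single i 1))) := by
  let coord : E d →L[ℝ] ℝ := EuclideanSpace.proj i
  set e : E d := EuclideanSpace.single i 1
  have hdiff : Differentiable ℝ φ := hφ.differentiable one_ne_zero
  have hφ' : Continuous fun x => fderiv ℝ φ x e :=
    (hφ.continuous_fderiv one_ne_zero).clm_apply continuous_const
  have hcoord : ∀ x, fderiv ℝ coord x e = 1 := fun x => by
    rw [coord.fderiv]
    simp [coord, e]
  have hsq : ∀ x, fderiv ℝ (fun x => φ x ^ 2) x e = φ x * (2 * fderiv ℝ φ x e) := fun x => by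
    rw [((hdiff x).hasFDerivAt.pow 2).fderiv]
    simp [mul_left_comm, mul_assoc]
  have hsupp : HasCompactSupport fun x => φ x ^ 2 := hφc.comp_left (g := (· ^ 2)) (by simp)
  have hint : Integrable (fun x => φ x ^ 2) :=
    (hφ.continuous.pow 2).integrable_of_hasCompactSupport hsupp
  have hint' : Integrable fun x => coord x * (φ x * (2 * fderiv ℝ φ x e)) :=
    (coord.continuous.mul (hφ.continuous.mul
      (continuous_const.mul hφ'))).integrable_of_hasCompactSupport hφc.mul_right.mul_left
  have hparts := integral_mul_fderiv_eq_neg_fderiv_mul_of_integrable (μ := (volume : Measure (E d)))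
    (f := coord) (g := fun x => φ x ^ 2) (v := e)
    (by simpa only [hcoord, one_mul]) (by simpa only [hsq])
    ((coord.continuous.mul (hφ.continuous.pow 2)).integrable_of_hasCompactSupport hsupp.mul_left)
    (fun x _ => coord.differentiableAt) (fun x _ => (hdiff x).pow 2)
  simp only [hcoord, hsq, one_mul] at hparts
  rw [← neg_eq_iff_eq_neg, ← hparts]
  rfl

theorem norm_sq_fst_eq_integral_sq {w : L2Pair Ω} {φ : E d → ℝ}
    (hw : w.fst =ᵐ[volume.restrict Ω] φ) (hφ : ∀ x ∉ Ω, φ x = 0) :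
    ‖w.fst‖ ^ 2 = ∫ x, φ x ^ 2 := by
  rw [← integral_norm_sq, ← setIntegral_eq_integral_of_forall_compl_eq_zero (s := Ω)
    (f := fun x => φ x ^ 2) (fun x hx => by simp [hφ x hx])]
  refine integral_congr_ae ?_
  filter_upwards [hw] with x hx
  rw [hx, Real.norm_eq_abs, sq_abs]

theorem abs_fderiv_single_le_norm_gradient (φ : E d → ℝ) (x : E d) (i : Fin d) :
    |fderiv ℝ φ x (EuclideanSpace.single i 1)| ≤ ‖gradient φ x‖ := by
  rw [gradient, LinearIsometryEquiv.norm_map]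
  simpa using (fderiv ℝ φ x).le_opNorm (EuclideanSpace.single i (1 : ℝ))

theorem norm_fst_le_of_mem_testPairs (i : Fin d) {R : ℝ} (hR : 0 ≤ R) (hΩ : ∀ x ∈ Ω, ‖x‖ ≤ R)
    {w : L2Pair Ω} (hw : w ∈ testPairs Ω) : ‖w.fst‖ ≤ 2 * R * ‖w.snd‖ := by
  obtain ⟨φ, hφ, hφc, hφΩ, hwφ, hwφ'⟩ := hw
  have hzero : ∀ x ∉ Ω, φ x = 0 := fun x hx =>
    image_eq_zero_of_notMem_tsupport fun hx' => hx (hφΩ hx')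
  have hnorm : ∀ᵐ x ∂(volume.restrict Ω), ‖x‖ ≤ R := by
    have hball : Ω ⊆ Metric.closedBall 0 R := fun x hx => by simpa using hΩ x hx
    filter_upwards [ae_mono (Measure.restrict_mono_set volume hball)
      (ae_restrict_mem Metric.isClosed_closedBall.measurableSet)] with x hx
    simpa using hx
  have hsq : ‖w.fst‖ ^ 2 ≤ 2 * R * (‖w.fst‖ * ‖w.snd‖) := by
    rw [norm_sq_fst_eq_integral_sq hwφ hzero,
      integral_sq_eq_neg_integral_mul_fderiv i (hφ.of_le (by norm_cast)) hφc,
      ← setIntegral_eq_integral_of_forall_compl_eq_zero (s := Ω)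
        (fun x hx => by simp [hzero x hx])]
    refine (neg_le_abs _).trans
      (abs_integral_le_mul_norm_mul_norm (by positivity) w.fst w.snd ?_)
    filter_upwards [hwφ, hwφ', hnorm] with x hx hx' hxR
    have hcoord : |x i| ≤ R := (PiLp.norm_apply_le x i).trans hxR
    have hderiv := abs_fderiv_single_le_norm_gradient φ x i
    rw [hx, hx', abs_mul, abs_mul, abs_mul, abs_two, Real.norm_eq_abs]
    calc |x i| * (|φ x| * (2 * |fderiv ℝ φ x (EuclideanSpace.single i 1)|))
        ≤ R * (|φ x| * (2 * ‖gradient φ x‖)) := by gcongr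
      _ = 2 * R * (|φ x| * ‖gradient φ x‖) := by ring
  rcases (norm_nonneg w.fst).eq_or_lt with h | h
  · rw [← h]
    positivity
  · exact le_of_mul_le_mul_left (by linarith) h

theorem exists_poincare (hd : 0 < d) (hΩ : Bornology.IsBounded Ω) :
    ∃ C : ℝ, 0 ≤ C ∧ ∀ v : H10 Ω, ‖fnL v‖ ≤ C * ‖wgradL v‖ := by
  obtain ⟨R, hR, hΩR⟩ := hΩ.exists_pos_norm_le
  have hclosed : IsClosed {w : L2Pair Ω | ‖w.fst‖ ≤ 2 * R * ‖w.snd‖} :=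
    isClosed_le (WithLp.prod_continuous_ofLp 2 _ _).fst.norm
      (continuous_const.mul (WithLp.prod_continuous_ofLp 2 _ _).snd.norm)
  have htest : (Submodule.span ℝ (testPairs Ω) : Set (L2Pair Ω)) ⊆
      {w : L2Pair Ω | ‖w.fst‖ ≤ 2 * R * ‖w.snd‖} := fun w hw =>
    norm_fst_le_of_mem_testPairs ⟨0, hd⟩ hR.le hΩR (mem_testPairs_of_mem_span hw)
  exact ⟨2 * R, by positivity, fun v => closure_minimal htest hclosed v.2⟩

section Energy

variable {A : E d → Matrix (Fin d) (Fin d) ℝ} {b : E d → E d} {c : E d → ℝ}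

theorem exists_sqrt_apply_self_le {V : Type*} [SeminormedAddCommGroup V] [NormedSpace ℝ V]
    (a : V →L[ℝ] V →L[ℝ] ℝ) : ∃ C : ℝ, 0 ≤ C ∧ ∀ v, √(a v v) ≤ C * ‖v‖ := by
  refine ⟨√‖a‖, Real.sqrt_nonneg _, fun v => ?_⟩
  calc √(a v v) ≤ √(‖a‖ * ‖v‖ ^ 2) := Real.sqrt_le_sqrt <| by
        rw [sq, ← mul_assoc]
        exact (le_abs_self _).trans (a.le_opNorm₂ v v)
    _ = √‖a‖ * ‖v‖ := by rw [Real.sqrt_mul' _ (sq_nonneg _), Real.sqrt_sq (norm_nonneg v)]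

theorem exists_energyNorm_le (hA : ∀ i j, MemLp (fun x => A x i j) ⊤ (volume.restrict Ω)) :
    ∃ C : ℝ, 0 ≤ C ∧ ∀ v : H10 Ω, energyNorm A v ≤ C * ‖v‖ := by
  simpa only [principalFormL_apply, energyNorm] using
    exists_sqrt_apply_self_le (principalFormL (Ω := Ω) hA)

theorem exists_mul_norm_wgradL_sq_le (h : AdmissibleCoefficients Ω A b c) :
    ∃ α : ℝ, 0 < α ∧ ∀ v : H10 Ω, α * ‖wgradL v‖ ^ 2 ≤ principalForm A v v := by
  obtain ⟨α, hα, hAα⟩ := h.posDef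
  refine ⟨α, hα, fun v => ?_⟩
  rw [← integral_norm_sq, ← integral_const_mul, principalForm]
  refine integral_mono_ae (((Lp.memLp (wgradL v)).integrable_norm_pow two_ne_zero).const_mul α)
    (integrable_principal h.memLp_A v v) ?_
  filter_upwards [hAα] with x hx using hx _

theorem exists_norm_le_energyNorm (hd : 0 < d) (hΩ : Bornology.IsBounded Ω)
    (h : AdmissibleCoefficients Ω A b c) :
    ∃ C : ℝ, 0 ≤ C ∧ ∀ v : H10 Ω, ‖v‖ ≤ C * energyNorm A v := by
  obtain ⟨P, -, hP⟩ := exists_poincare hd hΩ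
  obtain ⟨α, hα, hαA⟩ := exists_mul_norm_wgradL_sq_le h
  refine ⟨√((P ^ 2 + 1) / α), Real.sqrt_nonneg _, fun v => ?_⟩
  rw [energyNorm, ← Real.sqrt_mul (by positivity)]
  apply Real.le_sqrt_of_sq_le
  calc ‖v‖ ^ 2 = ‖fnL v‖ ^ 2 + ‖wgradL v‖ ^ 2 := norm_sq_eq_add_norm_wgradL_sq v
    _ ≤ (P * ‖wgradL v‖) ^ 2 + ‖wgradL v‖ ^ 2 := by gcongr; exact hP v
    _ = (P ^ 2 + 1) / α * (α * ‖wgradL v‖ ^ 2) := by field_simp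
    _ ≤ (P ^ 2 + 1) / α * principalForm A v v := by gcongr; exact hαA v

end Energy

end Poincare

section FiniteElements

variable {d : ℕ} {Ω : Set (E d)}

theorem Elem.isCompact_hull (T : Elem d) : IsCompact (Elem.hull T) :=
  T.finite_toSet.isCompact_convexHull ℝ

theorem memLp_eval (T : Elem d) (q : MvPolynomial (Fin d) ℝ) :
    MemLp (fun x : E d => MvPolynomial.eval x.ofLp q) 2
      ((volume.restrict Ω).restrict (Elem.hull T)) := by
  have hcont : Continuous fun x : E d => MvPolynomial.eval x.ofLp q :=
    (MvPolynomial.continuous_eval q).comp (PiLp.continuous_ofLp 2 _)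
  obtain ⟨C, hC⟩ := (Elem.isCompact_hull T).exists_bound_of_continuousOn hcont.continuousOn
  have : IsFiniteMeasure ((volume.restrict Ω).restrict (Elem.hull T)) :=
    isFiniteMeasure_restrict.2
      ((Measure.restrict_apply_le _ _).trans_lt (Elem.isCompact_hull T).measure_lt_top).ne
  refine MemLp.of_bound hcont.aestronglyMeasurable C ?_
  filter_upwards [ae_restrict_mem (Elem.isCompact_hull T).measurableSet] with x hx using hC x hx

/-- The polynomials of total degree at most `p`, as elements of `L²(Ω ∩ T)`. -/
noncomputable def polyToLp (Ω : Set (E d)) (p : ℕ) (T : Elem d) :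
    MvPolynomial.restrictTotalDegree (Fin d) ℝ p →ₗ[ℝ]
      Lp ℝ 2 ((volume.restrict Ω).restrict (Elem.hull T)) where
  toFun q := (memLp_eval T (q : MvPolynomial (Fin d) ℝ)).toLp _
  map_add' q r := by
    rw [← MemLp.toLp_add]
    congr 1
    funext x
    simp
  map_smul' t q := by
    rw [RingHom.id_apply, ← MemLp.toLp_const_smul]
    congr 1
    funext x
    simp [MvPolynomial.smul_eval]

theorem isPolyOn_iff_mem_range_polyToLp (p : ℕ) (T : Elem d) (v : H10 Ω) :
    IsPolyOn p T v ↔ LpToLpRestrictCLM (E d) ℝ ℝ (volume.restrict Ω) 2 (Elem.hull T) (fnL v) ∈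
      LinearMap.range (polyToLp Ω p T) := by
  have hmeas := (Elem.isCompact_hull T).measurableSet
  have hv := LpToLpRestrictCLM_coeFn ℝ (Elem.hull T) (fnL v)
  constructor
  · rintro ⟨q, hq, hvq⟩
    refine ⟨⟨q, (MvPolynomial.mem_restrictTotalDegree _ _ _).2 hq⟩, Lp.ext ?_⟩
    rw [← ae_restrict_iff' hmeas] at hvq
    filter_upwards [hvq, hv, (memLp_eval (Ω := Ω) T q).coeFn_toLp] with x hvq hv hq
    exact hq.trans (hvq.symm.trans hv.symm)
  · rintro ⟨q, hq⟩
    refine ⟨q, (MvPolynomial.mem_restrictTotalDegree _ _ _).1 q.2, ?_⟩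
    rw [← ae_restrict_iff' hmeas]
    filter_upwards [hv, (memLp_eval (Ω := Ω) T (q : MvPolynomial (Fin d) ℝ)).coeFn_toLp]
      with x hv hq'
    rw [← hq] at hv
    exact hv.symm.trans hq'

theorem isClosed_feSpace (p : ℕ) (TH : Mesh d) : IsClosed (feSpace Ω p TH : Set (H10 Ω)) := by
  have hpreimage : (feSpace Ω p TH : Set (H10 Ω)) = ⋂ T ∈ TH,
      (fun v => LpToLpRestrictCLM (E d) ℝ ℝ (volume.restrict Ω) 2 (Elem.hull T) (fnL v)) ⁻¹'
        (LinearMap.range (polyToLp Ω p T) : Set _) := by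
    ext v
    simp only [Set.mem_iInter, Set.mem_preimage, SetLike.mem_coe,
      ← isPolyOn_iff_mem_range_polyToLp]
    exact Iff.rfl
  rw [hpreimage]
  exact isClosed_biInter fun T _ => (Submodule.closed_of_finiteDimensional _).preimage
    ((ContinuousLinearMap.continuous _).comp fnL.continuous)

theorem feSpace_le_of_subdivision {p : ℕ} {TH Th : Mesh d}
    (h : ∀ T ∈ Th, ∃ T' ∈ TH, Elem.hull T ⊆ Elem.hull T') :
    feSpace Ω p TH ≤ feSpace Ω p Th := by
  intro v hv T hT
  obtain ⟨T', hT', hTT'⟩ := h T hT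
  obtain ⟨q, hq, hvq⟩ := hv T' hT'
  exact ⟨q, hq, hvq.mono fun x hx hxT => hx (hTT' hxT)⟩

end FiniteElements

/-! ### Bounds for Galerkin solutions -/

section AbstractGalerkin

variable {V : Type} [NormedAddCommGroup V] [InnerProductSpace ℝ V] {a : V →L[ℝ] V →L[ℝ] ℝ}

theorem isCoercive_flip (ha : IsCoercive a) : IsCoercive a.flip := ha

theorem isGalerkin_galerkin [CompleteSpace V] (ha : IsCoercive a) {F : V →L[ℝ] ℝ}
    {a' : V → V → ℝ} {F' : V → ℝ} (haa' : ∀ u v, a u v = a' u v) (hFF' : ∀ v, F v = F' v)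
    {X : Submodule ℝ V} (hX : IsClosed (X : Set V)) : IsGalerkin a F X (galerkin a' F' X) := by
  have hiff : ∀ u, (u ∈ X ∧ ∀ v ∈ X, a' u v = F' v) ↔ IsGalerkin a F X u := fun u => by
    simp only [IsGalerkin, haa', hFF']
  obtain ⟨u, hu⟩ := exists_isGalerkin ha F hX
  exact (hiff _).1 (Classical.epsilon_spec (p := fun u => u ∈ X ∧ ∀ v ∈ X, a' u v = F' v)
    ⟨u, (hiff u).2 hu⟩)

theorem exists_norm_isGalerkin_sub_le_of_rhs (ha : IsCoercive a) (H : V →L[ℝ] V →L[ℝ] ℝ) :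
    ∃ B, 0 ≤ B ∧ ∀ (X : Submodule ℝ V) (w w' z z' : V), IsGalerkin a (H w) X z →
      IsGalerkin a (H w') X z' → ‖z - z'‖ ≤ B * ‖w - w'‖ := by
  obtain ⟨B, hB, hle⟩ := exists_norm_isGalerkin_le ha
  refine ⟨B * ‖H‖, by positivity, fun X w w' z z' hz hz' => ?_⟩
  calc ‖z - z'‖ ≤ B * ‖H (w - w')‖ := by
        rw [map_sub]
        exact hle _ _ _ (hz.sub hz')
    _ ≤ B * (‖H‖ * ‖w - w'‖) := by gcongr; exact H.le_opNorm _
    _ = B * ‖H‖ * ‖w - w'‖ := (mul_assoc _ _ _).symm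

/-- The bounds on Galerkin solutions of a primal problem with form `a` and of dual problems with
right-hand side `H w` that drive the analysis of the adaptive algorithm: quasi-optimality, Lipschitz
dependence of the dual solutions on the linearization point `w`, and oscillation bounds along nested
spaces. Errors are measured by `N`, which is the norm of `V` or an equivalent energy norm. -/
structure GalerkinBounds (N : V → ℝ) (a H : V →L[ℝ] V →L[ℝ] ℝ) (C : ℝ) (M : ℝ → ℕ) : Prop where
  primal_cea : ∀ {F : V →L[ℝ] ℝ} {X : Submodule ℝ V} {w u v : V}, IsGalerkin a F ⊤ w →
    IsGalerkin a F X u → v ∈ X → N (u - v) ≤ C * N (w - v)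
  dual_cea : ∀ {F : V →L[ℝ] ℝ} {X : Submodule ℝ V} {w u v : V}, IsGalerkin a.flip F ⊤ w →
    IsGalerkin a.flip F X u → v ∈ X → N (u - v) ≤ C * N (w - v)
  dual_lipschitz : ∀ {X : Submodule ℝ V} {w w' z z' : V}, IsGalerkin a.flip (H w) X z →
    IsGalerkin a.flip (H w') X z' → N (z - z') ≤ C * N (w - w')
  primal_oscillation : ∀ {ε : ℝ} {X : ℕ →o ClosedSubmodule ℝ V} {F : V →L[ℝ] ℝ} {w : V}
    {u : ℕ → V}, 0 < ε → IsGalerkin a F ⊤ w → (∀ k, IsGalerkin a F (X k).toSubmodule (u k)) →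
    OscillationLE (fun k l => N (u l - u k)) (ε * N (w - u 0)) (M ε)
  dual_oscillation : ∀ {ε : ℝ} {X : ℕ →o ClosedSubmodule ℝ V} {F : V →L[ℝ] ℝ} {w : V}
    {u : ℕ → V} {y : V} {z : ℕ → ℕ → V}, 0 < ε → IsGalerkin a F ⊤ w →
    (∀ k, IsGalerkin a F (X k).toSubmodule (u k)) → IsGalerkin a.flip (H (u 0)) ⊤ y →
    (∀ k l, IsGalerkin a.flip (H (u k)) (X l).toSubmodule (z k l)) →
    OscillationLE (fun k l => N (z k l - z k k)) (ε * (N (w - u 0) + N (y - z 0 0))) (M ε)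

theorem exists_galerkinBounds_norm [CompleteSpace V] (ha : IsCoercive a)
    (H : V →L[ℝ] V →L[ℝ] ℝ) : ∃ C M, 0 ≤ C ∧ GalerkinBounds norm a H C M := by
  have ha' := isCoercive_flip ha
  obtain ⟨B₁, hB₁, hcea⟩ := exists_norm_isGalerkin_sub_le ha
  obtain ⟨B₂, hB₂, hcea'⟩ := exists_norm_isGalerkin_sub_le ha'
  obtain ⟨B₃, hB₃, hlip⟩ := exists_norm_isGalerkin_sub_le_of_rhs ha' H
  choose! M₁ hM₁ using fun ε (hε : 0 < ε) => exists_oscillationLE_isGalerkin ha hε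
  choose! M₂ hM₂ using fun ε (hε : 0 < ε) => exists_oscillationLE_nested_isGalerkin ha ha' H hε
  have hle : ∀ {B : ℝ} (x : V), B ≤ B₁ + B₂ + B₃ → B * ‖x‖ ≤ (B₁ + B₂ + B₃) * ‖x‖ :=
    fun x hB => mul_le_mul_of_nonneg_right hB (norm_nonneg x)
  exact ⟨B₁ + B₂ + B₃, fun ε => max (M₁ ε) (M₂ ε), by positivity,
    { primal_cea := fun hw hu hv => (hcea _ _ _ _ _ hw hu hv).trans (hle _ (by linarith))
      dual_cea := fun hw hu hv => (hcea' _ _ _ _ _ hw hu hv).trans (hle _ (by linarith))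
      dual_lipschitz := fun hz hz' => (hlip _ _ _ _ _ hz hz').trans (hle _ (by linarith))
      primal_oscillation := fun hε hw hu =>
        (hM₁ _ hε _ _ _ _ hw hu).mono_count (le_max_left _ _)
      dual_oscillation := fun hε hw hu hy hz =>
        (hM₂ _ hε _ _ _ _ _ _ hw hu hy hz).mono_count (le_max_right _ _) }⟩

theorem GalerkinBounds.of_equiv {H : V →L[ℝ] V →L[ℝ] ℝ} {C R : ℝ} {M : ℝ → ℕ} {N : V → ℝ}
    (h : GalerkinBounds norm a H C M) (hC : 0 ≤ C) (hR : 0 < R) (hN : ∀ v, N v ≤ R * ‖v‖)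
    (hnorm : ∀ v, ‖v‖ ≤ R * N v) :
    GalerkinBounds N a H (C * R ^ 2) fun ε => M (ε / R ^ 2) := by
  have htransfer : ∀ {x : V} {B r s : ℝ}, 0 ≤ B → ‖x‖ ≤ B * r → r ≤ R * s →
      N x ≤ B * R ^ 2 * s := fun {x B r s} hB hx hr =>
    calc N x ≤ R * ‖x‖ := hN x
      _ ≤ R * (B * (R * s)) := by gcongr; exact hx.trans (by gcongr)
      _ = B * R ^ 2 * s := by ring
  have htransfer_div : ∀ {x : V} {ε r s : ℝ}, 0 < ε → ‖x‖ ≤ ε / R ^ 2 * r → r ≤ R * s →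
      N x ≤ ε * s := fun hε hx hr =>
    (htransfer (by positivity) hx hr).trans_eq (by field_simp)
  exact
    { primal_cea := fun hw hu hv => htransfer hC (h.primal_cea hw hu hv) (hnorm _)
      dual_cea := fun hw hu hv => htransfer hC (h.dual_cea hw hu hv) (hnorm _)
      dual_lipschitz := fun hz hz' => htransfer hC (h.dual_lipschitz hz hz') (hnorm _)
      primal_oscillation := fun {ε X F w u} hε hw hu =>
        (h.primal_oscillation (ε := ε / R ^ 2) (by positivity) hw hu).mono fun k l hkl =>
          htransfer_div hε hkl (hnorm _)
      dual_oscillation := fun {ε X F w u y z} hε hw hu hy hz =>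
        (h.dual_oscillation (ε := ε / R ^ 2) (by positivity) hw hu hy hz).mono fun k l hkl =>
          htransfer_div hε hkl
            ((add_le_add (hnorm _) (hnorm _)).trans_eq (mul_add _ _ _).symm) }

end AbstractGalerkin

section Solutions

variable {d : ℕ} {Ω : Set (E d)} {A : E d → Matrix (Fin d) (Fin d) ℝ} {b : E d → E d} {c : E d → ℝ}

theorem isGalerkin_primal (h : AdmissibleCoefficients Ω A b c) {f : E d → ℝ} {ff : E d → E d}
    (hf : MemLp f 2 (volume.restrict Ω)) (hff : MemLp ff 2 (volume.restrict Ω))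
    {X : Submodule ℝ (H10 Ω)} (hX : IsClosed (X : Set (H10 Ω))) :
    IsGalerkin (bilinL h) (loadL hf hff) X (primal A b c f ff X) :=
  isGalerkin_galerkin (isCoercive_bilinL h) (bilinL_apply h) (loadL_apply hf hff) hX

/-- The map `w ↦ (v ↦ ⟨K v, w⟩ + ⟨K w, v⟩)`, i.e. the derivative of the goal functional
`w ↦ ⟨K w, w⟩`. -/
noncomputable def goalDerivative (K : H10 Ω →L[ℝ] Hneg1 Ω) : H10 Ω →L[ℝ] Hneg1 Ω := K.flip + K

theorem isGalerkin_dual (h : AdmissibleCoefficients Ω A b c) (K : H10 Ω →L[ℝ] Hneg1 Ω) (w : H10 Ω)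
    {X : Submodule ℝ (H10 Ω)} (hX : IsClosed (X : Set (H10 Ω))) :
    IsGalerkin (bilinL h).flip (goalDerivative K w) X (dual A b c K w X) :=
  isGalerkin_galerkin (isCoercive_flip (isCoercive_bilinL h)) (fun z v => bilinL_apply h v z)
    (fun _ => rfl) hX

theorem exists_energyNorm_equiv (hd : 0 < d) (hΩ : Bornology.IsBounded Ω)
    (h : AdmissibleCoefficients Ω A b c) :
    ∃ C : ℝ, 0 < C ∧ (∀ v : H10 Ω, energyNorm A v ≤ C * ‖v‖) ∧
      ∀ v : H10 Ω, ‖v‖ ≤ C * energyNorm A v := by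
  obtain ⟨C, hC, hle⟩ := exists_energyNorm_le (Ω := Ω) h.memLp_A
  obtain ⟨C', hC', hle'⟩ := exists_norm_le_energyNorm hd hΩ h
  have henergy : ∀ v : H10 Ω, 0 ≤ energyNorm A v := fun _ => Real.sqrt_nonneg _
  refine ⟨C + C' + 1, by positivity, fun v => (hle v).trans ?_, fun v => (hle' v).trans ?_⟩
  · gcongr
    linarith
  · exact mul_le_mul_of_nonneg_right (by linarith) (henergy v)

theorem exists_galerkinBounds (hd : 0 < d) (hΩ : Bornology.IsBounded Ω)
    (h : AdmissibleCoefficients Ω A b c) (K : H10 Ω →L[ℝ] Hneg1 Ω) :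
    ∃ C M, 0 ≤ C ∧ GalerkinBounds (energyNorm A) (bilinL h) (goalDerivative K) C M := by
  obtain ⟨C, M, hC, hbounds⟩ := exists_galerkinBounds_norm (isCoercive_bilinL h) (goalDerivative K)
  obtain ⟨R, hR, henergy, hnorm⟩ := exists_energyNorm_equiv hd hΩ h
  exact ⟨_, _, by positivity, hbounds.of_equiv hC hR henergy hnorm⟩

end Solutions

/-! ### Refinement indicators -/

section Indicators

/-- The estimator `(∑_{T ∈ U} f(T)²)^{1/2}` of a family of refinement indicators `f`. -/
noncomputable def indicatorNorm {α : Type*} (f : α → ℝ) (U : Finset α) : ℝ := √(∑ T ∈ U, f T ^ 2)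

/-- The indicators of the combined estimator of two families `f`, `g`. -/
noncomputable def jointIndicator {α : Type*} (f g : α → ℝ) (T : α) : ℝ := √(f T ^ 2 + g T ^ 2)

variable {α : Type*} {f g f' g' : α → ℝ} {S S' U M : Finset α} {q θ δ δ' : ℝ}

theorem indicatorNorm_nonneg (f : α → ℝ) (U : Finset α) : 0 ≤ indicatorNorm f U :=
  Real.sqrt_nonneg _

theorem indicatorNorm_sq (f : α → ℝ) (U : Finset α) :
    indicatorNorm f U ^ 2 = ∑ T ∈ U, f T ^ 2 :=
  Real.sq_sqrt (Finset.sum_nonneg fun _ _ => sq_nonneg _)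

theorem indicatorNorm_mono (h : U ⊆ S) : indicatorNorm f U ≤ indicatorNorm f S :=
  Real.sqrt_le_sqrt (Finset.sum_le_sum_of_subset_of_nonneg h fun _ _ _ => sq_nonneg _)

theorem indicatorNorm_inter_sq_add_sdiff_sq [DecidableEq α] (f : α → ℝ) (S S' : Finset α) :
    indicatorNorm f (S ∩ S') ^ 2 + indicatorNorm f (S \ S') ^ 2 = indicatorNorm f S ^ 2 := by
  simp only [indicatorNorm_sq, Finset.sum_inter_add_sum_sdiff]

theorem indicatorNorm_joint (f g : α → ℝ) (U : Finset α) :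
    indicatorNorm (jointIndicator f g) U = √(indicatorNorm f U ^ 2 + indicatorNorm g U ^ 2) := by
  simp only [indicatorNorm_sq, ← Finset.sum_add_distrib]
  simp only [indicatorNorm, jointIndicator, Real.sq_sqrt (add_nonneg (sq_nonneg _) (sq_nonneg _))]

theorem indicatorNorm_joint_sq (f g : α → ℝ) (U : Finset α) :
    indicatorNorm (jointIndicator f g) U ^ 2 = indicatorNorm f U ^ 2 + indicatorNorm g U ^ 2 := by
  rw [indicatorNorm_joint, Real.sq_sqrt (by positivity)]

theorem indicatorNorm_le_joint_left (f g : α → ℝ) (U : Finset α) :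
    indicatorNorm f U ≤ indicatorNorm (jointIndicator f g) U := by
  rw [indicatorNorm_joint]
  exact Real.le_sqrt_of_sq_le (le_add_of_nonneg_right (sq_nonneg _))

theorem indicatorNorm_le_joint_right (f g : α → ℝ) (U : Finset α) :
    indicatorNorm g U ≤ indicatorNorm (jointIndicator f g) U := by
  rw [indicatorNorm_joint]
  exact Real.le_sqrt_of_sq_le (le_add_of_nonneg_left (sq_nonneg _))

theorem indicatorNorm_joint_le_add (f g : α → ℝ) (U : Finset α) :
    indicatorNorm (jointIndicator f g) U ≤ indicatorNorm f U + indicatorNorm g U := by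
  have hf := indicatorNorm_nonneg f U
  have hg := indicatorNorm_nonneg g U
  rw [indicatorNorm_joint]
  exact Real.sqrt_le_iff.2 ⟨by positivity, by nlinarith [mul_nonneg hf hg]⟩

theorem sqrt_sq_add_sq_le_of_le_add {a a' r r' x x' : ℝ} (ha : 0 ≤ a) (ha' : 0 ≤ a') (hx : 0 ≤ x)
    (hx' : 0 ≤ x') (h : a ≤ r + x) (h' : a' ≤ r' + x') :
    √(a ^ 2 + a' ^ 2) ≤ √(r ^ 2 + r' ^ 2) + (x + x') := by
  have hsq : √(r ^ 2 + r' ^ 2) ^ 2 = r ^ 2 + r' ^ 2 := Real.sq_sqrt (by positivity)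
  have hr : r ≤ √(r ^ 2 + r' ^ 2) := Real.le_sqrt_of_sq_le (by linarith [sq_nonneg r'])
  have hr' : r' ≤ √(r ^ 2 + r' ^ 2) := Real.le_sqrt_of_sq_le (by linarith [sq_nonneg r])
  refine Real.sqrt_le_iff.2 ⟨by positivity, ?_⟩
  calc a ^ 2 + a' ^ 2 ≤ (r + x) ^ 2 + (r' + x') ^ 2 := by gcongr
    _ ≤ (√(r ^ 2 + r' ^ 2) + (x + x')) ^ 2 := by
      nlinarith [mul_le_mul_of_nonneg_right hr hx, mul_le_mul_of_nonneg_right hr' hx',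
        mul_nonneg hx hx']

theorem indicatorNorm_joint_le_mul_add (hq : 0 ≤ q) (hδ : 0 ≤ δ) (hδ' : 0 ≤ δ')
    (h : indicatorNorm f S ≤ q * indicatorNorm f' S' + δ)
    (h' : indicatorNorm g S ≤ q * indicatorNorm g' S' + δ') :
    indicatorNorm (jointIndicator f g) S ≤
      q * indicatorNorm (jointIndicator f' g') S' + (δ + δ') := by
  rw [indicatorNorm_joint, indicatorNorm_joint]
  refine (sqrt_sq_add_sq_le_of_le_add (indicatorNorm_nonneg _ _) (indicatorNorm_nonneg _ _)
    hδ hδ' h h').trans_eq ?_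
  rw [mul_pow, mul_pow, ← mul_add, Real.sqrt_mul (sq_nonneg q), Real.sqrt_sq hq]

variable [DecidableEq α]

/-- Up to the perturbation `δ`, the indicators `g` on the refined mesh `S'` are dominated by the
indicators `f` on the mesh `S` where the meshes agree and contracted by the factor `q` where they
differ. -/
structure IsReduction (f g : α → ℝ) (S S' : Finset α) (q δ : ℝ) : Prop where
  inter_le : indicatorNorm g (S' ∩ S) ≤ indicatorNorm f (S ∩ S') + δ
  sdiff_le : indicatorNorm g (S' \ S) ≤ q * indicatorNorm f (S \ S') + δ
  nonneg : 0 ≤ δ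

namespace IsReduction

theorem mono (h : IsReduction f g S S' q δ) (hδ : δ ≤ δ') : IsReduction f g S S' q δ' :=
  ⟨h.inter_le.trans (by gcongr), h.sdiff_le.trans (by gcongr), h.nonneg.trans hδ⟩

theorem perturb (h : IsReduction f g S S' q δ) (hδ' : 0 ≤ δ')
    (hg : ∀ U ⊆ S', indicatorNorm g' U ≤ indicatorNorm g U + δ') :
    IsReduction f g' S S' q (δ + δ') where
  inter_le := by linarith [hg (S' ∩ S) Finset.inter_subset_left, h.inter_le]
  sdiff_le := by linarith [hg (S' \ S) Finset.sdiff_subset, h.sdiff_le]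
  nonneg := add_nonneg h.nonneg hδ'

theorem joint (hq : 0 ≤ q) (h : IsReduction f g S S' q δ) (h' : IsReduction f' g' S S' q δ') :
    IsReduction (jointIndicator f f') (jointIndicator g g') S S' q (δ + δ') where
  inter_le := by
    simpa only [one_mul] using indicatorNorm_joint_le_mul_add zero_le_one h.nonneg h'.nonneg
      (by simpa only [one_mul] using h.inter_le) (by simpa only [one_mul] using h'.inter_le)
  sdiff_le := indicatorNorm_joint_le_mul_add hq h.nonneg h'.nonneg h.sdiff_le h'.sdiff_le
  nonneg := add_nonneg h.nonneg h'.nonneg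

theorem le_sqrt (h : IsReduction f g S S' q δ) :
    indicatorNorm g S' ≤
      √(indicatorNorm f (S ∩ S') ^ 2 + (q * indicatorNorm f (S \ S')) ^ 2) + 2 * δ := by
  rw [← Real.sqrt_sq (indicatorNorm_nonneg g S'), ← indicatorNorm_inter_sq_add_sdiff_sq g S' S,
    two_mul]
  exact sqrt_sq_add_sq_le_of_le_add (indicatorNorm_nonneg _ _) (indicatorNorm_nonneg _ _)
    h.nonneg h.nonneg h.inter_le h.sdiff_le

theorem le_of_doerfler (h : IsReduction f g S S' q δ) (hq0 : 0 ≤ q) (hq1 : q ≤ 1)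
    (hM : M ⊆ S \ S') (hθ : θ * indicatorNorm f S ^ 2 ≤ indicatorNorm f M ^ 2) :
    indicatorNorm g S' ≤ √(1 - (1 - q ^ 2) * θ) * indicatorNorm f S + 2 * δ := by
  refine h.le_sqrt.trans (add_le_add_left ?_ _)
  set x := indicatorNorm f (S ∩ S')
  set r := indicatorNorm f (S \ S')
  have hsplit : x ^ 2 + r ^ 2 = indicatorNorm f S ^ 2 := indicatorNorm_inter_sq_add_sdiff_sq f S S'
  have hr : θ * indicatorNorm f S ^ 2 ≤ r ^ 2 :=
    hθ.trans (pow_le_pow_left₀ (indicatorNorm_nonneg _ _) (indicatorNorm_mono hM) 2)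
  have hq : 0 ≤ 1 - q ^ 2 := by nlinarith
  have hle : x ^ 2 + (q * r) ^ 2 ≤ (1 - (1 - q ^ 2) * θ) * indicatorNorm f S ^ 2 := by
    linear_combination mul_le_mul_of_nonneg_left hr hq + hsplit
  calc √(x ^ 2 + (q * r) ^ 2) ≤ √((1 - (1 - q ^ 2) * θ) * indicatorNorm f S ^ 2) :=
        Real.sqrt_le_sqrt hle
    _ = √(1 - (1 - q ^ 2) * θ) * indicatorNorm f S := by
        rw [Real.sqrt_mul' _ (sq_nonneg _), Real.sqrt_sq (indicatorNorm_nonneg _ _)]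

theorem le (h : IsReduction f g S S' q δ) (hq0 : 0 ≤ q) (hq1 : q ≤ 1) :
    indicatorNorm g S' ≤ indicatorNorm f S + 2 * δ := by
  simpa using h.le_of_doerfler hq0 hq1 (Finset.empty_subset _) (θ := 0) (by simp [indicatorNorm_sq])

end IsReduction

end Indicators

/-! ### Estimators under mesh refinement -/

theorem energyNorm_nonneg {d : ℕ} {Ω : Set (E d)} (A : E d → Matrix (Fin d) (Fin d) ℝ)
    (v : H10 Ω) : 0 ≤ energyNorm A v := Real.sqrt_nonneg _

theorem energyNorm_zero {d : ℕ} {Ω : Set (E d)} {A : E d → Matrix (Fin d) (Fin d) ℝ}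
    {b : E d → E d} {c : E d → ℝ} (h : AdmissibleCoefficients Ω A b c) :
    energyNorm A (0 : H10 Ω) = 0 := by
  obtain ⟨C, -, hle⟩ := exists_energyNorm_le (Ω := Ω) h.memLp_A
  exact le_antisymm (by simpa using hle 0) (energyNorm_nonneg A 0)

theorem energyNorm_sub_comm {d : ℕ} {Ω : Set (E d)} {A : E d → Matrix (Fin d) (Fin d) ℝ}
    {b : E d → E d} {c : E d → ℝ} (h : AdmissibleCoefficients Ω A b c) (v w : H10 Ω) :
    energyNorm A (v - w) = energyNorm A (w - v) := by
  rw [← neg_sub w v, energyNorm, energyNorm, ← principalFormL_apply h.memLp_A,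
    ← principalFormL_apply h.memLp_A, ContinuousLinearMap.map_neg₂, map_neg, neg_neg]

namespace Discretization

section Indicators

variable {d : ℕ} {Ω : Set (E d)} (D : Discretization Ω) (A : E d → Matrix (Fin d) (Fin d) ℝ)
  (b : E d → E d) (c : E d → ℝ) (K : H10 Ω →L[ℝ] Hneg1 Ω)

/-- The indicators `η_H(T, u_H)` of the discrete primal solution. -/
noncomputable def primalIndicator (TH : Mesh d) (T : Elem d) : ℝ := D.eta TH T (D.uH A b c TH)

/-- The indicators `ζ_H[w](T, z_H[w])` of the discrete dual solution linearized at `w`. -/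
noncomputable def dualIndicator (w : H10 Ω) (TH : Mesh d) (T : Elem d) : ℝ :=
  D.zeta w TH T (D.zH A b c K w TH)

/-- The indicators `(η_H(T, u_H)² + ζ_H(T, z_H[u_H])²)^{1/2}` of the combined estimator. -/
noncomputable def combinedIndicator (TH : Mesh d) : Elem d → ℝ :=
  jointIndicator (D.primalIndicator A b c TH) (D.dualIndicator A b c K (D.uH A b c TH) TH)

theorem indicatorNorm_primal_le_combined (TH : Mesh d) (U : Finset (Elem d)) :
    indicatorNorm (D.primalIndicator A b c TH) U ≤
      indicatorNorm (D.combinedIndicator A b c K TH) U :=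
  indicatorNorm_le_joint_left _ _ _

theorem indicatorNorm_dual_le_combined (TH : Mesh d) (U : Finset (Elem d)) :
    indicatorNorm (D.dualIndicator A b c K (D.uH A b c TH) TH) U ≤
      indicatorNorm (D.combinedIndicator A b c K TH) U :=
  indicatorNorm_le_joint_right _ _ _

theorem estProduct_eq_indicatorNorm_mul (TH : Mesh d) :
    D.estProduct A b c K TH =
      indicatorNorm (D.primalIndicator A b c TH) TH *
        indicatorNorm (D.combinedIndicator A b c K TH) TH := by
  rw [combinedIndicator, indicatorNorm_joint]
  rfl

theorem doerflerU_iff (θ : ℝ) (TH : Mesh d) (M : Finset (Elem d)) :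
    D.DoerflerU A b c θ TH M ↔ θ * indicatorNorm (D.primalIndicator A b c TH) TH ^ 2 ≤
      indicatorNorm (D.primalIndicator A b c TH) M ^ 2 := Iff.rfl

theorem doerflerUZ_iff (θ : ℝ) (TH : Mesh d) (M : Finset (Elem d)) :
    D.DoerflerUZ A b c K θ TH M ↔ θ * indicatorNorm (D.combinedIndicator A b c K TH) TH ^ 2 ≤
      indicatorNorm (D.combinedIndicator A b c K TH) M ^ 2 := by
  rw [combinedIndicator, indicatorNorm_joint_sq, indicatorNorm_joint_sq]
  rfl

end Indicators

variable {d : ℕ} {Ω : Set (E d)} {D : Discretization Ω}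
  {A : E d → Matrix (Fin d) (Fin d) ℝ} {b : E d → E d} {c : E d → ℝ} {K : H10 Ω →L[ℝ] Hneg1 Ω}
  {Cmesh Cstab qred Crel Cdrel : ℝ} {TH Th : Mesh d}

theorem mem_meshes_of_refines (hTH : TH ∈ D.meshes) (href : Refines D.refine TH Th) :
    Th ∈ D.meshes :=
  Relation.ReflTransGen.trans hTH href

namespace Admissible

theorem X_mono (hD : D.Admissible A b c K Cmesh Cstab qred Crel Cdrel) (hTH : TH ∈ D.meshes)
    (href : Refines D.refine TH Th) : D.X TH ≤ D.X Th := by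
  induction href with
  | refl => exact le_rfl
  | @tail T T' hT hstep ih =>
    obtain ⟨M, hM, rfl⟩ := hstep
    exact ih.trans (feSpace_le_of_subdivision
      (hD.refinement.subdivision T (mem_meshes_of_refines hTH hT) M hM))

theorem isGalerkin_u (hD : D.Admissible A b c K Cmesh Cstab qred Crel Cdrel)
    (h : AdmissibleCoefficients Ω A b c) :
    IsGalerkin (bilinL h) (loadL hD.memLp_f hD.memLp_ff) ⊤ (D.u A b c) :=
  isGalerkin_primal h hD.memLp_f hD.memLp_ff isClosed_univ

theorem isGalerkin_uH (hD : D.Admissible A b c K Cmesh Cstab qred Crel Cdrel)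
    (h : AdmissibleCoefficients Ω A b c) (TH : Mesh d) :
    IsGalerkin (bilinL h) (loadL hD.memLp_f hD.memLp_ff) (D.X TH) (D.uH A b c TH) :=
  isGalerkin_primal h hD.memLp_f hD.memLp_ff (isClosed_feSpace _ _)

theorem uH_mem (hD : D.Admissible A b c K Cmesh Cstab qred Crel Cdrel)
    (h : AdmissibleCoefficients Ω A b c) (TH : Mesh d) : D.uH A b c TH ∈ D.X TH :=
  (hD.isGalerkin_uH h TH).1

end Admissible

theorem isGalerkin_zH (D : Discretization Ω) (h : AdmissibleCoefficients Ω A b c)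
    (K : H10 Ω →L[ℝ] Hneg1 Ω) (w : H10 Ω) (TH : Mesh d) :
    IsGalerkin (bilinL h).flip (goalDerivative K w) (D.X TH) (D.zH A b c K w TH) :=
  isGalerkin_dual h K w (isClosed_feSpace _ _)

theorem zH_mem (D : Discretization Ω) (h : AdmissibleCoefficients Ω A b c)
    (K : H10 Ω →L[ℝ] Hneg1 Ω) (w : H10 Ω) (TH : Mesh d) : D.zH A b c K w TH ∈ D.X TH :=
  (D.isGalerkin_zH h K w TH).1

namespace Admissible

section Stability

open Classical in
theorem abs_etaOn_sub_le (hD : D.Admissible A b c K Cmesh Cstab qred Crel Cdrel)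
    (h : AdmissibleCoefficients Ω A b c) (hTH : TH ∈ D.meshes) (href : Refines D.refine TH Th)
    {vh vH : H10 Ω} (hvh : vh ∈ D.X Th) (hvH : vH ∈ D.X TH) {U : Finset (Elem d)}
    (hU : U ⊆ Th ∩ TH) :
    |D.etaOn Th U vh - D.etaOn TH U vH| ≤ Cstab * energyNorm A (vh - vH) := by
  have hstab := hD.adaptivity.stability TH hTH Th href vh hvh vH hvH 0 0 U hU
  rw [sub_self, energyNorm_zero h, add_zero] at hstab
  exact (le_add_of_nonneg_right (abs_nonneg _)).trans hstab

open Classical in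
theorem abs_zetaOn_sub_le (hD : D.Admissible A b c K Cmesh Cstab qred Crel Cdrel)
    (hTH : TH ∈ D.meshes) (href : Refines D.refine TH Th) {vh vH : H10 Ω} (hvh : vh ∈ D.X Th)
    (hvH : vH ∈ D.X TH) (wh wH : H10 Ω) {U : Finset (Elem d)} (hU : U ⊆ Th ∩ TH) :
    |D.zetaOn wh Th U vh - D.zetaOn wH TH U vH| ≤
      Cstab * (energyNorm A (vh - vH) + energyNorm A (wh - wH)) :=
  (le_add_of_nonneg_left (abs_nonneg _)).trans
    (hD.adaptivity.stability TH hTH Th href vh hvh vH hvH wh wH U hU)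

open Classical in
theorem abs_indicatorNorm_primal_sub_le (hD : D.Admissible A b c K Cmesh Cstab qred Crel Cdrel)
    (h : AdmissibleCoefficients Ω A b c) (hTH : TH ∈ D.meshes) (href : Refines D.refine TH Th) :
    |indicatorNorm (D.primalIndicator A b c Th) (Th ∩ TH) -
        indicatorNorm (D.primalIndicator A b c TH) (Th ∩ TH)| ≤
      Cstab * energyNorm A (D.uH A b c Th - D.uH A b c TH) :=
  hD.abs_etaOn_sub_le h hTH href (hD.uH_mem h Th) (hD.uH_mem h TH) Finset.Subset.rfl

open Classical in
theorem abs_indicatorNorm_dual_sub_le (hD : D.Admissible A b c K Cmesh Cstab qred Crel Cdrel)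
    (h : AdmissibleCoefficients Ω A b c) (hTH : TH ∈ D.meshes) (href : Refines D.refine TH Th)
    (w : H10 Ω) :
    |indicatorNorm (D.dualIndicator A b c K w Th) (Th ∩ TH) -
        indicatorNorm (D.dualIndicator A b c K w TH) (Th ∩ TH)| ≤
      Cstab * energyNorm A (D.zH A b c K w Th - D.zH A b c K w TH) := by
  have hstab := hD.abs_zetaOn_sub_le hTH href (D.zH_mem h K w Th) (D.zH_mem h K w TH) w w
    (Finset.Subset.refl (Th ∩ TH))
  rwa [sub_self, energyNorm_zero h, add_zero] at hstab

open Classical in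
theorem isReduction_primal (hD : D.Admissible A b c K Cmesh Cstab qred Crel Cdrel)
    (h : AdmissibleCoefficients Ω A b c) (hCstab : 0 ≤ Cstab) (hTH : TH ∈ D.meshes)
    (href : Refines D.refine TH Th) :
    IsReduction (D.primalIndicator A b c TH) (D.primalIndicator A b c Th) TH Th qred
      (Cstab * energyNorm A (D.uH A b c Th - D.uH A b c TH)) where
  inter_le := by
    rw [Finset.inter_comm TH Th]
    linarith [abs_le.1 (hD.abs_indicatorNorm_primal_sub_le h hTH href)]
  sdiff_le := by
    have hstab := hD.abs_etaOn_sub_le h (mem_meshes_of_refines hTH href) .refl (hD.uH_mem h Th)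
      (hD.X_mono hTH href (hD.uH_mem h TH)) (U := Th \ TH) (by simp)
    have hred := hD.adaptivity.reduction_eta TH hTH Th href _ (hD.uH_mem h TH)
    exact (sub_le_iff_le_add'.1 (le_of_abs_le hstab)).trans (add_le_add_left hred _)
  nonneg := mul_nonneg hCstab (energyNorm_nonneg _ _)

open Classical in
theorem isReduction_dual (hD : D.Admissible A b c K Cmesh Cstab qred Crel Cdrel)
    (h : AdmissibleCoefficients Ω A b c) (hCstab : 0 ≤ Cstab) (hTH : TH ∈ D.meshes)
    (href : Refines D.refine TH Th) (w : H10 Ω) :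
    IsReduction (D.dualIndicator A b c K w TH) (D.dualIndicator A b c K w Th) TH Th qred
      (Cstab * energyNorm A (D.zH A b c K w Th - D.zH A b c K w TH)) where
  inter_le := by
    rw [Finset.inter_comm TH Th]
    linarith [abs_le.1 (hD.abs_indicatorNorm_dual_sub_le h hTH href w)]
  sdiff_le := by
    have hstab := hD.abs_zetaOn_sub_le (mem_meshes_of_refines hTH href) .refl (D.zH_mem h K w Th)
      (hD.X_mono hTH href (D.zH_mem h K w TH)) w w (U := Th \ TH) (by simp)
    rw [sub_self, energyNorm_zero h, add_zero] at hstab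
    have hred := hD.adaptivity.reduction_zeta TH hTH Th href _ (D.zH_mem h K w TH) w
    exact (sub_le_iff_le_add'.1 (le_of_abs_le hstab)).trans (add_le_add_left hred _)
  nonneg := mul_nonneg hCstab (energyNorm_nonneg _ _)

end Stability

section Bounds

variable {h : AdmissibleCoefficients Ω A b c} {C : ℝ} {M : ℝ → ℕ}

theorem indicatorNorm_dual_le_add (hD : D.Admissible A b c K Cmesh Cstab qred Crel Cdrel)
    (hG : GalerkinBounds (energyNorm A) (bilinL h) (goalDerivative K) C M) (hCstab : 0 ≤ Cstab)
    (hTH : TH ∈ D.meshes) (w w' : H10 Ω) {U : Finset (Elem d)} (hU : U ⊆ TH) :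
    indicatorNorm (D.dualIndicator A b c K w TH) U ≤
      indicatorNorm (D.dualIndicator A b c K w' TH) U +
        Cstab * (C + 1) * energyNorm A (w - w') := by
  have hstab := hD.abs_zetaOn_sub_le hTH .refl (D.zH_mem h K w TH) (D.zH_mem h K w' TH) w w'
    (U := U) (by simpa using hU)
  have hlip := hG.dual_lipschitz (D.isGalerkin_zH h K w TH) (D.isGalerkin_zH h K w' TH)
  calc indicatorNorm (D.dualIndicator A b c K w TH) U
      ≤ indicatorNorm (D.dualIndicator A b c K w' TH) U +
          Cstab * (energyNorm A (D.zH A b c K w TH - D.zH A b c K w' TH) +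
            energyNorm A (w - w')) := sub_le_iff_le_add'.1 (le_of_abs_le hstab)
    _ ≤ _ := by
        rw [mul_assoc, add_one_mul]
        gcongr

open Classical in
theorem isReduction_combined (hD : D.Admissible A b c K Cmesh Cstab qred Crel Cdrel)
    (hG : GalerkinBounds (energyNorm A) (bilinL h) (goalDerivative K) C M) (hC : 0 ≤ C)
    (hCstab : 0 ≤ Cstab) (hq : 0 ≤ qred) (hTH : TH ∈ D.meshes) (href : Refines D.refine TH Th) :
    IsReduction (D.combinedIndicator A b c K TH) (D.combinedIndicator A b c K Th) TH Th qred
      (Cstab * (C + 2) * (energyNorm A (D.uH A b c Th - D.uH A b c TH) +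
        energyNorm A (D.zH A b c K (D.uH A b c TH) Th - D.zH A b c K (D.uH A b c TH) TH))) := by
  have hTh := mem_meshes_of_refines hTH href
  have hE := energyNorm_nonneg A (D.uH A b c Th - D.uH A b c TH)
  have hE' := energyNorm_nonneg A
    (D.zH A b c K (D.uH A b c TH) Th - D.zH A b c K (D.uH A b c TH) TH)
  have hdual := (hD.isReduction_dual h hCstab hTH href (D.uH A b c TH)).perturb
    (mul_nonneg (mul_nonneg hCstab (by positivity : 0 ≤ C + 1)) hE)
    fun U hU => hD.indicatorNorm_dual_le_add hG hCstab hTh (D.uH A b c Th) (D.uH A b c TH) hU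
  refine ((hD.isReduction_primal h hCstab hTH href).joint hq hdual).mono ?_
  nlinarith [mul_nonneg hCstab (mul_nonneg (by positivity : 0 ≤ C + 1) hE')]

theorem energyNorm_uH_sub_le (hD : D.Admissible A b c K Cmesh Cstab qred Crel Cdrel)
    (hG : GalerkinBounds (energyNorm A) (bilinL h) (goalDerivative K) C M) (hC : 0 ≤ C)
    (hTH : TH ∈ D.meshes) (href : Refines D.refine TH Th) :
    energyNorm A (D.uH A b c Th - D.uH A b c TH) ≤
      C * Crel * indicatorNorm (D.primalIndicator A b c TH) TH := by
  have hcea := hG.primal_cea (hD.isGalerkin_u h) (hD.isGalerkin_uH h Th)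
    (hD.X_mono hTH href (hD.uH_mem h TH))
  rw [mul_assoc]
  exact hcea.trans (mul_le_mul_of_nonneg_left (hD.adaptivity.reliability_eta TH hTH) hC)

theorem energyNorm_zH_sub_le (hD : D.Admissible A b c K Cmesh Cstab qred Crel Cdrel)
    (hG : GalerkinBounds (energyNorm A) (bilinL h) (goalDerivative K) C M) (hC : 0 ≤ C)
    (hTH : TH ∈ D.meshes) (href : Refines D.refine TH Th) (w : H10 Ω) :
    energyNorm A (D.zH A b c K w Th - D.zH A b c K w TH) ≤
      C * Crel * indicatorNorm (D.dualIndicator A b c K w TH) TH := by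
  have hcea := hG.dual_cea (isGalerkin_dual h K w isClosed_univ) (D.isGalerkin_zH h K w Th)
    (hD.X_mono hTH href (D.zH_mem h K w TH))
  rw [mul_assoc]
  exact hcea.trans (mul_le_mul_of_nonneg_left (hD.adaptivity.reliability_zeta TH hTH w) hC)

theorem indicatorNorm_primal_le_mul (hD : D.Admissible A b c K Cmesh Cstab qred Crel Cdrel)
    (hG : GalerkinBounds (energyNorm A) (bilinL h) (goalDerivative K) C M) (hC : 0 ≤ C)
    (hCstab : 0 ≤ Cstab) (hq0 : 0 ≤ qred) (hq1 : qred ≤ 1) (hTH : TH ∈ D.meshes)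
    (href : Refines D.refine TH Th) :
    indicatorNorm (D.primalIndicator A b c Th) Th ≤
      (1 + 2 * Cstab * (C * Crel)) * indicatorNorm (D.primalIndicator A b c TH) TH := by
  have hle := (hD.isReduction_primal h hCstab hTH href).le hq0 hq1
  have hE := mul_le_mul_of_nonneg_left (hD.energyNorm_uH_sub_le hG hC hTH href) hCstab
  linear_combination hle + 2 * hE

theorem indicatorNorm_dual_le_mul (hD : D.Admissible A b c K Cmesh Cstab qred Crel Cdrel)
    (hG : GalerkinBounds (energyNorm A) (bilinL h) (goalDerivative K) C M) (hC : 0 ≤ C)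
    (hCstab : 0 ≤ Cstab) (hq0 : 0 ≤ qred) (hq1 : qred ≤ 1) (hTH : TH ∈ D.meshes)
    (href : Refines D.refine TH Th) (w : H10 Ω) :
    indicatorNorm (D.dualIndicator A b c K w Th) Th ≤
      (1 + 2 * Cstab * (C * Crel)) * indicatorNorm (D.dualIndicator A b c K w TH) TH := by
  have hle := (hD.isReduction_dual h hCstab hTH href w).le hq0 hq1
  have hE := mul_le_mul_of_nonneg_left (hD.energyNorm_zH_sub_le hG hC hTH href w) hCstab
  linear_combination hle + 2 * hE

end Bounds

end Admissible

end Discretization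

/-! ### Linear convergence of the adaptive algorithm -/

theorem AdaptiveSequence.of_isReduction {α : Type*} [DecidableEq α] {f : ℕ → α → ℝ}
    {S : ℕ → Finset α} {q B : ℝ} {δ : ℕ → ℕ → ℝ} {M : ℝ → ℕ} (θ : ℝ) (hq0 : 0 ≤ q) (hq1 : q ≤ 1)
    (hred : ∀ k l, k ≤ l → IsReduction (f k) (f l) (S k) (S l) q (δ k l))
    (hrel : ∀ k l, k ≤ l → δ k l ≤ B * indicatorNorm (f k) (S k))
    (hosc : ∀ j, ∀ ε > 0, OscillationLE (fun k l => δ (j + k) (j + l))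
      (ε * indicatorNorm (f j) (S j)) (M ε)) :
    AdaptiveSequence (fun k => indicatorNorm (f k) (S k)) (fun k l => 2 * δ k l)
      {k | ∃ U ⊆ S k \ S (k + 1), θ * indicatorNorm (f k) (S k) ^ 2 ≤ indicatorNorm (f k) U ^ 2}
      (2 * B) √(1 - (1 - q ^ 2) * θ) (fun ε => M (ε / 2)) where
  nonneg k := indicatorNorm_nonneg _ _
  stability k l hkl := (hred k l hkl).le hq0 hq1
  reduction k := fun ⟨_, hU, hθ⟩ => (hred k (k + 1) k.le_succ).le_of_doerfler hq0 hq1 hU hθ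
  reliability k l hkl := by linarith [hrel k l hkl]
  oscillation j ε hε := (hosc j (ε / 2) (half_pos hε)).mono fun k l hkl => by linarith

namespace Discretization

variable {d : ℕ} {Ω : Set (E d)} {D : Discretization Ω}
  {A : E d → Matrix (Fin d) (Fin d) ℝ} {b : E d → E d} {c : E d → ℝ} {K : H10 Ω →L[ℝ] Hneg1 Ω}
  {Cmesh Cstab qred Crel Cdrel θ Cmark : ℝ} {TH Th : Mesh d} {𝒯 : ℕ → Mesh d}

section Marking

variable {U U' : Finset (Elem d)}

theorem DoerflerU.mono (hU : D.DoerflerU A b c θ TH U) (hUU' : U ⊆ U') :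
    D.DoerflerU A b c θ TH U' :=
  hU.trans (pow_le_pow_left₀ (Real.sqrt_nonneg _) (indicatorNorm_mono hUU') 2)

theorem DoerflerUZ.mono (hU : D.DoerflerUZ A b c K θ TH U) (hUU' : U ⊆ U') :
    D.DoerflerUZ A b c K θ TH U' := by
  rw [doerflerUZ_iff] at hU ⊢
  exact hU.trans (pow_le_pow_left₀ (indicatorNorm_nonneg _ _) (indicatorNorm_mono hUU') 2)

/-- Half of the refined set already satisfies one of the Dörfler criteria: the smaller one of the
two almost minimal sets is not truncated. -/
theorem Step.exists_marked (h : D.Step A b c K θ Cmark TH Th) :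
    ∃ M ⊆ TH, Th = D.refine TH M ∧
      (D.DoerflerU A b c θ TH M ∨ D.DoerflerUZ A b c K θ TH M) ∧
      ∀ M' ⊆ TH, D.DoerflerU A b c θ TH M' ∨ D.DoerflerUZ A b c K θ TH M' →
        (M.card : ℝ) ≤ 2 * Cmark * M'.card := by
  classical
  obtain ⟨Mu', Muz', Mu, Muz, ⟨hMu'TH, hDu, hmin_u⟩, ⟨hMuz'TH, hDuz, hmin_uz⟩, hMu, hMuz, hcard_u,
    hcard_uz, rfl⟩ := h
  refine ⟨Mu ∪ Muz, Finset.union_subset (hMu.trans hMu'TH) (hMuz.trans hMuz'TH), by congr!, ?_,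
    fun M' hM' hDM' => ?_⟩
  · rcases le_total Mu'.card Muz'.card with hle | hle
    · have heq : Mu = Mu' :=
        Finset.eq_of_subset_of_card_le hMu (by rw [hcard_u, min_eq_left hle])
      exact .inl (hDu.mono (heq ▸ Finset.subset_union_left))
    · have heq : Muz = Muz' :=
        Finset.eq_of_subset_of_card_le hMuz (by rw [hcard_uz, min_eq_right hle])
      exact .inr (hDuz.mono (heq ▸ Finset.subset_union_right))
  · have hcard : (Mu ∪ Muz).card ≤ 2 * min Mu'.card Muz'.card := by
      linarith [Finset.card_union_le Mu Muz]
    have hmin : ((min Mu'.card Muz'.card : ℕ) : ℝ) ≤ Cmark * M'.card := hDM'.elim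
      (fun hM => (Nat.cast_le.2 (min_le_left _ _)).trans (hmin_u M' hM' hM))
      (fun hM => (Nat.cast_le.2 (min_le_right _ _)).trans (hmin_uz M' hM' hM))
    have hcard' : ((Mu ∪ Muz).card : ℝ) ≤ 2 * (min Mu'.card Muz'.card : ℕ) := mod_cast hcard
    linarith

end Marking

namespace IsRun

theorem refines (h : D.IsRun A b c K θ Cmark 𝒯) {k l : ℕ} (hkl : k ≤ l) :
    Refines D.refine (𝒯 k) (𝒯 l) := by
  induction l, hkl using Nat.le_induction with
  | base => exact .refl
  | succ n _ ih =>
    obtain ⟨M, hM, hT, -⟩ := (h.2 n).exists_marked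
    exact ih.tail ⟨M, hM, hT⟩

theorem mem_meshes (h : D.IsRun A b c K θ Cmark 𝒯) (k : ℕ) : 𝒯 k ∈ D.meshes := by
  have href := h.refines (Nat.zero_le k)
  rwa [h.1] at href

/-- The nested finite element spaces of a run from step `j` on. -/
noncomputable def spaces (h : D.IsRun A b c K θ Cmark 𝒯)
    (hD : D.Admissible A b c K Cmesh Cstab qred Crel Cdrel) (j : ℕ) :
    ℕ →o ClosedSubmodule ℝ (H10 Ω) where
  toFun k := ⟨D.X (𝒯 (j + k)), isClosed_feSpace _ _⟩
  monotone' k _ hkl := hD.X_mono (h.mem_meshes (j + k)) (h.refines (Nat.add_le_add_left hkl j))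

section Linear

variable {h : AdmissibleCoefficients Ω A b c} {C : ℝ} {M : ℝ → ℕ}

theorem oscillation_uH (hrun : D.IsRun A b c K θ Cmark 𝒯)
    (hD : D.Admissible A b c K Cmesh Cstab qred Crel Cdrel)
    (hG : GalerkinBounds (energyNorm A) (bilinL h) (goalDerivative K) C M) (j : ℕ) {ε : ℝ}
    (hε : 0 < ε) :
    OscillationLE (fun k l => energyNorm A (D.uH A b c (𝒯 (j + l)) - D.uH A b c (𝒯 (j + k))))
      (ε * Crel * indicatorNorm (D.primalIndicator A b c (𝒯 j)) (𝒯 j)) (M ε) := by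
  have hosc := hG.primal_oscillation (X := hrun.spaces hD j) hε (hD.isGalerkin_u h)
    fun k => hD.isGalerkin_uH h (𝒯 (j + k))
  refine hosc.mono fun k l hkl => hkl.trans ?_
  rw [mul_assoc]
  exact mul_le_mul_of_nonneg_left (hD.adaptivity.reliability_eta _ (hrun.mem_meshes j)) hε.le

theorem oscillation_zH (hrun : D.IsRun A b c K θ Cmark 𝒯)
    (hD : D.Admissible A b c K Cmesh Cstab qred Crel Cdrel)
    (hG : GalerkinBounds (energyNorm A) (bilinL h) (goalDerivative K) C M) (j : ℕ) {ε : ℝ}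
    (hε : 0 < ε) :
    OscillationLE (fun k l => energyNorm A (D.zH A b c K (D.uH A b c (𝒯 (j + k))) (𝒯 (j + l)) -
        D.zH A b c K (D.uH A b c (𝒯 (j + k))) (𝒯 (j + k))))
      (ε * Crel * (indicatorNorm (D.primalIndicator A b c (𝒯 j)) (𝒯 j) +
        indicatorNorm (D.dualIndicator A b c K (D.uH A b c (𝒯 j)) (𝒯 j)) (𝒯 j))) (M ε) := by
  have hosc := hG.dual_oscillation (X := hrun.spaces hD j) hε (hD.isGalerkin_u h)
    (fun k => hD.isGalerkin_uH h (𝒯 (j + k))) (isGalerkin_dual h K _ isClosed_univ)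
    fun k l => D.isGalerkin_zH h K (D.uH A b c (𝒯 (j + k))) (𝒯 (j + l))
  refine hosc.mono fun k l hkl => hkl.trans ?_
  rw [mul_assoc, mul_add Crel]
  exact mul_le_mul_of_nonneg_left
    (add_le_add (hD.adaptivity.reliability_eta _ (hrun.mem_meshes j))
      (hD.adaptivity.reliability_zeta _ (hrun.mem_meshes j) _)) hε.le

open Classical in
theorem adaptiveSequence_primal (hrun : D.IsRun A b c K θ Cmark 𝒯)
    (hD : D.Admissible A b c K Cmesh Cstab qred Crel Cdrel)
    (hG : GalerkinBounds (energyNorm A) (bilinL h) (goalDerivative K) C M) (hC : 0 ≤ C)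
    (hCstab : 0 < Cstab) (hq0 : 0 ≤ qred) (hq1 : qred ≤ 1) (hCrel : 0 < Crel) :
    AdaptiveSequence (fun k => indicatorNorm (D.primalIndicator A b c (𝒯 k)) (𝒯 k))
      (fun k l => 2 * (Cstab * (C + 2) *
        energyNorm A (D.uH A b c (𝒯 l) - D.uH A b c (𝒯 k))))
      {k | ∃ U ⊆ 𝒯 k \ 𝒯 (k + 1), D.DoerflerU A b c θ (𝒯 k) U}
      (2 * (Cstab * (C + 2) * (2 * (C * Crel)))) √(1 - (1 - qred ^ 2) * θ)
      (fun ε => M (ε / 2 / (3 * (Cstab * (C + 2)) * Crel)) ^ 2) := by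
  refine .of_isReduction (M := fun ε => M (ε / (3 * (Cstab * (C + 2)) * Crel)) ^ 2) θ hq0 hq1
    (fun k l hkl => ?_) (fun k l hkl => ?_) fun j ε hε => ?_
  · refine (hD.isReduction_primal h hCstab.le (hrun.mem_meshes k) (hrun.refines hkl)).mono ?_
    exact mul_le_mul_of_nonneg_right (by nlinarith) (energyNorm_nonneg _ _)
  · have hη := indicatorNorm_nonneg (D.primalIndicator A b c (𝒯 k)) (𝒯 k)
    have hE := hD.energyNorm_uH_sub_le hG hC (hrun.mem_meshes k) (hrun.refines hkl)
    rw [mul_assoc _ _ (indicatorNorm _ _)]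
    gcongr
    linarith [mul_nonneg (mul_nonneg hC hCrel.le) hη]
  · have hη := indicatorNorm_nonneg (D.primalIndicator A b c (𝒯 j)) (𝒯 j)
    refine ((hrun.oscillation_uH hD hG j (ε := ε / (3 * (Cstab * (C + 2)) * Crel))
      (by positivity)).mono fun k l hkl => ?_).mono_count (Nat.le_self_pow two_ne_zero _)
    calc _ ≤ Cstab * (C + 2) * _ := mul_le_mul_of_nonneg_left hkl (by positivity)
      _ = ε / 3 * indicatorNorm (D.primalIndicator A b c (𝒯 j)) (𝒯 j) := by field_simp
      _ ≤ _ := by gcongr; linarith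

open Classical in
theorem adaptiveSequence_combined (hrun : D.IsRun A b c K θ Cmark 𝒯)
    (hD : D.Admissible A b c K Cmesh Cstab qred Crel Cdrel)
    (hG : GalerkinBounds (energyNorm A) (bilinL h) (goalDerivative K) C M) (hC : 0 ≤ C)
    (hCstab : 0 < Cstab) (hq0 : 0 ≤ qred) (hq1 : qred ≤ 1) (hCrel : 0 < Crel) :
    AdaptiveSequence (fun k => indicatorNorm (D.combinedIndicator A b c K (𝒯 k)) (𝒯 k))
      (fun k l => 2 * (Cstab * (C + 2) *
        (energyNorm A (D.uH A b c (𝒯 l) - D.uH A b c (𝒯 k)) +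
          energyNorm A (D.zH A b c K (D.uH A b c (𝒯 k)) (𝒯 l) -
            D.zH A b c K (D.uH A b c (𝒯 k)) (𝒯 k)))))
      {k | ∃ U ⊆ 𝒯 k \ 𝒯 (k + 1), D.DoerflerUZ A b c K θ (𝒯 k) U}
      (2 * (Cstab * (C + 2) * (2 * (C * Crel)))) √(1 - (1 - qred ^ 2) * θ)
      (fun ε => M (ε / 2 / (3 * (Cstab * (C + 2)) * Crel)) ^ 2) := by
  have hη_le := fun k => D.indicatorNorm_primal_le_combined A b c K (𝒯 k) (𝒯 k)
  have hζ_le := fun k => D.indicatorNorm_dual_le_combined A b c K (𝒯 k) (𝒯 k)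
  simp only [doerflerUZ_iff]
  refine .of_isReduction (M := fun ε => M (ε / (3 * (Cstab * (C + 2)) * Crel)) ^ 2) θ hq0 hq1
    (fun k l hkl => hD.isReduction_combined hG hC hCstab.le hq0 (hrun.mem_meshes k)
      (hrun.refines hkl)) (fun k l hkl => ?_) fun j ε hε => ?_
  · have hE := hD.energyNorm_uH_sub_le hG hC (hrun.mem_meshes k) (hrun.refines hkl)
    have hE' := hD.energyNorm_zH_sub_le hG hC (hrun.mem_meshes k) (hrun.refines hkl)
      (D.uH A b c (𝒯 k))
    rw [mul_assoc _ _ (indicatorNorm _ _), two_mul, add_mul]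
    gcongr
    · exact hE.trans (mul_le_mul_of_nonneg_left (hη_le k) (by positivity))
    · exact hE'.trans (mul_le_mul_of_nonneg_left (hζ_le k) (by positivity))
  · have hε' : 0 < ε / (3 * (Cstab * (C + 2)) * Crel) := by positivity
    rw [sq]
    refine ((hrun.oscillation_uH hD hG j hε').add (hrun.oscillation_zH hD hG j hε')).mono
      fun k l hkl => ?_
    calc _ ≤ Cstab * (C + 2) * _ := mul_le_mul_of_nonneg_left hkl (by positivity)
      _ = ε / 3 * (indicatorNorm (D.primalIndicator A b c (𝒯 j)) (𝒯 j) +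
          (indicatorNorm (D.primalIndicator A b c (𝒯 j)) (𝒯 j) + indicatorNorm
            (D.dualIndicator A b c K (D.uH A b c (𝒯 j)) (𝒯 j)) (𝒯 j))) := by field_simp
      _ ≤ ε / 3 * (3 * indicatorNorm (D.combinedIndicator A b c K (𝒯 j)) (𝒯 j)) := by
          gcongr
          linarith [hη_le j, hζ_le j]
      _ = _ := by ring

open Classical in
theorem doerfler_mem_or (hrun : D.IsRun A b c K θ Cmark 𝒯)
    (hD : D.Admissible A b c K Cmesh Cstab qred Crel Cdrel) (k : ℕ) :
    (∃ U ⊆ 𝒯 k \ 𝒯 (k + 1), D.DoerflerU A b c θ (𝒯 k) U) ∨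
      ∃ U ⊆ 𝒯 k \ 𝒯 (k + 1), D.DoerflerUZ A b c K θ (𝒯 k) U := by
  obtain ⟨U, hU, hrefine, hDoerfler, -⟩ := (hrun.2 k).exists_marked
  have hsub := hD.refinement.marked _ (hrun.mem_meshes k) U hU
  rw [← hrefine] at hsub
  exact hDoerfler.imp (fun hDU => ⟨U, hsub, hDU⟩) fun hDU => ⟨U, hsub, hDU⟩

end Linear

end IsRun

theorem exists_linear_convergence (hd : 0 < d) (hΩ : Bornology.IsBounded Ω)
    (h : AdmissibleCoefficients Ω A b c) (K : H10 Ω →L[ℝ] Hneg1 Ω) (hθ : 0 < θ)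
    (hCstab : 0 < Cstab) (hq0 : 0 ≤ qred) (hq1 : qred < 1) (hCrel : 0 < Crel) :
    ∃ Clin qlin : ℝ, 0 < Clin ∧ 0 < qlin ∧ qlin < 1 ∧
      ∀ {Cmark Cmesh Cdrel : ℝ} {D : Discretization Ω} {𝒯 : ℕ → Mesh d},
        D.Admissible A b c K Cmesh Cstab qred Crel Cdrel → D.IsRun A b c K θ Cmark 𝒯 →
        ∀ {l n : ℕ}, l ≤ n →
          D.estProduct A b c K (𝒯 n) ≤ Clin * qlin ^ (n - l) * D.estProduct A b c K (𝒯 l) := by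
  obtain ⟨C, M, hC, hG⟩ := exists_galerkinBounds hd hΩ h K
  have hρ : √(1 - (1 - qred ^ 2) * θ) < 1 := by
    rw [Real.sqrt_lt' one_pos]
    nlinarith [mul_pos (by nlinarith : 0 < 1 - qred ^ 2) hθ]
  obtain ⟨Clin, qlin, hClin, hqlin0, hqlin1, hlin⟩ := exists_linear_convergence_mul
    (B := 2 * (Cstab * (C + 2) * (2 * (C * Crel)))) (by positivity) (Real.sqrt_nonneg _) hρ
    fun ε => M (ε / 2 / (3 * (Cstab * (C + 2)) * Crel)) ^ 2
  refine ⟨Clin, qlin, hClin, hqlin0, hqlin1, fun hD hrun l n hln => ?_⟩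
  simp only [estProduct_eq_indicatorNorm_mul]
  exact hlin (hrun.adaptiveSequence_primal hD hG hC hCstab hq0 hq1.le hCrel)
    (hrun.adaptiveSequence_combined hD hG hC hCstab hq0 hq1.le hCrel)
    (Set.eq_univ_of_forall fun k => hrun.doerfler_mem_or hD k) hln

end Discretization

/-! ### Optimal rates -/

theorem mul_sqrt_lt_sqrt_one_sub {θ G : ℝ} (hG : 0 ≤ G) (hθ : θ < (1 + G ^ 2)⁻¹) :
    G * √θ < √(1 - θ) := by
  have hpos : 0 < 1 + G ^ 2 := by positivity
  have hθ_mul : θ * (1 + G ^ 2) < 1 := by rwa [← lt_div_iff₀ hpos, one_div]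
  have hθ_le : (1 + G ^ 2)⁻¹ ≤ 1 := inv_le_one_of_one_le₀ (by linarith [sq_nonneg G])
  rw [← Real.sqrt_sq hG, ← Real.sqrt_mul (sq_nonneg G)]
  exact (Real.sqrt_lt_sqrt_iff_of_pos (by linarith)).2 (by linarith)

/-- Optimality of Dörfler marking. If the refined elements did not satisfy the criterion, they would
carry less than `√θ` and the others more than `√(1 - θ)` of the estimator. -/
theorem doerfler_sdiff_of_inter_le {α : Type*} [DecidableEq α] {f : α → ℝ} {S S' : Finset α}
    {θ G : ℝ} (hθ : θ ≤ 1) (hG : 0 ≤ G)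
    (h : indicatorNorm f (S ∩ S') ≤
      (√(1 - θ) - G * √θ) * indicatorNorm f S + G * indicatorNorm f (S \ S')) :
    θ * indicatorNorm f S ^ 2 ≤ indicatorNorm f (S \ S') ^ 2 := by
  have hsplit := indicatorNorm_inter_sq_add_sdiff_sq f S S'
  have he := indicatorNorm_nonneg f S
  by_contra! hlt
  have hsdiff : indicatorNorm f (S \ S') ≤ √θ * indicatorNorm f S := by
    rw [← Real.sqrt_sq he, ← Real.sqrt_mul' _ (sq_nonneg _)]
    exact Real.le_sqrt_of_sq_le hlt.le
  have hinter : √(1 - θ) * indicatorNorm f S < indicatorNorm f (S ∩ S') := by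
    refine lt_of_pow_lt_pow_left₀ 2 (indicatorNorm_nonneg _ _) ?_
    rw [mul_pow, Real.sq_sqrt (sub_nonneg.2 hθ)]
    linarith
  linarith [mul_le_mul_of_nonneg_left hsdiff hG]

theorem exists_le_or_add_le_of_mul_le {ε B : ℝ} (hε : 0 < ε) (hB : 0 ≤ B) :
    ∃ κ > 0, ∀ {p ρ p' ρ' : ℝ}, 0 ≤ p → 0 ≤ ρ → p' ≤ ρ' → p' * ρ' ≤ κ * (p * ρ) →
      p' ≤ ε * p ∨ 2 * ρ' + B * p ≤ ε * ρ := by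
  refine ⟨ε * (ε ^ 2 / (2 * ε + B)), by positivity, fun {p ρ p' ρ'} hp hρ hp' hmul => ?_⟩
  by_contra! ⟨hlt, hlt'⟩
  have hρ' : ε ^ 2 / (2 * ε + B) * ρ < ρ' := by
    rw [div_mul_eq_mul_div, div_lt_iff₀ (by positivity)]
    nlinarith [mul_le_mul_of_nonneg_left (hlt.le.trans hp') hB]
  have := mul_lt_mul'' hlt hρ' (by positivity) (by positivity)
  linarith

theorem exists_mul_lt_of_ofReal_mul_iInf_lt {ι : Type*} {S : Set ι} {f : ι → ℝ} {x y : ℝ}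
    (hx : 0 < x) (h : ENNReal.ofReal x * ⨅ i ∈ S, ENNReal.ofReal (f i) < ENNReal.ofReal y) :
    ∃ i ∈ S, x * f i < y := by
  by_contra! hle
  refine h.not_ge ?_
  calc ENNReal.ofReal y = ENNReal.ofReal x * ENNReal.ofReal (y / x) := by
        rw [← ENNReal.ofReal_mul hx.le, mul_div_cancel₀ y hx.ne']
    _ ≤ _ := mul_le_mul_right (le_iInf₂ fun i hi =>
        ENNReal.ofReal_le_ofReal ((div_le_iff₀' hx).2 (hle i hi))) _

theorem mul_add_le_rpow_neg_min {n p z s t U Z : ℝ} (hn : 1 ≤ n) (hp : 0 ≤ p) (hz : 0 ≤ z)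
    (hU : n ^ s * p ≤ U) (hZ : n ^ t * z ≤ Z) :
    p * (p + z) ≤ U * (U + Z) * n ^ (-min (2 * s) (s + t)) := by
  have hn0 : 0 < n := by linarith
  have hU0 : 0 ≤ U := hU.trans' (by positivity)
  have hα := Real.rpow_pos_of_pos hn0 (min (2 * s) (s + t))
  have hss : n ^ min (2 * s) (s + t) ≤ n ^ s * n ^ s := by
    rw [← Real.rpow_add hn0, ← two_mul]
    exact Real.rpow_le_rpow_of_exponent_le hn (min_le_left _ _)
  have hst : n ^ min (2 * s) (s + t) ≤ n ^ s * n ^ t := by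
    rw [← Real.rpow_add hn0]
    exact Real.rpow_le_rpow_of_exponent_le hn (min_le_right _ _)
  rw [Real.rpow_neg hn0.le, ← div_eq_mul_inv, le_div_iff₀' hα]
  calc n ^ min (2 * s) (s + t) * (p * (p + z))
      = n ^ min (2 * s) (s + t) * (p * p) + n ^ min (2 * s) (s + t) * (p * z) := by ring
    _ ≤ n ^ s * n ^ s * (p * p) + n ^ s * n ^ t * (p * z) := by gcongr
    _ = n ^ s * p * (n ^ s * p) + n ^ s * p * (n ^ t * z) := by ring
    _ ≤ U * U + U * Z := by gcongr
    _ = U * (U + Z) := by ring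

theorem exists_nat_le_rpow_inv {α x : ℝ} (hα : 0 < α) (hx : 0 ≤ x) :
    ∃ N : ℕ, (N : ℝ) ≤ x ^ α⁻¹ ∧ x * ((N : ℝ) + 1) ^ (-α) ≤ 1 := by
  refine ⟨⌊x ^ α⁻¹⌋₊, Nat.floor_le (by positivity), ?_⟩
  rw [Real.rpow_neg (by positivity), ← div_eq_mul_inv, div_le_one (by positivity)]
  exact (Real.rpow_inv_le_iff_of_pos hx (by positivity) hα).1 (Nat.lt_floor_add_one _).le

theorem sum_range_pow_sub_le {r : ℝ} (hr0 : 0 ≤ r) (hr1 : r < 1) (l : ℕ) :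
    ∑ j ∈ Finset.range l, r ^ (l - j) ≤ (1 - r)⁻¹ := by
  calc ∑ j ∈ Finset.range l, r ^ (l - j) ≤ ∑ j ∈ Finset.range l, r ^ (l - 1 - j) :=
        Finset.sum_le_sum fun j _ => pow_le_pow_of_le_one hr0 hr1.le (by omega)
    _ = ∑ j ∈ Finset.range l, r ^ j := Finset.sum_range_reflect _ _
    _ ≤ ∑' j, r ^ j :=
        (summable_geometric_of_lt_one hr0 hr1).sum_le_tsum _ fun j _ => pow_nonneg hr0 j
    _ = (1 - r)⁻¹ := tsum_geometric_of_lt_one hr0 hr1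

section Complexity

variable {P m : ℕ → ℝ} {Clin q a y α x : ℝ} {l : ℕ}

theorem div_rpow_le_of_linear_convergence {j : ℕ} (hClin : 0 < Clin) (hq : 0 < q) (hα : 0 < α)
    (hy : 0 ≤ y) (hPl : 0 < P l) (hPj : 0 < P j) (hlin : P l ≤ Clin * q ^ (l - j) * P j) :
    (y / P j) ^ α⁻¹ ≤ (Clin * y / P l) ^ α⁻¹ * (q ^ α⁻¹) ^ (l - j) := by
  have hdiv : y / P j ≤ Clin * y / P l * q ^ (l - j) := by
    rw [div_mul_eq_mul_div, div_le_div_iff₀ hPj hPl]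
    calc y * P l ≤ y * (Clin * q ^ (l - j) * P j) := by gcongr
      _ = _ := by ring
  calc (y / P j) ^ α⁻¹ ≤ (Clin * y / P l * q ^ (l - j)) ^ α⁻¹ := by gcongr
    _ = _ := by
      rw [Real.mul_rpow (by positivity) (by positivity), ← Real.rpow_natCast_mul hq.le,
        ← Real.rpow_mul_natCast hq.le, mul_comm α⁻¹]

/-- Linear convergence makes the numbers of marked elements grow geometrically, so that their sum is
comparable to the last one. -/
theorem le_rpow_neg_of_linear_convergence (hClin : 0 < Clin) (hq0 : 0 < q) (hq1 : q < 1)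
    (ha : 0 ≤ a) (hy : 0 ≤ y) (hα : 0 < α) (hP : ∀ j ≤ l, 0 < P j)
    (hlin : ∀ j ≤ l, P l ≤ Clin * q ^ (l - j) * P j)
    (hm : ∀ j < l, m j ≤ a * (y / P j) ^ α⁻¹) (hx0 : 0 < x) (hx : x ≤ ∑ j ∈ Finset.range l, m j) :
    P l ≤ (a * (1 - q ^ α⁻¹)⁻¹) ^ α * (Clin * y) * x ^ (-α) := by
  have hPl := hP l le_rfl
  have hr1 : q ^ α⁻¹ < 1 := Real.rpow_lt_one hq0.le hq1 (by positivity)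
  have hr : 0 < 1 - q ^ α⁻¹ := sub_pos.2 hr1
  have hx_le : x ≤ a * (1 - q ^ α⁻¹)⁻¹ * (Clin * y / P l) ^ α⁻¹ := by
    calc x ≤ ∑ j ∈ Finset.range l, a * (y / P j) ^ α⁻¹ :=
          hx.trans (Finset.sum_le_sum fun j hj => hm j (Finset.mem_range.1 hj))
      _ ≤ ∑ j ∈ Finset.range l, a * ((Clin * y / P l) ^ α⁻¹ * (q ^ α⁻¹) ^ (l - j)) := by
          gcongr with j hj
          have hjl := (Finset.mem_range.1 hj).le
          exact div_rpow_le_of_linear_convergence hClin hq0 hα hy hPl (hP j hjl) (hlin j hjl)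
      _ = a * (Clin * y / P l) ^ α⁻¹ * ∑ j ∈ Finset.range l, (q ^ α⁻¹) ^ (l - j) := by
          simp only [Finset.mul_sum, mul_assoc]
      _ ≤ a * (Clin * y / P l) ^ α⁻¹ * (1 - q ^ α⁻¹)⁻¹ := by
          gcongr
          exact sum_range_pow_sub_le (by positivity) hr1 l
      _ = _ := by ring
  have hx_pow : x ^ α ≤ (a * (1 - q ^ α⁻¹)⁻¹) ^ α * (Clin * y / P l) := by
    have := Real.rpow_le_rpow hx0.le hx_le hα.le
    rwa [Real.mul_rpow (by positivity) (by positivity), Real.rpow_inv_rpow (by positivity) hα.ne']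
      at this
  rw [Real.rpow_neg hx0.le, ← div_eq_mul_inv, le_div_iff₀' (by positivity)]
  rwa [← mul_div_assoc, le_div_iff₀ hPl] at hx_pow

end Complexity

namespace Discretization

variable {d : ℕ} {Ω : Set (E d)} {D : Discretization Ω}
  {A : E d → Matrix (Fin d) (Fin d) ℝ} {b : E d → E d} {c : E d → ℝ} {K : H10 Ω →L[ℝ] Hneg1 Ω}
  {h : AdmissibleCoefficients Ω A b c} {C : ℝ} {M : ℝ → ℕ}
  {Cmesh Cstab qred Crel Cdrel θ Cmark : ℝ} {TH Th Tu Tz : Mesh d} {𝒯 : ℕ → Mesh d}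

namespace Admissible

section Marking

open Classical in
theorem indicatorNorm_primal_inter_le (hD : D.Admissible A b c K Cmesh Cstab qred Crel Cdrel)
    (h : AdmissibleCoefficients Ω A b c) (hCstab : 0 ≤ Cstab) (hTH : TH ∈ D.meshes)
    (href : Refines D.refine TH Th) :
    indicatorNorm (D.primalIndicator A b c TH) (TH ∩ Th) ≤
      Cstab * Cdrel * indicatorNorm (D.primalIndicator A b c TH) (TH \ Th) +
        indicatorNorm (D.primalIndicator A b c Th) Th := by
  have hstab := neg_le_of_abs_le (hD.abs_indicatorNorm_primal_sub_le h hTH href)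
  have hrel : energyNorm A (D.uH A b c Th - D.uH A b c TH) ≤
      Cdrel * indicatorNorm (D.primalIndicator A b c TH) (TH \ Th) :=
    hD.adaptivity.discreteReliability_eta TH hTH Th href
  have hmono := indicatorNorm_mono (f := D.primalIndicator A b c Th)
    (Finset.inter_subset_left : Th ∩ TH ⊆ Th)
  rw [Finset.inter_comm TH Th]
  linarith [mul_le_mul_of_nonneg_left hrel hCstab]

open Classical in
theorem indicatorNorm_dual_inter_le (hD : D.Admissible A b c K Cmesh Cstab qred Crel Cdrel)
    (h : AdmissibleCoefficients Ω A b c) (hCstab : 0 ≤ Cstab) (hTH : TH ∈ D.meshes)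
    (href : Refines D.refine TH Th) (w : H10 Ω) :
    indicatorNorm (D.dualIndicator A b c K w TH) (TH ∩ Th) ≤
      Cstab * Cdrel * indicatorNorm (D.dualIndicator A b c K w TH) (TH \ Th) +
        indicatorNorm (D.dualIndicator A b c K w Th) Th := by
  have hstab := neg_le_of_abs_le (hD.abs_indicatorNorm_dual_sub_le h hTH href w)
  have hrel : energyNorm A (D.zH A b c K w Th - D.zH A b c K w TH) ≤
      Cdrel * indicatorNorm (D.dualIndicator A b c K w TH) (TH \ Th) :=
    hD.adaptivity.discreteReliability_zeta TH hTH Th href w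
  have hmono := indicatorNorm_mono (f := D.dualIndicator A b c K w Th)
    (Finset.inter_subset_left : Th ∩ TH ⊆ Th)
  rw [Finset.inter_comm TH Th]
  linarith [mul_le_mul_of_nonneg_left hrel hCstab]

open Classical in
theorem indicatorNorm_combined_inter_le (hD : D.Admissible A b c K Cmesh Cstab qred Crel Cdrel)
    (hG : GalerkinBounds (energyNorm A) (bilinL h) (goalDerivative K) C M) (hC : 0 ≤ C)
    (hCstab : 0 ≤ Cstab) (hCrel : 0 ≤ Crel) (hCdrel : 0 ≤ Cdrel) (hTH : TH ∈ D.meshes)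
    (href : Refines D.refine TH Th) :
    indicatorNorm (D.combinedIndicator A b c K TH) (TH ∩ Th) ≤
      Cstab * Cdrel * indicatorNorm (D.combinedIndicator A b c K TH) (TH \ Th) +
        (2 * indicatorNorm (D.combinedIndicator A b c K Th) Th +
          Cstab * (C + 1) * (C * Crel) * indicatorNorm (D.primalIndicator A b c TH) TH) := by
  have hη := indicatorNorm_nonneg (D.primalIndicator A b c TH) TH
  have hρ := indicatorNorm_nonneg (D.combinedIndicator A b c K Th) Th
  have hprimal := (hD.indicatorNorm_primal_inter_le h hCstab hTH href).trans
    (add_le_add_right (D.indicatorNorm_primal_le_combined A b c K Th Th) _)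
  have hdual : indicatorNorm (D.dualIndicator A b c K (D.uH A b c TH) Th) Th ≤
      indicatorNorm (D.combinedIndicator A b c K Th) Th +
        Cstab * (C + 1) * (C * Crel) * indicatorNorm (D.primalIndicator A b c TH) TH := by
    calc _ ≤ indicatorNorm (D.dualIndicator A b c K (D.uH A b c Th) Th) Th +
          Cstab * (C + 1) * energyNorm A (D.uH A b c TH - D.uH A b c Th) :=
        hD.indicatorNorm_dual_le_add hG hCstab (mem_meshes_of_refines hTH href) _ _ subset_rfl
      _ ≤ _ := by
        rw [energyNorm_sub_comm h, mul_assoc _ (C * Crel)]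
        gcongr
        · exact D.indicatorNorm_dual_le_combined A b c K Th Th
        · exact hD.energyNorm_uH_sub_le hG hC hTH href
  refine (indicatorNorm_joint_le_mul_add (mul_nonneg hCstab hCdrel) hρ (by positivity) hprimal
    ((hD.indicatorNorm_dual_inter_le h hCstab hTH href _).trans
      (add_le_add_right hdual _))).trans_eq ?_
  rw [two_mul, add_assoc]
  rfl

end Marking

end Admissible

open Classical in
/-- A sufficiently large reduction of the estimator product reduces one of its two factors. -/
theorem exists_doerfler_of_reduction
    (hG : GalerkinBounds (energyNorm A) (bilinL h) (goalDerivative K) C M) (hC : 0 ≤ C)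
    (hCstab : 0 ≤ Cstab) (hCrel : 0 ≤ Crel) (hCdrel : 0 ≤ Cdrel)
    (hθ : θ < (1 + Cstab ^ 2 * Cdrel ^ 2)⁻¹) :
    ∃ κ > 0, ∀ {Cmesh qred : ℝ} {D : Discretization Ω} {TH Th : Mesh d},
      D.Admissible A b c K Cmesh Cstab qred Crel Cdrel → TH ∈ D.meshes →
      Refines D.refine TH Th → D.estProduct A b c K Th ≤ κ * D.estProduct A b c K TH →
      D.DoerflerU A b c θ TH (TH \ Th) ∨ D.DoerflerUZ A b c K θ TH (TH \ Th) := by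
  rw [← mul_pow] at hθ
  have hG0 : 0 ≤ Cstab * Cdrel := mul_nonneg hCstab hCdrel
  have hθ1 : θ ≤ 1 := hθ.le.trans (inv_le_one_of_one_le₀ (le_add_of_nonneg_right (sq_nonneg _)))
  obtain ⟨κ, hκ, hsplit⟩ := exists_le_or_add_le_of_mul_le
    (sub_pos.2 (mul_sqrt_lt_sqrt_one_sub hG0 hθ))
    (by positivity : 0 ≤ Cstab * (C + 1) * (C * Crel))
  refine ⟨κ, hκ, fun {Cmesh qred D TH Th} hD hTH href hred => ?_⟩
  rw [estProduct_eq_indicatorNorm_mul, estProduct_eq_indicatorNorm_mul] at hred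
  rw [doerflerU_iff, doerflerUZ_iff]
  refine (hsplit (indicatorNorm_nonneg _ _) (indicatorNorm_nonneg _ _)
    (D.indicatorNorm_primal_le_combined A b c K Th Th) hred).imp (fun hle => ?_) fun hle => ?_
  · refine doerfler_sdiff_of_inter_le hθ1 hG0 ?_
    linarith [hD.indicatorNorm_primal_inter_le h hCstab hTH href]
  · refine doerfler_sdiff_of_inter_le hθ1 hG0 ?_
    linarith [hD.indicatorNorm_combined_inter_le hG hC hCstab hCrel hCdrel hTH href]

namespace Admissible

theorem exists_overlay (hD : D.Admissible A b c K Cmesh Cstab qred Crel Cdrel) {N : ℕ}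
    (hTH : TH ∈ D.meshes) (hTu : Tu ∈ D.meshesUpTo N) (hTz : Tz ∈ D.meshesUpTo N) :
    ∃ Th, Refines D.refine TH Th ∧ Refines D.refine Tu Th ∧ Refines D.refine Tz Th ∧
      Th.card ≤ TH.card + 2 * N := by
  obtain ⟨To, hTHTo, hTuTo, hcard⟩ := hD.refinement.overlay TH Tu hTH hTu.1
  obtain ⟨Th, hToTh, hTzTh, hcard'⟩ :=
    hD.refinement.overlay To Tz (mem_meshes_of_refines hTH hTHTo) hTz.1
  have hcard_u := hTu.2
  have hcard_z := hTz.2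
  exact ⟨Th, hTHTo.trans hToTh, hTuTo.trans hToTh, hTzTh, by omega⟩

theorem indicatorNorm_combined_le (hD : D.Admissible A b c K Cmesh Cstab qred Crel Cdrel)
    (hG : GalerkinBounds (energyNorm A) (bilinL h) (goalDerivative K) C M) (hC : 0 ≤ C)
    (hCstab : 0 ≤ Cstab) (hTH : TH ∈ D.meshes) :
    indicatorNorm (D.combinedIndicator A b c K TH) TH ≤
      (1 + Cstab * (C + 1) * Crel) * indicatorNorm (D.primalIndicator A b c TH) TH +
        indicatorNorm (D.dualIndicator A b c K (D.u A b c) TH) TH := by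
  have hdual :=
    hD.indicatorNorm_dual_le_add hG hCstab hTH (D.uH A b c TH) (D.u A b c) subset_rfl
  have hrel : energyNorm A (D.u A b c - D.uH A b c TH) ≤
      Crel * indicatorNorm (D.primalIndicator A b c TH) TH :=
    hD.adaptivity.reliability_eta TH hTH
  rw [energyNorm_sub_comm h] at hdual
  have hcomb : indicatorNorm (D.combinedIndicator A b c K TH) TH ≤
      indicatorNorm (D.primalIndicator A b c TH) TH +
        indicatorNorm (D.dualIndicator A b c K (D.uH A b c TH) TH) TH :=
    indicatorNorm_joint_le_add _ _ _
  linarith [mul_le_mul_of_nonneg_left hrel (by positivity : 0 ≤ Cstab * (C + 1))]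

theorem estProduct_le_of_refines (hD : D.Admissible A b c K Cmesh Cstab qred Crel Cdrel)
    (hG : GalerkinBounds (energyNorm A) (bilinL h) (goalDerivative K) C M) (hC : 0 ≤ C)
    (hCstab : 0 ≤ Cstab) (hq0 : 0 ≤ qred) (hq1 : qred ≤ 1) (hCrel : 0 ≤ Crel)
    (hTu : Tu ∈ D.meshes) (hTz : Tz ∈ D.meshes) (hrefu : Refines D.refine Tu Th)
    (hrefz : Refines D.refine Tz Th) :
    D.estProduct A b c K Th ≤
      (1 + 2 * Cstab * (C * Crel)) ^ 2 * (1 + Cstab * (C + 1) * Crel) *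
        (indicatorNorm (D.primalIndicator A b c Tu) Tu *
          (indicatorNorm (D.primalIndicator A b c Tu) Tu +
            indicatorNorm (D.dualIndicator A b c K (D.u A b c) Tz) Tz)) := by
  have hp := hD.indicatorNorm_primal_le_mul hG hC hCstab hq0 hq1 hTu hrefu
  have hz := hD.indicatorNorm_dual_le_mul hG hC hCstab hq0 hq1 hTz hrefz (D.u A b c)
  have hcomb := hD.indicatorNorm_combined_le hG hC hCstab (mem_meshes_of_refines hTu hrefu)
  have hη := indicatorNorm_nonneg (D.primalIndicator A b c Tu) Tu
  have hζ := indicatorNorm_nonneg (D.dualIndicator A b c K (D.u A b c) Tz) Tz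
  set Q := 1 + 2 * Cstab * (C * Crel)
  set B := 1 + Cstab * (C + 1) * Crel
  have hQ : 0 ≤ Q := by positivity
  have hB : 1 ≤ B := le_add_of_nonneg_right (by positivity)
  rw [estProduct_eq_indicatorNorm_mul]
  set p := indicatorNorm (D.primalIndicator A b c Tu) Tu
  set z := indicatorNorm (D.dualIndicator A b c K (D.u A b c) Tz) Tz
  calc _ ≤ Q * p * (B * (Q * p) + B * (Q * z)) := by
        refine mul_le_mul hp (hcomb.trans (add_le_add (by gcongr) ?_)) (indicatorNorm_nonneg _ _)
          (by positivity)
        exact hz.trans (le_mul_of_one_le_left (by positivity) hB)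
    _ = _ := by ring

theorem exists_comparison_mesh (hD : D.Admissible A b c K Cmesh Cstab qred Crel Cdrel)
    (hG : GalerkinBounds (energyNorm A) (bilinL h) (goalDerivative K) C M) (hC : 0 ≤ C)
    (hCstab : 0 ≤ Cstab) (hq0 : 0 ≤ qred) (hq1 : qred ≤ 1) (hCrel : 0 ≤ Crel)
    {s t U Z : ℝ} (hU : D.approxU A b c s < ENNReal.ofReal U)
    (hZ : D.approxZ A b c K t < ENNReal.ofReal Z) (hTH : TH ∈ D.meshes) (N : ℕ) :
    ∃ Th, Refines D.refine TH Th ∧ Th.card ≤ TH.card + 2 * N ∧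
      D.estProduct A b c K Th ≤
        (1 + 2 * Cstab * (C * Crel)) ^ 2 * (1 + Cstab * (C + 1) * Crel) *
          (U * (U + Z) * ((N : ℝ) + 1) ^ (-min (2 * s) (s + t))) := by
  obtain ⟨Tu, hTu, hTuU⟩ := exists_mul_lt_of_ofReal_mul_iInf_lt (by positivity)
    ((le_iSup _ N).trans_lt hU)
  obtain ⟨Tz, hTz, hTzZ⟩ := exists_mul_lt_of_ofReal_mul_iInf_lt (by positivity)
    ((le_iSup _ N).trans_lt hZ)
  obtain ⟨Th, href, hrefu, hrefz, hcard⟩ := hD.exists_overlay hTH hTu hTz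
  refine ⟨Th, href, hcard, (hD.estProduct_le_of_refines hG hC hCstab hq0 hq1 hCrel hTu.1 hTz.1
    hrefu hrefz).trans ?_⟩
  exact mul_le_mul_of_nonneg_left (mul_add_le_rpow_neg_min (by simp) (indicatorNorm_nonneg _ _)
    (indicatorNorm_nonneg _ _) hTuU.le hTzZ.le) (by positivity)

end Admissible

theorem exists_doerfler_card_le
    (hG : GalerkinBounds (energyNorm A) (bilinL h) (goalDerivative K) C M) (hC : 0 ≤ C)
    (hCstab : 0 ≤ Cstab) (hq0 : 0 ≤ qred) (hq1 : qred ≤ 1) (hCrel : 0 ≤ Crel)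
    (hCdrel : 0 ≤ Cdrel) (hθ : θ < (1 + Cstab ^ 2 * Cdrel ^ 2)⁻¹) :
    ∃ Cm > 0, ∀ {Cmesh s t U Z : ℝ} {D : Discretization Ω} {TH : Mesh d},
      D.Admissible A b c K Cmesh Cstab qred Crel Cdrel → TH ∈ D.meshes →
      0 < min (2 * s) (s + t) → D.approxU A b c s < ENNReal.ofReal U →
      D.approxZ A b c K t < ENNReal.ofReal Z → 0 < D.estProduct A b c K TH →
      ∃ M ⊆ TH, (D.DoerflerU A b c θ TH M ∨ D.DoerflerUZ A b c K θ TH M) ∧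
        (M.card : ℝ) ≤
          2 * (Cm * (U * (U + Z)) / D.estProduct A b c K TH) ^ (min (2 * s) (s + t))⁻¹ := by
  classical
  obtain ⟨κ, hκ, hdoerfler⟩ := exists_doerfler_of_reduction hG hC hCstab hCrel hCdrel hθ
  set Ccmp := (1 + 2 * Cstab * (C * Crel)) ^ 2 * (1 + Cstab * (C + 1) * Crel) with hCcmp
  have hCcmp0 : 0 < Ccmp := by positivity
  refine ⟨Ccmp / κ, by positivity, fun {Cmesh s t U Z D TH} hD hTH hα hU hZ hP => ?_⟩
  have hU0 : 0 < U := ENNReal.ofReal_pos.1 (bot_le.trans_lt hU)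
  have hZ0 : 0 < Z := ENNReal.ofReal_pos.1 (bot_le.trans_lt hZ)
  obtain ⟨N, hN, hN'⟩ := exists_nat_le_rpow_inv hα
    (by positivity : 0 ≤ Ccmp / κ * (U * (U + Z)) / D.estProduct A b c K TH)
  obtain ⟨Th, href, hcard, hle⟩ := hD.exists_comparison_mesh hG hC hCstab hq0 hq1 hCrel hU hZ hTH N
  refine ⟨TH \ Th, Finset.sdiff_subset, hdoerfler hD hTH href ?_, ?_⟩
  · rw [← hCcmp] at hle
    calc D.estProduct A b c K Th
        ≤ Ccmp * (U * (U + Z) * ((N : ℝ) + 1) ^ (-min (2 * s) (s + t))) := hle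
      _ = κ * D.estProduct A b c K TH * (Ccmp / κ * (U * (U + Z)) / D.estProduct A b c K TH *
            ((N : ℝ) + 1) ^ (-min (2 * s) (s + t))) := by field_simp
      _ ≤ κ * D.estProduct A b c K TH := mul_le_of_le_one_right (by positivity) hN'
  · have hsons : (TH \ Th).card + TH.card ≤ Th.card := hD.refinement.sons TH Th hTH href
    have hcard_sdiff : ((TH \ Th).card : ℝ) ≤ 2 * N := mod_cast (by omega)
    linarith

theorem IsRun.exists_marked (hrun : D.IsRun A b c K θ Cmark 𝒯) :
    ∃ M : ℕ → Finset (Elem d), (∀ l, M l ⊆ 𝒯 l ∧ 𝒯 (l + 1) = D.refine (𝒯 l) (M l)) ∧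
      ∀ l, ∀ M' ⊆ 𝒯 l, D.DoerflerU A b c θ (𝒯 l) M' ∨ D.DoerflerUZ A b c K θ (𝒯 l) M' →
        ((M l).card : ℝ) ≤ 2 * Cmark * M'.card := by
  choose M hM hT _ hmin using fun l => (hrun.2 l).exists_marked
  exact ⟨M, fun l => ⟨hM l, hT l⟩, hmin⟩

section Rates

variable {α : ℝ}

theorem exists_estProduct_le (hd : 0 < d) (hΩ : Bornology.IsBounded Ω)
    (h : AdmissibleCoefficients Ω A b c) (K : H10 Ω →L[ℝ] Hneg1 Ω) (hθ0 : 0 < θ)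
    (hCstab : 0 < Cstab) (hq0 : 0 ≤ qred) (hq1 : qred < 1) (hCrel : 0 < Crel) (hCmark : 0 < Cmark)
    (hCmesh : 0 < Cmesh) (hCdrel : 0 ≤ Cdrel) (hα : 0 < α)
    (hθ : θ < (1 + Cstab ^ 2 * Cdrel ^ 2)⁻¹) :
    ∃ Copt > 0, ∀ {D : Discretization Ω} {𝒯 : ℕ → Mesh d} {s t U Z : ℝ},
      D.Admissible A b c K Cmesh Cstab qred Crel Cdrel → D.IsRun A b c K θ Cmark 𝒯 →
      α = min (2 * s) (s + t) → D.approxU A b c s < ENNReal.ofReal U →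
      D.approxZ A b c K t < ENNReal.ofReal Z → ∀ {l : ℕ}, D.T0.card < (𝒯 l).card →
        D.estProduct A b c K (𝒯 l) ≤
          Copt * (U * (U + Z)) * (((𝒯 l).card : ℝ) - D.T0.card) ^ (-α) := by
  obtain ⟨C, M, hC, hG⟩ := exists_galerkinBounds hd hΩ h K
  obtain ⟨Clin, q, hClin, hq0', hq1', hlin⟩ :=
    exists_linear_convergence hd hΩ h K hθ0 hCstab hq0 hq1 hCrel
  obtain ⟨Cm, hCm, hmark⟩ :=
    exists_doerfler_card_le hG hC hCstab.le hq0 hq1.le hCrel.le hCdrel hθ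
  have hr : 0 < 1 - q ^ α⁻¹ := sub_pos.2 (Real.rpow_lt_one hq0'.le hq1' (by positivity))
  refine ⟨(Cmesh * (4 * Cmark) * (1 - q ^ α⁻¹)⁻¹) ^ α * (Clin * Cm), by positivity,
    fun {D 𝒯 s t U Z} hD hrun hst hU hZ l hl => ?_⟩
  have hU0 : 0 < U := ENNReal.ofReal_pos.1 (bot_le.trans_lt hU)
  have hZ0 : 0 < Z := ENNReal.ofReal_pos.1 (bot_le.trans_lt hZ)
  have hl' : (0 : ℝ) < (𝒯 l).card - D.T0.card := sub_pos.2 (Nat.cast_lt.2 hl)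
  rcases le_or_gt (D.estProduct A b c K (𝒯 l)) 0 with hP0 | hP0
  · exact hP0.trans (by positivity)
  have hpos : ∀ j ≤ l, 0 < D.estProduct A b c K (𝒯 j) := fun j hj =>
    pos_of_mul_pos_right (hP0.trans_le (hlin hD hrun hj)) (by positivity)
  obtain ⟨M, hM, hmin⟩ := hrun.exists_marked
  have hcard := hD.refinement.meshClosure 𝒯 M hrun.1 hM l
  rw [Finset.mul_sum] at hcard
  have hmarked : ∀ j < l, Cmesh * (M j).card ≤
      Cmesh * (4 * Cmark) * (Cm * (U * (U + Z)) / D.estProduct A b c K (𝒯 j)) ^ α⁻¹ := by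
    intro j hj
    obtain ⟨M', hM', hdoerfler, hcard'⟩ :=
      hmark hD (hrun.mem_meshes j) (hst ▸ hα) hU hZ (hpos j hj.le)
    rw [← hst] at hcard'
    rw [mul_assoc]
    refine mul_le_mul_of_nonneg_left ((hmin j M' hM' hdoerfler).trans ?_) hCmesh.le
    linarith [mul_le_mul_of_nonneg_left hcard' (by positivity : 0 ≤ 2 * Cmark)]
  refine (le_rpow_neg_of_linear_convergence hClin hq0' hq1' (by positivity) (by positivity) hα
    hpos (fun j hj => hlin hD hrun hj) hmarked hl' hcard).trans_eq ?_
  ring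

theorem exists_optimal_rates (hd : 0 < d) (hΩ : Bornology.IsBounded Ω)
    (h : AdmissibleCoefficients Ω A b c) (K : H10 Ω →L[ℝ] Hneg1 Ω) (hθ0 : 0 < θ)
    (hCstab : 0 < Cstab) (hq0 : 0 ≤ qred) (hq1 : qred < 1) (hCrel : 0 < Crel) (hCmark : 0 < Cmark)
    (hCmesh : 0 < Cmesh) (hCdrel : 0 ≤ Cdrel) (hα : 0 < α)
    (hθ : θ < (1 + Cstab ^ 2 * Cdrel ^ 2)⁻¹) :
    ∃ Copt > 0, ∀ {D : Discretization Ω} {𝒯 : ℕ → Mesh d} {s t : ℝ},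
      D.Admissible A b c K Cmesh Cstab qred Crel Cdrel → D.IsRun A b c K θ Cmark 𝒯 →
      α = min (2 * s) (s + t) → D.approxU A b c s + D.approxZ A b c K t < ⊤ →
      ∀ {l : ℕ}, D.T0.card < (𝒯 l).card →
        D.estProduct A b c K (𝒯 l) ≤
          Copt * ((D.approxU A b c s).toReal *
            ((D.approxU A b c s).toReal + (D.approxZ A b c K t).toReal)) *
            (((𝒯 l).card : ℝ) - D.T0.card) ^ (-α) := by
  obtain ⟨Copt, hCopt, hle⟩ :=
    exists_estProduct_le hd hΩ h K hθ0 hCstab hq0 hq1 hCrel hCmark hCmesh hCdrel hα hθ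
  refine ⟨Copt, hCopt, fun {D 𝒯 s t} hD hrun hst hfin l hl => ?_⟩
  obtain ⟨hU, hZ⟩ := ENNReal.add_lt_top.1 hfin
  set U := (D.approxU A b c s).toReal
  set Z := (D.approxZ A b c K t).toReal
  have hcont : Continuous fun ε : ℝ => Copt * ((U + ε) * (U + ε + (Z + ε))) *
      (((𝒯 l).card : ℝ) - D.T0.card) ^ (-α) := by fun_prop
  refine ge_of_tendsto ((hcont.tendsto' 0 _ (by simp only [add_zero])).mono_left
    nhdsWithin_le_nhds) (Filter.eventually_of_mem (self_mem_nhdsWithin (s := Set.Ioi 0))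
      fun ε hε => hle hD hrun hst ?_ ?_ hl)
  · exact (ENNReal.lt_ofReal_iff_toReal_lt hU.ne).2 (lt_add_of_pos_right _ hε)
  · exact (ENNReal.lt_ofReal_iff_toReal_lt hZ.ne).2 (lt_add_of_pos_right _ hε)

end Rates

end Discretization

end GOAFEM

theorem theorem2p4_general {d : ℕ} (hd : 0 < d) (Ω : Set (GOAFEM.E d))
    (hΩb : Bornology.IsBounded Ω)
    (A : GOAFEM.E d → Matrix (Fin d) (Fin d) ℝ) (b : GOAFEM.E d → GOAFEM.E d)
    (c : GOAFEM.E d → ℝ) (hcoef : GOAFEM.AdmissibleCoefficients Ω A b c)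
    (K : GOAFEM.H10 Ω →L[ℝ] GOAFEM.Hneg1 Ω)
    (θ Cstab qred Crel : ℝ) (hθ0 : 0 < θ) (hCstab : 0 < Cstab)
    (hq0 : 0 ≤ qred) (hq1 : qred < 1) (hCrel : 0 < Crel) :
    ∃ Clin qlin : ℝ, 0 < Clin ∧ 0 < qlin ∧ qlin < 1 ∧
      (∀ Cmark Cmesh Cdrel : ℝ,
        ∀ D : GOAFEM.Discretization Ω, D.Admissible A b c K Cmesh Cstab qred Crel Cdrel →
        ∀ 𝒯 : ℕ → GOAFEM.Mesh d, D.IsRun A b c K θ Cmark 𝒯 →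
        ∀ l n : ℕ, l ≤ n →
          D.estProduct A b c K (𝒯 n) ≤ Clin * qlin ^ (n - l) * D.estProduct A b c K (𝒯 l)) ∧
      (∀ Cmark Cmesh Cdrel α : ℝ, 0 < Cmark → 0 < Cmesh → 0 ≤ Cdrel → 0 < α →
        θ < (1 + Cstab ^ 2 * Cdrel ^ 2)⁻¹ →
        ∃ Copt : ℝ, 0 < Copt ∧
          ∀ D : GOAFEM.Discretization Ω, D.Admissible A b c K Cmesh Cstab qred Crel Cdrel →
          ∀ 𝒯 : ℕ → GOAFEM.Mesh d, D.IsRun A b c K θ Cmark 𝒯 →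
          ∀ s t : ℝ, α = min (2 * s) (s + t) →
          D.approxU A b c s + D.approxZ A b c K t < ⊤ →
          ∀ l : ℕ, D.T0.card < (𝒯 l).card →
            D.estProduct A b c K (𝒯 l) ≤
              Copt * ((D.approxU A b c s).toReal *
                ((D.approxU A b c s).toReal + (D.approxZ A b c K t).toReal)) *
                (((𝒯 l).card : ℝ) - D.T0.card) ^ (-α)) := by
  obtain ⟨Clin, qlin, hClin, hqlin0, hqlin1, hlin⟩ :=
    GOAFEM.Discretization.exists_linear_convergence hd hΩb hcoef K hθ0 hCstab hq0 hq1 hCrel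
  refine ⟨Clin, qlin, hClin, hqlin0, hqlin1, fun Cmark Cmesh Cdrel D hD 𝒯 hrun l n hln =>
    hlin hD hrun hln, fun Cmark Cmesh Cdrel α hCmark hCmesh hCdrel hα hθ => ?_⟩
  obtain ⟨Copt, hCopt, hopt⟩ := GOAFEM.Discretization.exists_optimal_rates hd hΩb hcoef K hθ0
    hCstab hq0 hq1 hCrel hCmark hCmesh hCdrel hα hθ
  exact ⟨Copt, hCopt, fun D hD 𝒯 hrun s t hst hfin l hl => hopt hD hrun hst hfin hl⟩

theorem theorem2p4 {d : ℕ} (hd : 2 ≤ d) (Ω : Set (GOAFEM.E d)) (hΩo : IsOpen Ω)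
    (hΩb : Bornology.IsBounded Ω)
    (A : GOAFEM.E d → Matrix (Fin d) (Fin d) ℝ) (b : GOAFEM.E d → GOAFEM.E d)
    (c : GOAFEM.E d → ℝ) (hcoef : GOAFEM.AdmissibleCoefficients Ω A b c)
    (K : GOAFEM.H10 Ω →L[ℝ] GOAFEM.Hneg1 Ω) (hK : IsCompactOperator K)
    (θ Cstab qred Crel : ℝ) (hθ0 : 0 < θ) (hθ1 : θ ≤ 1) (hCstab : 0 < Cstab)
    (hq0 : 0 < qred) (hq1 : qred < 1) (hCrel : 0 < Crel) :
    ∃ (l₀ : ℕ) (Clin qlin : ℝ), 0 < Clin ∧ 0 < qlin ∧ qlin < 1 ∧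
      -- (i) linear convergence
      (∀ Cmark Cmesh Cdrel : ℝ, 1 ≤ Cmark → 0 < Cmesh → 0 < Cdrel →
        ∀ D : GOAFEM.Discretization Ω, D.Admissible A b c K Cmesh Cstab qred Crel Cdrel →
        ∀ 𝒯 : ℕ → GOAFEM.Mesh d, D.IsRun A b c K θ Cmark 𝒯 →
        ∀ l n : ℕ, l₀ ≤ l → l ≤ n →
          D.estProduct A b c K (𝒯 n) ≤ Clin * qlin ^ (n - l) * D.estProduct A b c K (𝒯 l)) ∧
      -- (ii) optimal rates
      (∀ Cmark Cmesh Cdrel α : ℝ, 1 ≤ Cmark → 0 < Cmesh → 0 < Cdrel → 0 < α →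
        θ < (1 + Cstab ^ 2 * Cdrel ^ 2)⁻¹ →
        ∃ Copt : ℝ, 0 < Copt ∧
          ∀ D : GOAFEM.Discretization Ω, D.Admissible A b c K Cmesh Cstab qred Crel Cdrel →
          ∀ 𝒯 : ℕ → GOAFEM.Mesh d, D.IsRun A b c K θ Cmark 𝒯 →
          ∀ s t : ℝ, 0 < s → 0 < t → α = min (2 * s) (s + t) →
          D.approxU A b c s + D.approxZ A b c K t < ⊤ →
          ∀ l : ℕ, l₀ ≤ l → D.T0.card < (𝒯 l).card →
            D.estProduct A b c K (𝒯 l) ≤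
              Copt * ((D.approxU A b c s).toReal *
                ((D.approxU A b c s).toReal + (D.approxZ A b c K t).toReal)) *
                (((𝒯 l).card : ℝ) - D.T0.card) ^ (-α)) := by
  obtain ⟨Clin, qlin, hClin, hqlin0, hqlin1, hlin, hopt⟩ := theorem2p4_general (by omega) Ω hΩb
    A b c hcoef K θ Cstab qred Crel hθ0 hCstab hq0.le hq1 hCrel
  refine ⟨0, Clin, qlin, hClin, hqlin0, hqlin1, fun _ _ _ _ _ _ D hD 𝒯 hrun l n _ =>
    hlin _ _ _ D hD 𝒯 hrun l n, fun Cmark Cmesh Cdrel α hCmark hCmesh hCdrel hα hθ => ?_⟩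
  obtain ⟨Copt, hCopt, hrate⟩ := hopt Cmark Cmesh Cdrel α (by linarith) hCmesh hCdrel.le hα hθ
  exact ⟨Copt, hCopt, fun D hD 𝒯 hrun s t _ _ hst hfin l _ => hrate D hD 𝒯 hrun s t hst hfin l⟩
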